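/- **Theorem 1.3.** Let $n\ge 1$, let $N$ be a lattice of rank $n$ with dual lattice $M=\operatorname{Hom}(N,\mathbb Z)$, and put $N_{\mathbb R}=N\otimes\mathbb R$, $M_{\mathbb R}=M\otimes\mathbb R$ with the pairing $\langle x,u\rangle$ for $x\in M_{\mathbb R}$, $u\in N_{\mathbb R}$. Let $\operatorname{vol}_M$ be the Haar measure on $M_{\mathbb R}$ for which a fundamental domain of $M$ has volume $1$. For $i=0,\dots,n$ let $g_i:Q_i\to\mathbb R$ be a continuous concave function on a nonempty rational polytope $Q_i\subseteq M_{\mathbb R}$, i.e. a bounded intersection of finitely many half-spaces $\{x:\langle x,u\rangle+c\ge 0\}$ with $u\in N$ and $c\in\mathbb R$. *Notation.* For $C\subseteq M_{\mathbb R}$ and $u\in N_{\mathbb R}$ let $C^u=\{x\in C:\langle x,u\rangle=\inf_{y\in C}\langle y,u\rangle\}$, and similarly in $M_{\mathbb R}\times\mathbb R$ with the pairing $\langle (x,t),(u,\lambda)\rangle=\langle x,u\rangle+t\lambda$. Let $\Psi_{Q_0}(u)=\min_{x\in Q_0}\langle x,u\rangle$, let $g_i^\vee(v)=\inf_{x\in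 Q_i}(\langle x,v\rangle-g_i(x))$ for $v\in N_{\mathbb R}$, and let $\Gamma_i=\{(x,t):x\in Q_i,\ t\le g_i(x)\}$ be the hypograph of $g_i$. For a nonempty set $I$ of indices, $\boxplus_{i\in I}g_i$ is the sup-convolution $x\mapsto\sup\{\sum_{i\in I} g_i(x_i):x_i\in Q_i,\ \sum_{i\in I} x_i=x\}$ on the Minkowski sum $\sum_{i\in I}Q_i$. With respect to a Haar measure $\mu$ on a real vector space of dimension $d$, the mixed integral of $d+1$ concave functions $h_0,\dots,h_d$ on convex bodies $B_0,\dots,B_d$ is $$\operatorname{MI}_\mu(h_0,\dots,h_d)=\sum_{\emptyset\ne I\subseteq\{0,\dots,d\}}(-1)^{d+1-|I|}\int_{\sum_{i\in I}B_i}\boxplus_{i\in I}h_i\,d\mu ,$$ and, for $d\ge 1$, the mixed volume of convex bodies $B_1,\dots,B_d$ is $\operatorname{MV}_\mu(B_1,\dots,B_d)=\sum_{\emptyset\ne I\subseteq\{1,\dots,d\}}(-1)^{d-|I|}\mu\big(\sum_{i\in I}B_i\big)$. The real Monge-Ampère measure of a concave function $f:N_{\mathbb R}\to\mathbb R$ is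 the Borel measure $\mathcal M_M(f)(A)=\operatorname{vol}_M\big(\bigcup_{v\in A}\partial f(v)\big)$ on $N_{\mathbb R}$, where $\partial f(v)=\{x\in M_{\mathbb R}: f(w)\le f(v)+\langle x,w-v\rangle\ \forall w\in N_{\mathbb R}\}$, and $$\operatorname{MM}_M(f_1,\dots,f_n)=\sum_{\emptyset\ne I\subseteq\{1,\dots,n\}}(-1)^{n-|I|}\mathcal M_M\Big(\sum_{i\in I}f_i\Big).$$ We write $\operatorname{MI}_M$ and $\operatorname{MV}_M$ when $\mu=\operatorname{vol}_M$. A vector $u\in N$ is primitive if it is nonzero and is not of the form $ku'$ with $k$ a positive integer and $u'\in N$, $u'\neq u$. For primitive $u$ put $u^\perp=\{x\in M_{\mathbb R}:\langle x,u\rangle=0\}$, $M(u)=M\cap u^\perp$ (a lattice in $u^\perp$), and let $\operatorname{MI}_{M(u)}$ be the mixed integral on $u^\perp$ with respect to $\operatorname{vol}_{M(u)}$; it is applied to the restrictions $g_i|_{Q_i^u}$, each regarded as a function on a subset of $u^\perp$ after translation of its domain by an arbitrary point of $Q_i^u$. *Statement.* The function $g_0^\vee$ is integrable with respect to $\operatorname{MM}_M(g_1^\vee,\dots,g_n^\vee)$,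 and $$\operatorname{MI}_M(g_0,\dots,g_n)=-\sum_{u\in N\text{ primitive}}\Psi_{Q_0}(u)\operatorname{MI}_{M(u)}\big(g_1|_{Q_1^u},\dots,g_n|_{Q_n^u}\big)-\int_{N_{\mathbb R}}g_0^\vee\,d\operatorname{MM}_M(g_1^\vee,\dots,g_n^\vee),$$ the sum having only finitely many nonzero terms. In particular, if every $g_i$ is piecewise affine on $Q_i$ (i.e. the minimum on $Q_i$ of finitely many affine functions), then, with $\pi:M_{\mathbb R}\times\mathbb R\to M_{\mathbb R}$ the projection onto the first factor, $$\operatorname{MI}_M(g_0,\dots,g_n)=-\sum_{u\in N\text{ primitive}}\Psi_{Q_0}(u)\operatorname{MI}_{M(u)}\big(g_1|_{Q_1^u},\dots,g_n|_{Q_n^u}\big)-\sum_{v\in N_{\mathbb R}}g_0^\vee(v)\operatorname{MV}_M\Big(\pi\big(\Gamma_1^{(v,-1)}\big),\dots,\pi\big(\Gamma_n^{(v,-1)}\big)\Big),$$ where the last sum also has only finitely many nonzero terms. -/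

import Mathlib

open MeasureTheory
open scoped Pointwise ENNReal NNReal

noncomputable section

namespace MixedInt

/-! ### Lattices, rational polytopes, faces

The lattice `M` is given inside its real vector space `E = M_ℝ`; the space `N_ℝ` is the dual
`StrongDual ℝ E` (all linear functionals, since `E` is finite dimensional), with the pairing
`⟨x, u⟩ = u x`. -/

section Lattice

variable {E : Type*} [NormedAddCommGroup E] [NormedSpace ℝ E]

/-- The dual lattice `N` of `M`: the functionals on `E` that take integer values on `M`. -/
def dualLattice (M : Submodule ℤ E) : Set (StrongDual ℝ E) :=
  {u | ∀ m ∈ M, ∃ k : ℤ, u m = k}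

/-- A primitive vector of `N`: nonzero, and not a positive integer multiple of another
element of `N`. -/
def IsPrimitive (M : Submodule ℤ E) (u : StrongDual ℝ E) : Prop :=
  u ∈ dualLattice M ∧ u ≠ 0 ∧
    ∀ u' ∈ dualLattice M, ∀ k : ℕ, 0 < k → k • u' = u → u' = u

/-- A rational polytope: a bounded intersection of finitely many closed half-spaces
`⟨x, u⟩ + c ≥ 0` with slopes `u ∈ N` and real constants `c`. -/
def IsRationalPolytope (M : Submodule ℤ E) (Q : Set E) : Prop :=
  Bornology.IsBounded Q ∧
    ∃ H : Finset (StrongDual ℝ E × ℝ), (∀ h ∈ H, h.1 ∈ dualLattice M) ∧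
      Q = {x | ∀ h ∈ H, 0 ≤ h.1 x + h.2}

/-- The set `C^u` of the points of `C` where the functional `u` attains its infimum on `C`. -/
def face (C : Set E) (u : StrongDual ℝ E) : Set E :=
  {x | x ∈ C ∧ ∀ y ∈ C, u x ≤ u y}

/-- The support function `Ψ_C(u) = min_{x ∈ C} ⟨x, u⟩`. -/
def supportFun (C : Set E) (u : StrongDual ℝ E) : ℝ :=
  sInf (u '' C)

/-- The lattice `M(u) = M ∩ u^⊥` in the real vector space `u^⊥`. -/
def perpLattice (M : Submodule ℤ E) (u : StrongDual ℝ E) : Submodule ℤ u.ker :=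
  M.comap (u.ker.subtype.restrictScalars ℤ)

/-- The Haar measure `vol_L`, normalized so that a fundamental domain of the lattice `L` has
volume `1`. -/
def latticeVolume [FiniteDimensional ℝ E] [MeasurableSpace E] [BorelSpace E]
    (L : Submodule ℤ E) : Measure E :=
  (ENNReal.ofReal (ZLattice.covolume L (Measure.addHaar : Measure E)))⁻¹ • Measure.addHaar

end Lattice

/-! ### Concave functions

A concave function with domain `Q` is a real function `g`, of which only the values on `Q`
matter (outside of `Q` the function is thought of as `-∞`). -/

section Functions

variable {E : Type*} [NormedAddCommGroup E] [NormedSpace ℝ E]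

/-- `g` is piecewise affine on `Q`: there it is the minimum of finitely many affine functions. -/
def IsPiecewiseAffineOn (Q : Set E) (g : E → ℝ) : Prop :=
  ∃ (S : Finset (StrongDual ℝ E)) (hS : S.Nonempty) (c : StrongDual ℝ E → ℝ),
    ∀ x ∈ Q, g x = S.inf' hS fun α => α x + c α

/-- The Legendre-Fenchel dual `g^∨(v) = inf_{x ∈ Q} (⟨x, v⟩ - g(x))` of `g` with domain `Q`. -/
def legendre (Q : Set E) (g : E → ℝ) (v : StrongDual ℝ E) : ℝ :=
  sInf ((fun x => v x - g x) '' Q)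

/-- The hypograph of `g` with domain `Q`. -/
def hypograph (Q : Set E) (g : E → ℝ) : Set (E × ℝ) :=
  {z | z.1 ∈ Q ∧ z.2 ≤ g z.1}

/-- The functional `(x, t) ↦ ⟨x, v⟩ + t * l` on `E × ℝ` given by `(v, l)`. -/
def pairing (v : StrongDual ℝ E) (l : ℝ) : StrongDual ℝ (E × ℝ) :=
  v.coprod (l • ContinuousLinearMap.id ℝ ℝ)

/-- The sup-convolution of the functions `g i` with domains `Q i`, `i ∈ I`; it is a function on
the Minkowski sum `∑ i ∈ I, Q i`. -/
def supConv {ι : Type*} (I : Finset ι) (Q : ι → Set E) (g : ι → E → ℝ) (v : E) : ℝ :=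
  sSup {s | ∃ x : ι → E, (∀ i ∈ I, x i ∈ Q i) ∧ ∑ i ∈ I, x i = v ∧ s = ∑ i ∈ I, g i (x i)}

end Functions

/-! ### Mixed volumes and mixed integrals -/

section Mixed

variable {E : Type*} [NormedAddCommGroup E] [NormedSpace ℝ E] [MeasurableSpace E]
  {ι : Type*} [Fintype ι]

/-- The mixed volume `∑ (-1)^(n - |I|) μ(∑_{i ∈ I} Q i)`, over the nonempty sets `I` of the `n`
indices. -/
def mixedVolume (μ : Measure E) (Q : ι → Set E) : ℝ :=
  ∑ I : Finset ι with I.Nonempty,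
    (-1 : ℝ) ^ (Fintype.card ι - I.card) * μ.real (∑ i ∈ I, Q i)

/-- The mixed integral: the polarization of the integral of a concave function over its
domain. For `n + 1` functions the sign `(-1)^(n + 1 - |I|)` is `(-1)^(n - k)` with
`|I| = k + 1`. -/
def mixedIntegral (μ : Measure E) (Q : ι → Set E) (g : ι → E → ℝ) : ℝ :=
  ∑ I : Finset ι with I.Nonempty,
    (-1 : ℝ) ^ (Fintype.card ι - I.card) * ∫ x in ∑ i ∈ I, Q i, supConv I Q g x ∂μ

/-- The mixed integral, with respect to `vol_{M(u)}`, of the restrictions of the `g i` to the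
faces `(Q i)^u`. These faces lie in translates of `u^⊥`; they are moved into `u^⊥` by
subtracting the point `p i` of `(Q i)^u`. -/
def faceMixedIntegral [FiniteDimensional ℝ E] [BorelSpace E] (M : Submodule ℤ E)
    (u : StrongDual ℝ E) (p : ι → E) (Q : ι → Set E) (g : ι → E → ℝ) : ℝ :=
  mixedIntegral (latticeVolume (perpLattice M u))
    (fun i => {y : u.ker | p i + y ∈ face (Q i) u}) (fun i y => g i (p i + y))

end Mixed

/-! ### Real Monge-Ampère measures -/

section MongeAmpere

variable {E : Type*} [NormedAddCommGroup E] [NormedSpace ℝ E]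

/-- The sup-differential of `f : N_ℝ → ℝ` at `v`, a subset of `M_ℝ`. -/
def supDiff (f : StrongDual ℝ E → ℝ) (v : StrongDual ℝ E) : Set E :=
  {x | ∀ w, f w ≤ f v + (w - v) x}

variable [MeasurableSpace E]

/-- The set function `A ↦ μ(⋃_{v ∈ A} ∂f(v))` on all subsets of `N_ℝ`. -/
def mongeAmpereOuter (μ : Measure E) (f : StrongDual ℝ E → ℝ) :
    OuterMeasure (StrongDual ℝ E) where
  measureOf A := μ (⋃ v ∈ A, supDiff f v)
  empty := by simp
  mono {A B} h := measure_mono (Set.biUnion_subset_biUnion_left h)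
  iUnion_nat s _ := by
    rw [Set.biUnion_iUnion]
    exact measure_iUnion_le _

open scoped Classical in
/-- The real Monge-Ampère measure `A ↦ μ(∂f(A))` on the Borel sets of `N_ℝ`. For continuous `f`
(in particular for concave `f`) the first case applies, by `borel_le_caratheodory` below. -/
def mongeAmpere (μ : Measure E) (f : StrongDual ℝ E → ℝ) : Measure (StrongDual ℝ E) :=
  if h : (inferInstance : MeasurableSpace (StrongDual ℝ E)) ≤
      (mongeAmpereOuter μ f).caratheodory
  then (mongeAmpereOuter μ f).toMeasure h else 0

open scoped Classical in
/-- A finite measure as a signed measure (and `0` for an infinite one). -/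
def toSigned {X : Type*} [MeasurableSpace X] (μ : Measure X) : SignedMeasure X :=
  if _h : IsFiniteMeasure μ then μ.toSignedMeasure else 0

/-- The mixed real Monge-Ampère measure
`∑ (-1)^(n - |I|) M_μ(∑_{i ∈ I} f i)`, over the nonempty sets `I` of the `n` indices, for
functions such that the measures `M_μ(∑_{i ∈ I} f i)` are finite. -/
def mixedMongeAmpere {ι : Type*} [Fintype ι] (μ : Measure E)
    (f : ι → StrongDual ℝ E → ℝ) : SignedMeasure (StrongDual ℝ E) :=
  ∑ I : Finset ι with I.Nonempty,
    (-1 : ℝ) ^ (Fintype.card ι - I.card) • toSigned (mongeAmpere μ (∑ i ∈ I, f i))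

end MongeAmpere

/-! ### The real Monge-Ampère set functions are measures

These facts show that the case distinctions in the definitions above are harmless. -/


section Justification

variable {E : Type*} [NormedAddCommGroup E] [NormedSpace ℝ E]

lemma isClosed_supDiff_of_isCompact {f : StrongDual ℝ E → ℝ} (hf : Continuous f)
    {K : Set (StrongDual ℝ E)} (hK : IsCompact K) : IsClosed (⋃ v ∈ K, supDiff f v) := by
  have : CompactSpace K := isCompact_iff_compactSpace.mp hK
  have hC : IsClosed {z : K × E | z.2 ∈ supDiff f z.1} := by
    have h0 : {z : K × E | z.2 ∈ supDiff f z.1} =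
        ⋂ w : StrongDual ℝ E, {z : K × E | f w ≤ f z.1 + (w - (z.1 : StrongDual ℝ E)) z.2} := by
      ext z
      rw [Set.mem_iInter]
      rfl
    rw [h0]
    refine isClosed_iInter fun w => isClosed_le continuous_const ?_
    have h1 : Continuous fun z : K × E => (w - (z.1 : StrongDual ℝ E)) z.2 :=
      (continuous_const.sub (continuous_subtype_val.comp continuous_fst)).clm_apply continuous_snd
    exact (hf.comp (continuous_subtype_val.comp continuous_fst)).add h1
  convert isClosedMap_snd_of_compactSpace _ hC using 1
  ext x
  simp

variable [FiniteDimensional ℝ E] [MeasurableSpace E] [BorelSpace E]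

lemma measure_supDiff_overlap (μ : Measure E) [μ.IsAddHaarMeasure] {f : StrongDual ℝ E → ℝ}
    (hf : Continuous f) :
    ∀ᵐ x ∂μ, ∀ v w, x ∈ supDiff f v → x ∈ supDiff f w → v = w := by
  set h : ℕ → E → ℝ := fun k x =>
    sInf ((fun u : StrongDual ℝ E => u x - f u) '' Metric.closedBall 0 k) with hh
  have bdd : ∀ (k : ℕ) x, BddBelow ((fun u : StrongDual ℝ E => u x - f u) ''
      Metric.closedBall 0 (k : ℝ)) := fun k x =>
    ((isCompact_closedBall _ _).image (by fun_prop)).bddBelow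
  have lip : ∀ k : ℕ, LipschitzWith k (h k) := by
    intro k
    refine LipschitzWith.of_le_add_mul _ fun x y => ?_
    rw [← sub_le_iff_le_add]
    refine le_csInf (Set.Nonempty.image _ ⟨0, by simp⟩) ?_
    rintro _ ⟨u, hu, rfl⟩
    have h1 : h k x ≤ u x - f u := csInf_le (bdd k x) ⟨u, hu, rfl⟩
    have h2 : u (x - y) ≤ k * dist x y := by
      rw [dist_eq_norm]
      refine (le_abs_self _).trans ((u.le_opNorm _).trans ?_)
      gcongr
      simpa using hu
    rw [map_sub] at h2
    simp only [NNReal.coe_natCast]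
    linarith
  have key : ∀ (k : ℕ) x v, ‖v‖ ≤ (k : ℝ) → x ∈ supDiff f v → DifferentiableAt ℝ (h k) x →
      v = fderiv ℝ (h k) x := by
    intro k x v hv hx hd
    have hmem : v ∈ Metric.closedBall (0 : StrongDual ℝ E) (k : ℝ) := by simpa using hv
    have hle : ∀ y, h k y ≤ v y - f v := fun y => csInf_le (bdd k y) ⟨v, hmem, rfl⟩
    have hge : v x - f v ≤ h k x := by
      refine le_csInf (Set.Nonempty.image _ ⟨0, by simp⟩) ?_
      rintro _ ⟨w, -, rfl⟩
      have := hx w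
      simp only [sub_apply] at this
      simp only
      linarith
    have hmin : IsLocalMin (fun y => v y - h k y) x :=
      Filter.Eventually.of_forall fun y => by
        have := hle y
        simp only
        linarith
    have := hmin.hasFDerivAt_eq_zero (v.hasFDerivAt.sub hd.hasFDerivAt)
    exact sub_eq_zero.mp this
  have hae : ∀ᵐ x ∂μ, ∀ k, DifferentiableAt ℝ (h k) x :=
    ae_all_iff.mpr fun k => (lip k).ae_differentiableAt
  filter_upwards [hae] with x hx v w hv hw
  obtain ⟨k, hk⟩ := exists_nat_ge (max ‖v‖ ‖w‖)
  rw [key k x v ((le_max_left _ _).trans hk) hv (hx k),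
    key k x w ((le_max_right _ _).trans hk) hw (hx k)]

/-- For continuous `f` the set function `A ↦ μ(∂f(A))` is countably additive on the Borel sets. -/
theorem borel_le_caratheodory (μ : Measure E) [μ.IsAddHaarMeasure] {f : StrongDual ℝ E → ℝ}
    (hf : Continuous f) :
    (inferInstance : MeasurableSpace (StrongDual ℝ E)) ≤
      (mongeAmpereOuter μ f).caratheodory := by
  have hb : (inferInstance : MeasurableSpace (StrongDual ℝ E)) = borel _ :=
    BorelSpace.measurable_eq
  rw [hb, borel_eq_generateFrom_isClosed]
  refine MeasurableSpace.generateFrom_le fun F hF => ?_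
  rw [OuterMeasure.isCaratheodory_iff_le]
  intro t
  change μ (⋃ v ∈ t ∩ F, supDiff f v) + μ (⋃ v ∈ t \ F, supDiff f v) ≤ μ (⋃ v ∈ t, supDiff f v)
  set S : Set E := ⋃ k : ℕ, ⋃ v ∈ F ∩ Metric.closedBall 0 (k : ℝ), supDiff f v
  have hS : MeasurableSet S := MeasurableSet.iUnion fun k =>
    (isClosed_supDiff_of_isCompact hf ((isCompact_closedBall 0 (k : ℝ)).inter_left hF)).measurableSet
  rw [← measure_inter_add_sdiff (⋃ v ∈ t, supDiff f v) hS]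
  refine add_le_add (measure_mono ?_) (measure_mono_ae ?_)
  · intro x hx
    simp only [Set.mem_iUnion, exists_prop] at hx
    obtain ⟨v, ⟨hvt, hvF⟩, hx⟩ := hx
    obtain ⟨k, hk⟩ := exists_nat_ge ‖v‖
    refine ⟨Set.mem_biUnion hvt hx, Set.mem_iUnion.mpr ⟨k, Set.mem_biUnion ⟨hvF, ?_⟩ hx⟩⟩
    simpa using hk
  · filter_upwards [measure_supDiff_overlap μ hf] with x huniq hx
    have hx' : x ∈ ⋃ v ∈ t \ F, supDiff f v := hx
    simp only [Set.mem_iUnion, exists_prop] at hx'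
    obtain ⟨v, ⟨hvt, hvF⟩, hxv⟩ := hx'
    refine ⟨Set.mem_biUnion hvt hxv, fun hxS => ?_⟩
    simp only [S, Set.mem_iUnion, exists_prop] at hxS
    obtain ⟨k, w, ⟨hwF, -⟩, hxw⟩ := hxS
    exact hvF (huniq v w hxv hxw ▸ hwF)

/-- The defining property of the real Monge-Ampère measure. -/
theorem mongeAmpere_apply (μ : Measure E) [μ.IsAddHaarMeasure] {f : StrongDual ℝ E → ℝ}
    (hf : Continuous f) {A : Set (StrongDual ℝ E)} (hA : MeasurableSet A) :
    mongeAmpere μ f A = μ (⋃ v ∈ A, supDiff f v) := by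
  rw [mongeAmpere, dif_pos (borel_le_caratheodory μ hf)]
  exact toMeasure_apply _ _ hA

lemma isFiniteMeasure_mongeAmpere (μ : Measure E) [μ.IsAddHaarMeasure]
    {f : StrongDual ℝ E → ℝ} {C : ℝ≥0} (hf : LipschitzWith C f) :
    IsFiniteMeasure (mongeAmpere μ f) := by
  refine ⟨?_⟩
  rw [mongeAmpere_apply μ hf.continuous MeasurableSet.univ]
  refine (measure_mono (t := Metric.closedBall (0 : E) C) ?_).trans_lt measure_closedBall_lt_top
  intro x hx
  simp only [Set.mem_iUnion, exists_prop] at hx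
  obtain ⟨v, -, hx⟩ := hx
  have hlow : ∀ u : StrongDual ℝ E, -(C * ‖u‖) ≤ u x := fun u => by
    have h1 := hx (v + u)
    have h2 := (abs_le.mp ((Real.dist_eq _ _).symm.le.trans (hf.dist_le_mul (v + u) v))).1
    simp only [add_sub_cancel_left] at h1
    rw [dist_eq_norm, add_sub_cancel_left] at h2
    linarith
  rw [mem_closedBall_zero_iff]
  refine NormedSpace.norm_le_dual_bound ℝ x C.2 fun u => ?_
  have h1 := hlow u
  have h2 := hlow (-u)
  rw [norm_neg, neg_apply] at h2
  rw [Real.norm_eq_abs, abs_le]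
  exact ⟨h1, by simpa using neg_le_neg h2⟩

/-- For Lipschitz functions, such as the Legendre-Fenchel duals of continuous functions on
polytopes, the mixed real Monge-Ampère measure is the expected set function. -/
theorem mixedMongeAmpere_apply {ι : Type*} [Fintype ι] (μ : Measure E) [μ.IsAddHaarMeasure]
    {f : ι → StrongDual ℝ E → ℝ} {C : ι → ℝ≥0} (hf : ∀ i, LipschitzWith (C i) (f i))
    {A : Set (StrongDual ℝ E)} (hA : MeasurableSet A) :
    mixedMongeAmpere μ f A = ∑ I : Finset ι with I.Nonempty,
      (-1 : ℝ) ^ (Fintype.card ι - I.card) * μ.real (⋃ v ∈ A, supDiff (∑ i ∈ I, f i) v) := by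
  have hsum : ∀ I : Finset ι, LipschitzWith (∑ i ∈ I, C i) (∑ i ∈ I, f i) := fun I => by
    classical
    induction I using Finset.induction_on with
    | empty => simp
    | insert a s ha ih =>
      rw [Finset.sum_insert ha, Finset.sum_insert ha]
      exact (hf a).add ih
  have hcoe : ∀ S : Finset (Finset ι), (∑ I ∈ S, (-1 : ℝ) ^ (Fintype.card ι - I.card) •
      toSigned (mongeAmpere μ (∑ i ∈ I, f i))) A = ∑ I ∈ S, (-1 : ℝ) ^ (Fintype.card ι - I.card) *
      toSigned (mongeAmpere μ (∑ i ∈ I, f i)) A := fun S => by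
    classical
    induction S using Finset.induction_on with
    | empty => simp
    | insert a s ha ih =>
      rw [Finset.sum_insert ha, Finset.sum_insert ha, ← ih]
      simp
  rw [mixedMongeAmpere, hcoe]
  refine Finset.sum_congr rfl fun I _ => ?_
  have hfin := isFiniteMeasure_mongeAmpere μ (hsum I)
  rw [toSigned, dif_pos hfin, Measure.toSignedMeasure_apply_measurable hA, Measure.real,
    mongeAmpere_apply μ (hsum I).continuous hA, Measure.real]

end Justification

/-- The dual of a continuous function on a nonempty compact set is a Lipschitz function. -/
lemma exists_lipschitzWith_legendre {E : Type*} [NormedAddCommGroup E] [NormedSpace ℝ E]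
    {Q : Set E} {g : E → ℝ} (hQ : IsCompact Q) (hne : Q.Nonempty) (hg : ContinuousOn g Q) :
    ∃ C : ℝ≥0, LipschitzWith C (legendre Q g) := by
  obtain ⟨C, hC⟩ := hQ.isBounded.exists_norm_le
  refine ⟨C.toNNReal, LipschitzWith.of_le_add_mul _ fun v w => ?_⟩
  have bdd : ∀ v : StrongDual ℝ E, BddBelow ((fun x => v x - g x) '' Q) := fun v =>
    (hQ.image_of_continuousOn (v.continuous.continuousOn.sub hg)).bddBelow
  rw [← sub_le_iff_le_add]
  refine le_csInf (hne.image _) ?_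
  rintro _ ⟨x, hx, rfl⟩
  have h1 : legendre Q g v ≤ v x - g x := csInf_le (bdd v) ⟨x, hx, rfl⟩
  have h2 : (v - w) x ≤ C.toNNReal * dist v w := by
    rw [dist_eq_norm, mul_comm]
    refine (le_abs_self _).trans (((v - w).le_opNorm x).trans ?_)
    gcongr
    exact (hC x hx).trans (Real.le_coe_toNNReal C)
  rw [sub_apply] at h2
  linarith

end MixedInt

end

open MeasureTheory
open scoped Pointwise ENNReal NNReal

noncomputable section

set_option linter.unusedSectionVars false

namespace MixedInt

/-! ### Fourier-Motzkin elimination -/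

section Elimination

variable {W : Type*} [AddCommGroup W] [Module ℝ W]

/-! For nonnegative weights `l`, let F(l) be the integral of the weighted sup-convolution `wfun Q g
l` over the weighted Minkowski sum `wsum Q l`. Up to the sign (-1)^(n+1), the mixed integral is the
alternating sum of F over the 0/1 weights. The proof rests on two facts about F.

F behaves like a polynomial of degree at most n + 1: its mixed differences of order n + 2 vanish
(`sum_integral_wfun`). For volumes of weighted sums of polytopes this is an induction on the
dimension, because the derivative in a weight is a combination of volumes of faces. Convex bodies
follow by outer approximation, and functions by passing to their subgraphs in E × ℝ. Consequently
A(t), the alternating sum over I ⊆ {1, …, n} of F(1_I + t e_0), has vanishing second differences,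
and A(1) - A(0) equals the right derivative of A at 0 (`sum_weight_eq_of_slopes`).

That derivative is computed by a first variation (`IsDilation.tendsto_slope`). If a concave g on a
polytope Q is sup-convolved with the ε-dilation of g₀ on Q₀, the integral changes to first order in
two ways. The domain gains a layer of thickness -ε Ψ_{Q₀}(u) along the face with inner normal u,
which gives the boundary terms. At an interior point of differentiability g(x) grows by ε times the
maximum over y of g₀(y) - ∇g(x)·y, that is, by -ε g₀^∨(∇g(x)). This picture needs 0 ∈ Q₀; the
general case follows by translation, the correction being the divergence theorem for g. Passing to
the limit under the integral uses that the gradient of a continuous concave function on a convex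
body is integrable (`integrableOn_fderiv`).

Taking the alternating sum over I turns the boundary terms into mixed integrals of the restrictions
to faces, since faces of sums are sums of faces. It turns the gradient terms into the integral
against the mixed Monge-Ampère measure, since the measure of g^∨ is the image of Lebesgue measure
under ∇g (`mongeAmpere_legendre`) and the dual of a sup-convolution is the sum of the duals
(`legendre_wsum`).

Rationality enters through Fourier-Motzkin elimination over ℤ: one finite set of primitive normals
cuts out all weighted sums (`exists_primitive_normals`), and for primitive u the volume of M
disintegrates into Lebesgue measure and the volume of M(u) (`isDisintegration_latticeVolume`). In
the piecewise affine case the same elimination, applied to subgraphs, confines gradients to a finite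
set almost everywhere, and the cell with gradient v is the projection of the face of the hypograph
selected by (v, -1). -/

lemma exists_between_finsets (A B : Finset ℝ) (h : ∀ a ∈ A, ∀ b ∈ B, a ≤ b) :
    ∃ t, (∀ a ∈ A, a ≤ t) ∧ ∀ b ∈ B, t ≤ b := by
  rcases A.eq_empty_or_nonempty with rfl | hA
  · rcases B.eq_empty_or_nonempty with rfl | hB
    · exact ⟨0, by simp, by simp⟩
    · exact ⟨B.min' hB, by simp, fun b hb => B.min'_le b hb⟩
  · exact ⟨A.max' hA, fun a ha => A.le_max' a ha, fun b hb => A.max'_le hA b fun a ha => h a ha b hb⟩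

open scoped Classical in
/-- Elimination of one variable from a finite system of homogeneous linear inequalities whose
coefficients on the vectors of `B` lie in the ring `R`. -/
lemma exists_elimination_single (R : Subring ℝ) (B : Set W) {e : W} (he : e ∈ B)
    (H : Finset (W →ₗ[ℝ] ℝ)) (hH : ∀ l ∈ H, ∀ w ∈ B, l w ∈ R) :
    ∃ H' : Finset (W →ₗ[ℝ] ℝ), (∀ l ∈ H', ∀ w ∈ B, l w ∈ R) ∧
      ∀ w, (∃ t : ℝ, ∀ l ∈ H, 0 ≤ l (w + t • e)) ↔ ∀ l ∈ H', 0 ≤ l w := by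
  -- Each pair of opposite signs at `e` is replaced by a positive combination that cancels `e`. The
  -- combination involves no division, so its values on `B` stay in `R`.
  refine ⟨H.filter (fun l => l e = 0) ∪ Finset.image₂ (fun l l' => l e • l' - l' e • l)
    (H.filter (fun l => 0 < l e)) (H.filter (fun l => l e < 0)), ?_, fun w => ⟨?_, fun h => ?_⟩⟩
  · intro l hl w hw
    rw [Finset.mem_union, Finset.mem_filter, Finset.mem_image₂] at hl
    rcases hl with ⟨hl, -⟩ | ⟨a, ha, b, hb, rfl⟩
    · exact hH l hl w hw
    · rw [Finset.mem_filter] at ha hb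
      simp only [LinearMap.sub_apply, LinearMap.smul_apply, smul_eq_mul]
      exact R.sub_mem (R.mul_mem (hH a ha.1 e he) (hH b hb.1 w hw))
        (R.mul_mem (hH b hb.1 e he) (hH a ha.1 w hw))
  · rintro ⟨t, ht⟩ l hl
    rw [Finset.mem_union, Finset.mem_filter, Finset.mem_image₂] at hl
    rcases hl with ⟨hl, h0⟩ | ⟨a, ha, b, hb, rfl⟩
    · simpa [h0] using ht l hl
    · rw [Finset.mem_filter] at ha hb
      have h1 := ht a ha.1
      have h2 := ht b hb.1
      simp only [map_add, map_smul, smul_eq_mul] at h1 h2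
      simp only [LinearMap.sub_apply, LinearMap.smul_apply, smul_eq_mul]
      nlinarith [mul_nonneg h2 ha.2.le, mul_nonneg h1 (neg_nonneg.2 hb.2.le)]
  · obtain ⟨t, ht1, ht2⟩ := exists_between_finsets
      ((H.filter (fun l => 0 < l e)).image fun l => -l w / l e)
      ((H.filter (fun l => l e < 0)).image fun l => -l w / l e) (by
        intro x hx y hy
        rw [Finset.mem_image] at hx hy
        obtain ⟨a, ha, rfl⟩ := hx
        obtain ⟨b, hb, rfl⟩ := hy
        have := h _ (Finset.mem_union_right _ (Finset.mem_image₂_of_mem ha hb))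
        rw [Finset.mem_filter] at ha hb
        simp only [LinearMap.sub_apply, LinearMap.smul_apply, smul_eq_mul] at this
        rw [div_le_iff₀ ha.2, div_mul_eq_mul_div, le_div_iff_of_neg hb.2]
        linarith)
    refine ⟨t, fun l hl => ?_⟩
    simp only [map_add, map_smul, smul_eq_mul]
    rcases lt_trichotomy (l e) 0 with h0 | h0 | h0
    · have := ht2 _ (Finset.mem_image_of_mem _ (Finset.mem_filter.2 ⟨hl, h0⟩))
      rw [le_div_iff_of_neg h0] at this
      linarith
    · have := h l (Finset.mem_union_left _ (Finset.mem_filter.2 ⟨hl, h0⟩))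
      simpa [h0] using this
    · have := ht1 _ (Finset.mem_image_of_mem _ (Finset.mem_filter.2 ⟨hl, h0⟩))
      rw [div_le_iff₀ h0] at this
      linarith

/-- Elimination of finitely many variables. -/
lemma exists_elimination (R : Subring ℝ) (B : Set W) (S : Finset W) (hS : ↑S ⊆ B)
    (H : Finset (W →ₗ[ℝ] ℝ)) (hH : ∀ l ∈ H, ∀ w ∈ B, l w ∈ R) :
    ∃ H' : Finset (W →ₗ[ℝ] ℝ), (∀ l ∈ H', ∀ w ∈ B, l w ∈ R) ∧
      ∀ w, (∃ v ∈ Submodule.span ℝ (S : Set W), ∀ l ∈ H, 0 ≤ l (w + v)) ↔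
        ∀ l ∈ H', 0 ≤ l w := by
  classical
  induction S using Finset.induction_on with
  | empty => exact ⟨H, hH, fun w => by simp⟩
  | insert e S _ ih =>
    rw [Finset.coe_insert, Set.insert_subset_iff] at hS
    obtain ⟨H1, hH1, h1⟩ := ih hS.2
    obtain ⟨H2, hH2, h2⟩ := exists_elimination_single R B hS.1 H1 hH1
    refine ⟨H2, hH2, fun w => ?_⟩
    rw [← h2 w]
    simp only [← h1, Finset.coe_insert, Submodule.mem_span_insert]
    constructor
    · rintro ⟨_, ⟨t, z, hz, rfl⟩, h⟩
      exact ⟨t, z, hz, by simpa only [add_assoc] using h⟩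
    · rintro ⟨t, z, hz, h⟩
      exact ⟨_, ⟨t, z, hz, rfl⟩, by simpa only [add_assoc] using h⟩

end Elimination

/-! ### Weighted Minkowski sums and polytopes -/

section Polytopes

variable {E : Type*} [NormedAddCommGroup E] [NormedSpace ℝ E]

lemma bddBelow_image_of_isBounded {C : Set E} (hC : Bornology.IsBounded C) (u : StrongDual ℝ E) :
    BddBelow (u '' C) :=
  (u.lipschitz.isBounded_image hC).bddBelow

lemma supportFun_le {C : Set E} (hC : Bornology.IsBounded C) (u : StrongDual ℝ E) {x : E}
    (hx : x ∈ C) : supportFun C u ≤ u x :=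
  csInf_le (bddBelow_image_of_isBounded hC u) ⟨x, hx, rfl⟩

lemma le_supportFun {C : Set E} (hC : C.Nonempty) {u : StrongDual ℝ E} {a : ℝ}
    (h : ∀ x ∈ C, a ≤ u x) : a ≤ supportFun C u :=
  le_csInf (hC.image _) (by rintro _ ⟨x, hx, rfl⟩; exact h x hx)

lemma exists_eq_supportFun {C : Set E} (hC : IsCompact C) (hne : C.Nonempty)
    (u : StrongDual ℝ E) : ∃ x ∈ C, u x = supportFun C u :=
  (hC.image u.continuous).sInf_mem (hne.image _)

lemma mem_face_iff {C : Set E} (hC : Bornology.IsBounded C) {u : StrongDual ℝ E} {x : E} :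
    x ∈ face C u ↔ x ∈ C ∧ u x = supportFun C u :=
  ⟨fun h => ⟨h.1, le_antisymm (le_supportFun ⟨x, h.1⟩ h.2) (supportFun_le hC u h.1)⟩,
    fun h => ⟨h.1, fun _ hy => h.2.le.trans (supportFun_le hC u hy)⟩⟩

lemma face_nonempty {C : Set E} (hC : IsCompact C) (hne : C.Nonempty) (u : StrongDual ℝ E) :
    (face C u).Nonempty :=
  let ⟨x, hx, h⟩ := exists_eq_supportFun hC hne u
  ⟨x, (mem_face_iff hC.isBounded).2 ⟨hx, h⟩⟩

/-- The weighted Minkowski sum `∑ i, l i • K i`. -/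
def wsum {ι : Type*} [Fintype ι] (K : ι → Set E) (l : ι → ℝ) : Set E :=
  {x | ∃ y : ι → E, (∀ i, y i ∈ K i) ∧ ∑ i, l i • y i = x}

/-- A polytope: a bounded finite intersection of half-spaces, the slopes of which have values
in `R` at the vectors `b k`. -/
def IsHPoly {κ : Type*} (b : κ → E) (R : Subring ℝ) (Q : Set E) : Prop :=
  Bornology.IsBounded Q ∧ ∃ H : Finset (StrongDual ℝ E × ℝ), (∀ h ∈ H, ∀ k, h.1 (b k) ∈ R) ∧
    Q = {x | ∀ h ∈ H, 0 ≤ h.1 x + h.2}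

lemma IsHPoly.isClosed {κ : Type*} {b : κ → E} {R : Subring ℝ} {Q : Set E} (h : IsHPoly b R Q) :
    IsClosed Q := by
  obtain ⟨-, H, -, rfl⟩ := h
  simp only [Set.ofPred_forall]
  exact isClosed_iInter fun h => isClosed_iInter fun _ =>
    isClosed_le continuous_const (h.1.continuous.add continuous_const)

lemma IsHPoly.isCompact [FiniteDimensional ℝ E] {κ : Type*} {b : κ → E} {R : Subring ℝ} {Q : Set E}
    (h : IsHPoly b R Q) : IsCompact Q :=
  have : ProperSpace E := FiniteDimensional.proper ℝ E
  Metric.isCompact_of_isClosed_isBounded h.isClosed h.1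

lemma IsHPoly.convex {κ : Type*} {b : κ → E} {R : Subring ℝ} {Q : Set E} (h : IsHPoly b R Q) :
    Convex ℝ Q := by
  obtain ⟨-, H, -, rfl⟩ := h
  simp only [Set.ofPred_forall]
  refine convex_iInter fun h => convex_iInter fun _ => ?_
  intro x hx y hy a b ha hb hab
  simp only [Set.mem_ofPred_eq, map_add, map_smul, smul_eq_mul] at *
  have : h.2 = a * h.2 + b * h.2 := by rw [← add_mul, hab, one_mul]
  nlinarith [mul_nonneg ha hx, mul_nonneg hb hy]

lemma IsHPoly.mono {κ κ' : Type*} {b : κ → E} {R : Subring ℝ} {Q : Set E} (h : IsHPoly b R Q)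
    (b' : κ' → E) : IsHPoly b' ⊤ Q := by
  obtain ⟨h0, H, -, rfl⟩ := h
  exact ⟨h0, H, by simp, rfl⟩

/-- A nonempty bounded intersection of half-spaces has trivial recession cone. -/
lemma eq_zero_of_recession {H : Finset (StrongDual ℝ E × ℝ)}
    (hb : Bornology.IsBounded {x : E | ∀ h ∈ H, 0 ≤ h.1 x + h.2}) {q z : E}
    (hq : ∀ h ∈ H, 0 ≤ h.1 q + h.2) (hz : ∀ h ∈ H, 0 ≤ h.1 z) : z = 0 := by
  by_contra hne
  obtain ⟨C, hC⟩ := hb.exists_norm_le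
  have hpos : 0 < ‖z‖ := norm_pos_iff.2 hne
  have hC0 : 0 ≤ C := (norm_nonneg q).trans (hC q hq)
  set t := (C + ‖q‖ + 1) / ‖z‖ with ht
  have ht0 : 0 ≤ t := by positivity
  have h1 := hC (q + t • z) fun h hh => by
    have h2 := hq h hh
    have h3 := mul_nonneg ht0 (hz h hh)
    simp only [map_add, map_smul, smul_eq_mul]
    linarith
  have h2 : ‖t • z‖ ≤ ‖q + t • z‖ + ‖q‖ := by
    calc ‖t • z‖ = ‖(q + t • z) - q‖ := by congr 1; abel
      _ ≤ _ := norm_sub_le _ _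
  rw [norm_smul, Real.norm_of_nonneg ht0, ht, div_mul_cancel₀ _ hpos.ne'] at h2
  linarith

variable {ι κ : Type*} [Fintype ι]

open scoped Classical in
/-- All weighted Minkowski sums of a family of polytopes are cut out by the same finitely many
slopes. -/
theorem exists_slopes_wsum [Fintype κ] (b : Module.Basis κ ℝ E) (R : Subring ℝ)
    (K : ι → Set E) (hK : ∀ i, IsHPoly b R (K i)) (hne : ∀ i, (K i).Nonempty) :
    ∃ U : Finset (StrongDual ℝ E), (∀ u ∈ U, ∀ k, u (b k) ∈ R) ∧
      ∀ l : ι → ℝ, (∀ i, 0 ≤ l i) →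
        wsum K l = {x | ∀ u ∈ U, ∑ i, l i * supportFun (K i) u ≤ u x} := by
  have : FiniteDimensional ℝ E := b.finiteDimensional_of_finite
  choose hbd H hHR hHeq using hK
  let z : ι → (ι → E) × (E × (ι → ℝ)) →ₗ[ℝ] E := fun i => LinearMap.proj i ∘ₗ LinearMap.fst ℝ _ _
  let xx : (ι → E) × (E × (ι → ℝ)) →ₗ[ℝ] E := LinearMap.fst ℝ _ _ ∘ₗ LinearMap.snd ℝ _ _
  let ll : ι → (ι → E) × (E × (ι → ℝ)) →ₗ[ℝ] ℝ := fun i =>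
    LinearMap.proj i ∘ₗ LinearMap.snd ℝ _ _ ∘ₗ LinearMap.snd ℝ _ _
  let S : Finset ((ι → E) × (E × (ι → ℝ))) :=
    Finset.univ.image fun p : ι × κ => (Pi.single p.1 (b p.2), 0, 0)
  -- The unknowns are the summands z, the point x and the weights l, subject to x = ∑ z i and the
  -- inequalities of `K i` homogenised by `l i`. Eliminating z describes all weighted sums at once.
  -- Coefficients in `R` are required only in the z and x directions: the real constants of the
  -- half-spaces multiply the weights.
  let B : Set ((ι → E) × (E × (ι → ℝ))) := ↑S ∪ Set.range fun k : κ => (0, b k, 0)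
  let e : κ → (ι → E) × (E × (ι → ℝ)) →ₗ[ℝ] ℝ := fun k => b.coord k ∘ₗ (xx - ∑ i, z i)
  let c : (i : ι) → StrongDual ℝ E × ℝ → (ι → E) × (E × (ι → ℝ)) →ₗ[ℝ] ℝ :=
    fun i h => h.1.toLinearMap ∘ₗ z i + h.2 • ll i
  let G : Finset ((ι → E) × (E × (ι → ℝ)) →ₗ[ℝ] ℝ) :=
    (Finset.univ.biUnion fun i => (H i).image (c i)) ∪
    (Finset.univ.image e ∪ Finset.univ.image fun k => -e k)
  have hcoord : ∀ k k', b.coord k (b k') ∈ R := fun k k' => by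
    rw [Module.Basis.coord_apply, Module.Basis.repr_self, Finsupp.single_apply]
    split_ifs
    · exact R.one_mem
    · exact R.zero_mem
  have hz : ∀ i w, z i w = w.1 i := fun i w => rfl
  have hxx : ∀ w, xx w = w.2.1 := fun w => rfl
  have hll : ∀ i w, ll i w = w.2.2 i := fun i w => rfl
  have hev : ∀ k w, e k w = b.coord k (w.2.1 - ∑ i, w.1 i) := fun k w => by
    simp [e, hz, hxx]
  have hcv : ∀ i h w, c i h w = h.1 (w.1 i) + h.2 * w.2.2 i := fun i h w => by
    simp [c, hz, hll]
  have he : ∀ k, ∀ w ∈ B, e k w ∈ R := by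
    intro k w hw
    rcases hw with hw | ⟨k', rfl⟩
    · obtain ⟨⟨i, k'⟩, -, rfl⟩ := Finset.mem_image.1 hw
      have h1 : ∑ j, (Pi.single i (b k') : ι → E) j = b k' := by simp
      rw [hev]
      simp only [h1, zero_sub, map_neg]
      exact R.neg_mem (hcoord k k')
    · rw [hev]
      simpa only [Pi.zero_apply, Finset.sum_const_zero, sub_zero] using hcoord k k'
  have hG : ∀ g ∈ G, ∀ w ∈ B, g w ∈ R := by
    intro g hg w hw
    simp only [G, Finset.mem_union, Finset.mem_biUnion, Finset.mem_image, Finset.mem_univ,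
      true_and] at hg
    rcases hg with ⟨i, h, hh, rfl⟩ | ⟨k, rfl⟩ | ⟨k, rfl⟩
    · rcases hw with hw | ⟨k', rfl⟩
      · obtain ⟨⟨i', k'⟩, -, rfl⟩ := Finset.mem_image.1 hw
        by_cases hii : i = i'
        · subst hii
          simpa [hcv] using hHR i h hh k'
        · simp [hcv, hii, R.zero_mem]
      · simp [hcv, R.zero_mem]
    · exact he k w hw
    · exact R.neg_mem (he k w hw)
  obtain ⟨G', hG', hiff⟩ := exists_elimination R B S Set.subset_union_left G hG
  have hspan : ∀ y : ι → E, ((y, 0, 0) : (ι → E) × (E × (ι → ℝ))) ∈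
      Submodule.span ℝ (S : Set ((ι → E) × (E × (ι → ℝ)))) := by
    intro y
    have h1 : ((y, 0, 0) : (ι → E) × (E × (ι → ℝ))) = ∑ i, ∑ k, b.repr (y i) k •
        ((Pi.single i (b k), 0, 0) : (ι → E) × (E × (ι → ℝ))) := by
      have : y = ∑ i, ∑ k, b.repr (y i) k • Pi.single i (b k) := by
        funext j
        rw [Finset.sum_apply, Finset.sum_eq_single j]
        · simp [b.sum_repr]
        · intro i _ hij
          simp [hij.symm]
        · simp
      refine Prod.ext ?_ ?_
      · simpa [Prod.fst_sum] using this
      · simp [Prod.snd_sum]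
    rw [h1]
    exact Submodule.sum_mem _ fun i _ => Submodule.sum_mem _ fun k _ => Submodule.smul_mem _ _
      (Submodule.subset_span (Finset.mem_coe.2 (Finset.mem_image_of_mem _ (Finset.mem_univ (i, k)))))
  have hspan' : ∀ v ∈ Submodule.span ℝ (S : Set ((ι → E) × (E × (ι → ℝ)))),
      ∃ y : ι → E, v = (y, 0, 0) := by
    intro v hv
    have : Submodule.span ℝ (S : Set ((ι → E) × (E × (ι → ℝ)))) ≤
        LinearMap.range (LinearMap.inl ℝ (ι → E) (E × (ι → ℝ))) := by
      rw [Submodule.span_le]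
      intro w hw
      obtain ⟨p, -, rfl⟩ := Finset.mem_image.1 hw
      exact ⟨_, rfl⟩
    obtain ⟨y, rfl⟩ := this hv
    exact ⟨y, rfl⟩
  have key : ∀ (l : ι → ℝ) (x : E), (∀ i, 0 ≤ l i) →
      (x ∈ wsum K l ↔ ∀ g ∈ G', 0 ≤ g ((0, x, l) : (ι → E) × (E × (ι → ℝ)))) := by
    intro l x hl
    rw [← hiff]
    have hGiff : ∀ y : ι → E, (∀ g ∈ G, 0 ≤ g ((0, x, l) + (y, 0, 0) : (ι → E) × (E × (ι → ℝ)))) ↔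
        (∀ i, ∀ h ∈ H i, 0 ≤ h.1 (y i) + h.2 * l i) ∧ x = ∑ i, y i := by
      intro y
      have h1 : (∀ k, e k ((0, x, l) + (y, 0, 0) : (ι → E) × (E × (ι → ℝ))) = 0) ↔ x = ∑ i, y i := by
        have h2 : ∀ k, e k ((0, x, l) + (y, 0, 0) : (ι → E) × (E × (ι → ℝ))) =
            b.repr (x - ∑ i, y i) k := by
          intro k; simp [hev]
        simp only [h2]
        rw [← sub_eq_zero, ← b.repr.map_eq_zero_iff, Finsupp.ext_iff]
        rfl
      rw [← h1]
      simp only [G, Finset.mem_union, Finset.mem_biUnion, Finset.mem_image, Finset.mem_univ,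
        true_and]
      constructor
      · intro h
        refine ⟨fun i hh hhi => ?_, fun k => le_antisymm ?_ ?_⟩
        · simpa [hcv] using h _ (Or.inl ⟨i, hh, hhi, rfl⟩)
        · simpa only [LinearMap.neg_apply, neg_nonneg] using h _ (Or.inr (Or.inr ⟨k, rfl⟩))
        · exact h _ (Or.inr (Or.inl ⟨k, rfl⟩))
      · rintro ⟨ha, hb⟩ g (⟨i, hh, hhi, rfl⟩ | ⟨k, rfl⟩ | ⟨k, rfl⟩)
        · simpa [hcv] using ha i hh hhi
        · exact (hb k).ge
        · rw [LinearMap.neg_apply, hb k, neg_zero]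
    constructor
    · rintro ⟨y, hy, rfl⟩
      refine ⟨_, hspan fun i => l i • y i, (hGiff _).2 ⟨fun i h hh => ?_, rfl⟩⟩
      have h1 := hy i
      rw [hHeq i] at h1
      have := mul_nonneg (hl i) (h1 h hh)
      simp only [map_smul, smul_eq_mul]
      linarith
    · rintro ⟨v, hv, h⟩
      obtain ⟨y, rfl⟩ := hspan' v hv
      obtain ⟨h1, rfl⟩ := (hGiff y).1 h
      choose q hq using hne
      -- At weight zero any point of `K i` will do: the homogenised system then puts `y i` into the
      -- recession cone of a bounded polyhedron, so `y i = 0`.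
      refine ⟨fun i => if l i = 0 then q i else (l i)⁻¹ • y i, fun i => ?_, ?_⟩
      · dsimp only
        split_ifs with h0
        · exact hq i
        · rw [hHeq i]
          intro h hh
          have h2 := h1 i h hh
          have hpos : 0 < l i := lt_of_le_of_ne (hl i) (Ne.symm h0)
          have h3 : h.1 ((l i)⁻¹ • y i) + h.2 = (l i)⁻¹ * (h.1 (y i) + h.2 * l i) := by
            simp only [map_smul, smul_eq_mul]
            field_simp
          rw [h3]
          exact mul_nonneg (inv_nonneg.2 hpos.le) h2
      · refine Finset.sum_congr rfl fun i _ => ?_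
        dsimp only
        split_ifs with h0
        · have h3 : y i = 0 := by
            have hb := hbd i
            have hqi := hq i
            rw [hHeq i] at hb hqi
            refine eq_zero_of_recession hb hqi fun h hh => ?_
            simpa [h0] using h1 i h hh
          rw [h0, zero_smul, h3]
        · rw [smul_smul, mul_inv_cancel₀ h0, one_smul]
  let toU : ((ι → E) × (E × (ι → ℝ)) →ₗ[ℝ] ℝ) → StrongDual ℝ E := fun g =>
    LinearMap.toContinuousLinearMap (g ∘ₗ LinearMap.inr ℝ (ι → E) _ ∘ₗ LinearMap.inl ℝ E (ι → ℝ))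
  have htoU : ∀ g x, toU g x = g (0, x, 0) := fun g x => rfl
  refine ⟨G'.image toU, ?_, fun l hl => Set.ext fun x => ⟨?_, fun hx => ?_⟩⟩
  · intro u hu k
    obtain ⟨g, hg, rfl⟩ := Finset.mem_image.1 hu
    exact hG' g hg _ (Or.inr ⟨k, rfl⟩)
  · rintro ⟨y, hy, rfl⟩ u -
    rw [map_sum]
    refine Finset.sum_le_sum fun i _ => ?_
    rw [map_smul, smul_eq_mul]
    exact mul_le_mul_of_nonneg_left (supportFun_le (hbd i) u (hy i)) (hl i)
  · rw [key l x hl]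
    intro g hg
    have h1 : ∀ (x : E) (l : ι → ℝ), g ((0, x, l) : (ι → E) × (E × (ι → ℝ))) =
        toU g x + ∑ i, l i * g (0, 0, Pi.single i 1) := by
      intro x l
      have h2 : ((0, x, l) : (ι → E) × (E × (ι → ℝ))) =
          (0, x, 0) + ∑ i, l i • ((0, 0, Pi.single i 1) : (ι → E) × (E × (ι → ℝ))) := by
        refine Prod.ext ?_ (Prod.ext ?_ ?_)
        · simp [Prod.fst_sum]
        · simp [Prod.fst_sum, Prod.snd_sum]
        · funext j
          simp [Prod.snd_sum, Finset.sum_apply, Pi.single_apply]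
      rw [h2, map_add, map_sum, htoU]
      simp only [map_smul, smul_eq_mul]
    have h3 := hx (toU g) (Finset.mem_image_of_mem _ hg)
    rw [h1]
    -- A point of `K i` is a weighted sum with weight 1 at `i` and 0 elsewhere, so the eliminated
    -- inequality holds for it. This bounds its coefficient at `l i` by the support function of `K
    -- i`; hence the inequalities with the support functions imply the eliminated ones.
    have h4 : ∀ i, -g ((0, 0, Pi.single i 1) : (ι → E) × (E × (ι → ℝ))) ≤ supportFun (K i) (toU g) := by
      intro i
      refine le_supportFun (hne i) fun y hy => ?_
      have h5 : y ∈ wsum K (Pi.single i 1) := by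
        choose q hq using hne
        refine ⟨Function.update q i y, fun j => ?_, ?_⟩
        · by_cases hj : j = i
          · subst hj; simpa using hy
          · simpa [hj] using hq j
        · rw [Finset.sum_eq_single i]
          · simp
          · intro j _ hj; simp [hj]
          · simp
      have h6 := (key _ y fun j => by
        by_cases hj : j = i
        · subst hj; simp
        · simp [hj]).1 h5 g hg
      rw [h1, Finset.sum_eq_single i] at h6
      · simp only [Pi.single_eq_same, one_mul] at h6
        linarith
      · intro j _ hj; simp [hj]
      · simp
    have h7 : -∑ i, l i * g ((0, 0, Pi.single i 1) : (ι → E) × (E × (ι → ℝ))) ≤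
        ∑ i, l i * supportFun (K i) (toU g) := by
      rw [← Finset.sum_neg_distrib]
      refine Finset.sum_le_sum fun i _ => ?_
      rw [← mul_neg]
      exact mul_le_mul_of_nonneg_left (h4 i) (hl i)
    linarith

end Polytopes

/-! ### Measures on hyperplanes -/

section Disintegration

variable {E : Type*} [NormedAddCommGroup E] [NormedSpace ℝ E]

/-- A vector with value `1` under `u` splits `E` into a line and the kernel of `u`. -/
def hyperplaneEquiv [FiniteDimensional ℝ E] (u : StrongDual ℝ E) (w : E) (hw : u w = 1) :
    (ℝ × u.ker) ≃L[ℝ] E :=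
  LinearEquiv.toContinuousLinearEquiv
    { toFun := fun p => p.1 • w + (p.2 : E)
      map_add' := fun p q => by
        simp only [Prod.fst_add, Prod.snd_add, Submodule.coe_add, add_smul]; abel
      map_smul' := fun c p => by
        simp only [Prod.smul_fst, Prod.smul_snd, Submodule.coe_smul, smul_add, smul_smul,
          smul_eq_mul, RingHom.id_apply]
      invFun := fun x => (u x, ⟨x - u x • w, by simp [hw]⟩)
      left_inv := fun p => by
        have h : u (p.2 : E) = 0 := p.2.2
        refine Prod.ext ?_ (Subtype.ext ?_)
        · simp [hw, h]
        · simp [hw, h]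
      right_inv := fun x => by simp }

lemma exists_apply_eq_one {u : StrongDual ℝ E} (hu : u ≠ 0) : ∃ w, u w = 1 := by
  obtain ⟨x, hx⟩ : ∃ x, u x ≠ 0 := by
    by_contra! h
    exact hu (ContinuousLinearMap.ext h)
  exact ⟨(u x)⁻¹ • x, by simp [hx]⟩

variable [MeasurableSpace E]

/-- The measure `ν` on the kernel of `u` is the one induced by `μ` and `u`. -/
def IsDisintegration (μ : Measure E) (u : StrongDual ℝ E) (ν : Measure u.ker) : Prop :=
  ∃ w, u w = 1 ∧
    MeasurePreserving (fun p : ℝ × u.ker => p.1 • w + (p.2 : E)) (volume.prod ν) μ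

variable [FiniteDimensional ℝ E] [BorelSpace E]

/-- A level set is a translate of the kernel, which is a proper subspace. -/
lemma addHaar_level_eq_zero (μ : Measure E) [μ.IsAddHaarMeasure] {u : StrongDual ℝ E}
    (hu : u ≠ 0) (c : ℝ) : μ {x | u x = c} = 0 := by
  obtain ⟨w, hw⟩ := exists_apply_eq_one hu
  have h1 : {x | u x = c} = (fun x => -(c • w) + x) ⁻¹' (u.ker : Set E) := by
    ext x
    simp only [Set.mem_ofPred_eq, Set.mem_preimage, SetLike.mem_coe, LinearMap.mem_ker,
      ContinuousLinearMap.coe_coe, map_add, map_neg, map_smul, hw, smul_eq_mul, mul_one]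
    constructor <;> intro h <;> linarith
  rw [h1, measure_preimage_add]
  refine Measure.addHaar_submodule μ _ fun h => ?_
  have : w ∈ u.ker := h ▸ Submodule.mem_top
  simp [hw] at this

/-- By uniqueness of Haar measure, the image of Lebesgue measure times a Haar measure of the kernel
is a multiple of `μ`; the factor is absorbed into the measure on the kernel. -/
theorem exists_isDisintegration (μ : Measure E) [μ.IsAddHaarMeasure] {u : StrongDual ℝ E}
    (hu : u ≠ 0) : ∃ ν : Measure u.ker, ν.IsAddHaarMeasure ∧ IsDisintegration μ u ν := by
  obtain ⟨w, hw⟩ := exists_apply_eq_one hu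
  set F := hyperplaneEquiv u w hw
  let ν₀ : Measure u.ker := Measure.addHaar
  have : ((volume.prod ν₀).map F).IsAddHaarMeasure :=
    F.isAddHaarMeasure_map _
  have h := Measure.isAddLeftInvariant_eq_smul μ ((volume.prod ν₀).map F)
  have hc := Measure.addHaarScalarFactor_pos_of_isAddHaarMeasure μ ((volume.prod ν₀).map F)
  set c : ℝ≥0∞ := (Measure.addHaarScalarFactor μ ((volume.prod ν₀).map F) : ℝ≥0∞) with hcdef
  have h' : μ = c • (volume.prod ν₀).map F := h
  refine ⟨c • ν₀, Measure.IsAddHaarMeasure.smul _ (by simpa [hcdef] using hc.ne')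
    ENNReal.coe_ne_top, w, hw, F.continuous.measurable, ?_⟩
  rw [h', Measure.prod_smul_right, Measure.map_smul]
  rfl

end Disintegration

/-! ### The first variation of an integral over a polytope -/

section HalfSpaces

variable {E : Type*} [NormedAddCommGroup E] [NormedSpace ℝ E]

lemma isClosed_halfSpaces {ι : Type*} (u : ι → StrongDual ℝ E) (b : ι → ℝ) :
    IsClosed {x | ∀ j, b j ≤ u j x} := by
  simp only [Set.ofPred_forall]
  exact isClosed_iInter fun j => isClosed_le continuous_const (u j).continuous

/-- The part of the boundary layer that belongs to the `j`-th half-space. -/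
def slab {m : ℕ} (u : Fin m → StrongDual ℝ E) (b h : Fin m → ℝ) (ε : ℝ) (j : Fin m) : Set E :=
  {x | (∀ k, b k - ε * h k ≤ u k x) ∧ u j x < b j ∧ ∀ k, j < k → b k ≤ u k x}

/-- A point of the layer belongs to the slab of the largest index whose inequality it violates. This
choice also makes the slabs disjoint. -/
lemma iUnion_slab {m : ℕ} (u : Fin m → StrongDual ℝ E) (b h : Fin m → ℝ) (ε : ℝ) :
    ⋃ j, slab u b h ε j = {x | ∀ k, b k - ε * h k ≤ u k x} \ {x | ∀ k, b k ≤ u k x} := by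
  ext x
  simp only [Set.mem_iUnion, slab, Set.mem_ofPred_eq, Set.mem_sdiff]
  constructor
  · rintro ⟨j, h1, h2, -⟩
    exact ⟨h1, fun h => h2.not_ge (h j)⟩
  · rintro ⟨h1, h2⟩
    push Not at h2
    obtain ⟨j0, hj0⟩ := h2
    have hne : (Finset.univ.filter fun j => u j x < b j).Nonempty := ⟨j0, by simpa using hj0⟩
    refine ⟨Finset.max' _ hne, h1, ?_, fun k hk => ?_⟩
    · have := Finset.max'_mem _ hne
      rw [Finset.mem_filter] at this
      exact this.2
    · by_contra hcon
      have h3 := Finset.le_max' (Finset.univ.filter fun j => u j x < b j) k (by simpa using hcon)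
      exact absurd hk h3.not_gt

lemma measurableSet_slab {m : ℕ} [MeasurableSpace E] [BorelSpace E]
    (u : Fin m → StrongDual ℝ E) (b h : Fin m → ℝ) (ε : ℝ)
    (j : Fin m) : MeasurableSet (slab u b h ε j) := by
  have h1 : slab u b h ε j = {x | ∀ k, b k - ε * h k ≤ u k x} ∩ ({x | u j x < b j} ∩
      {x | ∀ k : {k // j < k}, b k ≤ u k x}) := by
    ext x; simp [slab]
  rw [h1]
  exact (isClosed_halfSpaces u _).measurableSet.inter
    ((measurableSet_lt (u j).continuous.measurable measurable_const).inter
      (isClosed_halfSpaces (fun k : {k // j < k} => u k) fun k => b k).measurableSet)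

end HalfSpaces

/-! ### The boundary layer of a polytope -/

section FirstVariation

open Filter Topology

variable {E : Type*} [NormedAddCommGroup E] [NormedSpace ℝ E] [FiniteDimensional ℝ E]
  [MeasurableSpace E] [BorelSpace E]

lemma integrableOn_of_isBounded (μ : Measure E) [μ.IsAddHaarMeasure] {S : Set E}
    (hS : Bornology.IsBounded S) {f : E → ℝ} (hf : Continuous f) : IntegrableOn f S μ :=
  have : ProperSpace E := FiniteDimensional.proper ℝ E
  (hf.continuousOn.integrableOn_compact hS.isCompact_closure).mono_set subset_closure

/-- Fubini in the coordinates p + t w + y, followed by the substitution t = -ε s, whose Jacobian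
cancels ε⁻¹. The minus sign points out of the polytope, towards smaller values of the functional. -/
lemma inv_mul_integral_eq (μ : Measure E) [μ.IsAddHaarMeasure] {u : StrongDual ℝ E}
    {ν : Measure u.ker} [ν.IsAddHaarMeasure] {w : E}
    (hν : MeasurePreserving (fun p : ℝ × u.ker => p.1 • w + (p.2 : E)) (volume.prod ν) μ)
    {f : E → ℝ} (hf : Integrable f μ) (p : E) {ε : ℝ} (hε : 0 < ε) :
    ε⁻¹ * ∫ x, f x ∂μ = ∫ s : ℝ, ∫ y : u.ker, f (p - (ε * s) • w + y) ∂ν := by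
  have h1 : Integrable (fun x => f (p + x)) μ := hf.comp_add_left p
  have h2 : ∫ x, f x ∂μ = ∫ z : ℝ × u.ker, f (p + (z.1 • w + z.2)) ∂(volume.prod ν) := by
    rw [← integral_add_left_eq_self f p, ← hν.map_eq, integral_map hν.measurable.aemeasurable]
    rw [hν.map_eq]
    exact h1.aestronglyMeasurable
  have h3 : Integrable (fun z : ℝ × u.ker => f (p + (z.1 • w + z.2))) (volume.prod ν) :=
    hν.integrable_comp_of_integrable h1
  rw [h2, integral_prod _ h3]
  have h4 := Measure.integral_comp_mul_left
    (fun s : ℝ => ∫ y : u.ker, f (p + (s • w + y)) ∂ν) (-ε)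
  rw [abs_inv, abs_neg, abs_of_pos hε, smul_eq_mul] at h4
  rw [← h4]
  congr 1
  funext s
  congr 1
  funext y
  congr 1
  rw [neg_mul, neg_smul]
  abel

/-- In the rescaled depth s the slab occupies 0 < s ≤ h j, and its slice at each such depth tends to
the j-th face as ε → 0. Dominated convergence is applied first along the slice and then in s. -/
theorem tendsto_integral_slab (μ : Measure E) [μ.IsAddHaarMeasure] {m : ℕ}
    (u : Fin m → StrongDual ℝ E) (hu : ∀ j, u j ≠ 0)
    (hpar : ∀ j k, ∀ c : ℝ, 0 < c → u k = c • u j → k = j) (j : Fin m)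
    (ν : Measure (u j).ker) [ν.IsAddHaarMeasure] (hν : IsDisintegration μ (u j) ν)
    (b h : Fin m → ℝ) (hh : ∀ k, 0 ≤ h k) (p : E) (hp : ∀ k, b k ≤ u k p) (hpj : u j p = b j)
    (hbd : Bornology.IsBounded {x | ∀ k, b k - h k ≤ u k x}) {φ : E → ℝ} (hφ : Continuous φ) :
    Tendsto (fun ε : ℝ => ε⁻¹ * ∫ x in slab u b h ε j, φ x ∂μ) (𝓝[>] 0)
      (𝓝 (h j * ∫ y in {y : (u j).ker | ∀ k, b k ≤ u k (p + y)}, φ (p + y) ∂ν)) := by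
  have hproper : ProperSpace E := FiniteDimensional.proper ℝ E
  have hproper' : ProperSpace (u j).ker := FiniteDimensional.proper ℝ _
  obtain ⟨w, hw, hmp⟩ := hν
  obtain ⟨C, hC⟩ := hbd.exists_norm_le
  obtain ⟨D, hD⟩ := (isCompact_closedBall (0 : E) C).exists_bound_of_continuousOn hφ.continuousOn
  have hD0 : ∀ x ∈ {x | ∀ k, b k - h k ≤ u k x}, |φ x| ≤ D := fun x hx => by
    simpa using hD x (by simpa using hC x hx)
  have hDnn : 0 ≤ D := (abs_nonneg _).trans (hD0 p fun k => by linarith [hp k, hh k])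
  set R := C + ‖p‖ + h j * ‖w‖ with hR
  have hsub : ∀ {ε : ℝ}, 0 < ε → ε ≤ 1 → slab u b h ε j ⊆ {x | ∀ k, b k - h k ≤ u k x} :=
    fun {ε} h0 h1 x hx k => (by nlinarith [hh k] : b k - h k ≤ b k - ε * h k).trans (hx.1 k)
  set f : ℝ → E → ℝ := fun ε => (slab u b h ε j).indicator φ with hf
  set F : ℝ → ℝ → ℝ := fun ε s => ∫ y : (u j).ker, f ε (p - (ε * s) • w + y) ∂ν with hF
  set Q' : Set (u j).ker := {y | ∀ k, b k ≤ u k (p + y)} with hQ'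
  have hQ'm : MeasurableSet Q' := by
    have : Q' = (fun y : (u j).ker => p + (y : E)) ⁻¹' {x | ∀ k, b k ≤ u k x} := rfl
    rw [this]
    exact (isClosed_halfSpaces u b).measurableSet.preimage
      (continuous_const.add continuous_subtype_val).measurable
  have huj : ∀ (t : ℝ) (y : (u j).ker), u j (p - t • w + y) = b j - t := by
    intro t y
    have : u j (y : E) = 0 := y.2
    rw [map_add, map_sub, map_smul, hpj, hw, this, smul_eq_mul, mul_one, add_zero]
  have hzero : ∀ ε, 0 < ε → ∀ s, s ∉ Set.Ioc 0 (h j) → ∀ y : (u j).ker,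
      f ε (p - (ε * s) • w + y) = 0 := by
    intro ε hε s hs y
    refine Set.indicator_of_notMem (fun hx => hs ⟨?_, ?_⟩) _
    · have := hx.2.1
      rw [huj] at this
      by_contra hcon
      nlinarith
    · have := hx.1 j
      rw [huj] at this
      by_contra hcon
      nlinarith
  have hbound : ∀ ε, 0 < ε → ε ≤ 1 → ∀ s ∈ Set.Ioc 0 (h j), ∀ y : (u j).ker,
      ‖f ε (p - (ε * s) • w + y)‖ ≤ (Metric.closedBall (0 : (u j).ker) R).indicator (fun _ => D) y := by
    intro ε h0 h1 s hs y
    by_cases hx : p - (ε * s) • w + y ∈ slab u b h ε j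
    · have hx1 := hsub h0 h1 hx
      have hy : y ∈ Metric.closedBall (0 : (u j).ker) R := by
        rw [mem_closedBall_zero_iff]
        have h2 := hC _ hx1
        have h3 : (y : E) = (p - (ε * s) • w + y) - p + (ε * s) • w := by abel
        have h4 : ‖(ε * s) • w‖ ≤ h j * ‖w‖ := by
          rw [norm_smul, Real.norm_of_nonneg (mul_nonneg h0.le hs.1.le)]
          have : ε * s ≤ h j := by nlinarith [hs.1, hs.2]
          gcongr
        calc ‖y‖ = ‖(y : E)‖ := rfl
          _ = ‖(p - (ε * s) • w + y) - p + (ε * s) • w‖ := by rw [← h3]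
          _ ≤ ‖(p - (ε * s) • w + y) - p‖ + ‖(ε * s) • w‖ := norm_add_le _ _
          _ ≤ (‖p - (ε * s) • w + y‖ + ‖p‖) + ‖(ε * s) • w‖ := by gcongr; exact norm_sub_le _ _
          _ ≤ R := by rw [hR]; linarith
      rw [Set.indicator_of_mem hy]
      simp only [hf]
      rw [Set.indicator_of_mem hx]
      exact hD0 _ hx1
    · simp only [hf]
      rw [Set.indicator_of_notMem hx, norm_zero]
      exact Set.indicator_nonneg (fun _ _ => hDnn) _
  have hint : ∀ ε, 0 < ε → ε ≤ 1 → Integrable (f ε) μ := fun ε h0 h1 =>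
    (integrable_indicator_iff (measurableSet_slab u b h ε j)).2
      (integrableOn_of_isBounded μ (hbd.subset (hsub h0 h1)) hφ)
  have hev : ∀ᶠ ε in 𝓝[>] (0 : ℝ), 0 < ε ∧ ε ≤ 1 := by
    filter_upwards [Ioc_mem_nhdsGT (zero_lt_one' ℝ)] with ε hε using hε
  have hfm : ∀ ε, Measurable (f ε) := fun ε =>
    hφ.measurable.indicator (measurableSet_slab u b h ε j)
  have hmap : ∀ ε : ℝ, Measurable fun z : ℝ × (u j).ker => p - (ε * z.1) • w + (z.2 : E) := by
    intro ε
    exact Continuous.measurable (by fun_prop)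
  have hcongr : (fun ε : ℝ => ε⁻¹ * ∫ x in slab u b h ε j, φ x ∂μ) =ᶠ[𝓝[>] 0]
      fun ε => ∫ s, F ε s := by
    filter_upwards [hev] with ε hε
    rw [← integral_indicator (measurableSet_slab u b h ε j)]
    exact inv_mul_integral_eq μ hmp (hint ε hε.1 hε.2) p hε.1
  refine Tendsto.congr' hcongr.symm ?_
  have hlim : h j * ∫ y in Q', φ (p + y) ∂ν =
      ∫ s, (Set.Ioc 0 (h j)).indicator (fun _ => ∫ y in Q', φ (p + y) ∂ν) s := by
    rw [integral_indicator measurableSet_Ioc, setIntegral_const, Measure.real, Real.volume_Ioc,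
      sub_zero, ENNReal.toReal_ofReal (hh j), smul_eq_mul]
  rw [hlim]
  -- A functional that is not constant along the face has a null level set in the kernel, so for
  -- almost every y its inequality is strict or strictly violated, and remains so for small ε.
  have hae : ∀ᵐ (y : (u j).ker) ∂ν, ∀ k, (∃ z : (u j).ker, u k z ≠ 0) → u k (p + y) ≠ b k := by
    rw [ae_all_iff]
    intro k
    by_cases hk : ∃ z : (u j).ker, u k z ≠ 0
    · obtain ⟨z, hz⟩ := hk
      have hne : (u k).comp (u j).ker.subtypeL ≠ 0 := fun h0 => hz (by
        have := congrArg (fun v : StrongDual ℝ (u j).ker => v z) h0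
        simpa using this)
      have h0 : ν {y | (u k).comp (u j).ker.subtypeL y = b k - u k p} = 0 :=
        addHaar_level_eq_zero ν hne _
      refine (measure_eq_zero_iff_ae_notMem.1 h0).mono fun y hy _ hcon => hy ?_
      simp only [Set.mem_ofPred_eq, ContinuousLinearMap.comp_apply, Submodule.subtypeL_apply]
      rw [map_add] at hcon
      linarith
    · exact ae_of_all _ fun y h => absurd h hk
  have hinner : ∀ s ∈ Set.Ioc 0 (h j), Tendsto (fun ε => F ε s) (𝓝[>] 0)
      (𝓝 (∫ y in Q', φ (p + y) ∂ν)) := by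
    intro s hs
    rw [← integral_indicator hQ'm]
    refine tendsto_integral_filter_of_dominated_convergence
      ((Metric.closedBall (0 : (u j).ker) R).indicator fun _ => D) ?_ ?_ ?_ ?_
    · exact Eventually.of_forall fun ε =>
        ((hfm ε).comp ((hmap ε).comp measurable_prodMk_left)).aestronglyMeasurable
    · filter_upwards [hev] with ε hε
      exact ae_of_all _ fun y => hbound ε hε.1 hε.2 s hs y
    · exact (integrable_indicator_iff Metric.isClosed_closedBall.measurableSet).2
        (integrableOn_const (isCompact_closedBall _ _).measure_lt_top.ne)
    · filter_upwards [hae] with y hy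
      have hlim0 : Tendsto (fun ε : ℝ => p - (ε * s) • w + (y : E)) (𝓝[>] 0) (𝓝 (p + y)) := by
        have : Continuous fun ε : ℝ => p - (ε * s) • w + (y : E) := by fun_prop
        have h1 := this.tendsto 0
        rw [zero_mul, zero_smul, sub_zero] at h1
        exact h1.mono_left nhdsWithin_le_nhds
      have hk : ∀ k, ∀ᶠ ε in 𝓝[>] (0 : ℝ),
          (b k - ε * h k ≤ u k (p - (ε * s) • w + y) ↔ b k ≤ u k (p + y)) ∧
          (k ≠ j → (b k ≤ u k (p - (ε * s) • w + y) ↔ b k ≤ u k (p + y))) := by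
        intro k
        have hul := ((u k).continuous.tendsto _).comp hlim0
        have heps : Tendsto (fun ε : ℝ => b k - ε * h k) (𝓝[>] 0) (𝓝 (b k)) := by
          have : Continuous fun ε : ℝ => b k - ε * h k := by fun_prop
          have h1 := this.tendsto 0
          rw [zero_mul, sub_zero] at h1
          exact h1.mono_left nhdsWithin_le_nhds
        by_cases hker : ∃ z : (u j).ker, u k z ≠ 0
        · rcases lt_or_gt_of_ne (hy k hker) with hlt | hgt
          · filter_upwards [hul.eventually_lt heps hlt, hul.eventually_lt_const hlt] with ε h1 h2
            exact ⟨⟨fun h => absurd h1 h.not_gt, fun h => absurd hlt h.not_gt⟩,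
              fun _ => ⟨fun h => absurd h2 h.not_gt, fun h => absurd hlt h.not_gt⟩⟩
          · filter_upwards [heps.eventually_lt hul hgt, hul.eventually_const_lt hgt] with ε h1 h2
            exact ⟨⟨fun _ => hgt.le, fun _ => h1.le⟩, fun _ => ⟨fun _ => hgt.le, fun _ => h2.le⟩⟩
        · push Not at hker
          have hprop : ∀ x, u k x = u k w * u j x := by
            intro x
            have h1 := hker ⟨x - u j x • w, by simp [hw]⟩
            simp only [map_sub, map_smul, smul_eq_mul] at h1
            linarith
          have hbase : u k (p + y) = u k p := by rw [map_add, hker y, add_zero]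
          filter_upwards [hev] with ε hε
          have hx : u k (p - (ε * s) • w + y) = u k p - (ε * s) * u k w := by
            rw [map_add, map_sub, hker y, map_smul, smul_eq_mul, add_zero]
          rw [hbase, hx]
          by_cases hkj : k = j
          · subst hkj
            rw [hw]
            refine ⟨⟨fun _ => hp k, fun _ => ?_⟩, fun h => absurd rfl h⟩
            nlinarith [hp k, hs.2, hε.1]
          -- The only remaining functional parallel to `u j` is a negative multiple of it. It
          -- increases when the point moves out across the j-th side, so its inequality cannot fail
          -- in the layer.
          · have hc : u k w < 0 := by
              rcases lt_trichotomy (u k w) 0 with h0 | h0 | h0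
              · exact h0
              · exact absurd (ContinuousLinearMap.ext fun x => by rw [hprop x, h0]; simp) (hu k)
              · exact absurd (hpar j k _ h0 (ContinuousLinearMap.ext fun x => by
                  rw [hprop x]; simp)) hkj
            have h5 : b k ≤ u k p - ε * s * u k w := by
              nlinarith [hp k, mul_pos (mul_pos hε.1 hs.1) (neg_pos.2 hc)]
            refine ⟨⟨fun _ => hp k, fun _ => ?_⟩, fun _ => ⟨fun _ => hp k, fun _ => h5⟩⟩
            nlinarith [hh k, hε.1]
      have hall := eventually_all.2 hk
      by_cases hyQ : y ∈ Q'
      · rw [Set.indicator_of_mem hyQ]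
        refine Tendsto.congr' ?_ ((hφ.tendsto _).comp hlim0)
        filter_upwards [hall, hev] with ε h1 h2
        refine (Set.indicator_of_mem ?_ φ).symm
        refine ⟨fun k => (h1 k).1.2 (hyQ k), ?_, fun k hk => ((h1 k).2 hk.ne').2 (hyQ k)⟩
        rw [huj]
        nlinarith [hs.1, h2.1]
      · rw [Set.indicator_of_notMem hyQ]
        refine Tendsto.congr' ?_ tendsto_const_nhds
        filter_upwards [hall] with ε h1
        refine (Set.indicator_of_notMem (fun hx => hyQ fun k => (h1 k).1.1 (hx.1 k)) φ).symm
  refine tendsto_integral_filter_of_dominated_convergence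
    ((Set.Ioc 0 (h j)).indicator fun _ => D * ν.real (Metric.closedBall 0 R)) ?_ ?_ ?_ ?_
  · refine Eventually.of_forall fun ε => ?_
    exact (StronglyMeasurable.integral_prod_right'
      ((hfm ε).comp (hmap ε)).stronglyMeasurable).aestronglyMeasurable
  · filter_upwards [hev] with ε hε
    refine ae_of_all _ fun s => ?_
    by_cases hs : s ∈ Set.Ioc 0 (h j)
    · rw [Set.indicator_of_mem hs]
      have h1 := norm_integral_le_of_norm_le (μ := ν)
        ((integrable_indicator_iff Metric.isClosed_closedBall.measurableSet).2
        (integrableOn_const (isCompact_closedBall _ _).measure_lt_top.ne))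
        (ae_of_all _ fun y => hbound ε hε.1 hε.2 s hs y)
      rw [integral_indicator Metric.isClosed_closedBall.measurableSet, setIntegral_const,
        smul_eq_mul, mul_comm (ν.real _)] at h1
      exact h1
    · rw [Set.indicator_of_notMem hs]
      simp only [hF, hzero ε hε.1 s hs, integral_zero, norm_zero, le_refl]
  · exact (integrable_indicator_iff measurableSet_Ioc).2
      (integrableOn_const (by simp))
  · refine ae_of_all _ fun s => ?_
    by_cases hs : s ∈ Set.Ioc 0 (h j)
    · rw [Set.indicator_of_mem hs]
      exact hinner s hs
    · rw [Set.indicator_of_notMem hs]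
      refine Tendsto.congr' ?_ tendsto_const_nhds
      filter_upwards [hev] with ε hε
      simp only [hF, hzero ε hε.1 s hs, integral_zero]

end FirstVariation

/-! ### Weighted Minkowski sums: support functions and faces -/

section WeightedSums

variable {E : Type*} [NormedAddCommGroup E] [NormedSpace ℝ E] {ι : Type*} [Fintype ι]

lemma wsum_eq_image (K : ι → Set E) (l : ι → ℝ) :
    wsum K l = (fun y : ι → E => ∑ i, l i • y i) '' Set.univ.pi K := by
  ext x
  simp only [wsum, Set.mem_ofPred_eq, Set.mem_image, Set.mem_pi, Set.mem_univ, true_implies]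

lemma wsum_nonempty {K : ι → Set E} (hne : ∀ i, (K i).Nonempty) (l : ι → ℝ) :
    (wsum K l).Nonempty := by
  choose q hq using hne
  exact ⟨_, q, hq, rfl⟩

lemma isCompact_wsum {K : ι → Set E} (hK : ∀ i, IsCompact (K i)) (l : ι → ℝ) :
    IsCompact (wsum K l) := by
  rw [wsum_eq_image]
  exact (isCompact_univ_pi hK).image (by fun_prop)

lemma convex_wsum {K : ι → Set E} (hK : ∀ i, Convex ℝ (K i)) (l : ι → ℝ) :
    Convex ℝ (wsum K l) := by
  rintro _ ⟨x, hx, rfl⟩ _ ⟨y, hy, rfl⟩ a b ha hb hab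
  refine ⟨fun i => a • x i + b • y i, fun i => hK i (hx i) (hy i) ha hb hab, ?_⟩
  rw [Finset.smul_sum, Finset.smul_sum, ← Finset.sum_add_distrib]
  refine Finset.sum_congr rfl fun i _ => ?_
  rw [smul_add, smul_comm (l i), smul_comm (l i)]

lemma wsum_subset_closedBall {K : ι → Set E} {C : ι → ℝ} (hC : ∀ i, ∀ x ∈ K i, ‖x‖ ≤ C i)
    {l L : ι → ℝ} (hl : ∀ i, 0 ≤ l i) (hL : ∀ i, l i ≤ L i) :
    wsum K l ⊆ Metric.closedBall 0 (∑ i, L i * C i) := by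
  rintro _ ⟨y, hy, rfl⟩
  rw [mem_closedBall_zero_iff]
  refine (norm_sum_le _ _).trans (Finset.sum_le_sum fun i _ => ?_)
  rw [norm_smul, Real.norm_of_nonneg (hl i)]
  exact mul_le_mul (hL i) (hC i _ (hy i)) (norm_nonneg _) ((hl i).trans (hL i))

lemma sum_supportFun_le {K : ι → Set E} (hK : ∀ i, Bornology.IsBounded (K i)) {l : ι → ℝ}
    (hl : ∀ i, 0 ≤ l i) (u : StrongDual ℝ E) {x : E} (hx : x ∈ wsum K l) :
    ∑ i, l i * supportFun (K i) u ≤ u x := by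
  obtain ⟨y, hy, rfl⟩ := hx
  rw [map_sum]
  refine Finset.sum_le_sum fun i _ => ?_
  rw [map_smul, smul_eq_mul]
  exact mul_le_mul_of_nonneg_left (supportFun_le (hK i) u (hy i)) (hl i)

lemma supportFun_wsum {K : ι → Set E} (hK : ∀ i, IsCompact (K i)) (hne : ∀ i, (K i).Nonempty)
    {l : ι → ℝ} (hl : ∀ i, 0 ≤ l i) (u : StrongDual ℝ E) :
    supportFun (wsum K l) u = ∑ i, l i * supportFun (K i) u := by
  refine le_antisymm ?_ (le_supportFun (wsum_nonempty hne l) fun x hx =>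
    sum_supportFun_le (fun i => (hK i).isBounded) hl u hx)
  choose q hq hqu using fun i => exists_eq_supportFun (hK i) (hne i) u
  refine (supportFun_le (isCompact_wsum hK l).isBounded u ⟨q, hq, rfl⟩).trans_eq ?_
  simp [hqu]

/-- The summands of a point of a face lie in the corresponding faces. -/
lemma mem_face_of_sum_mem_face {K : ι → Set E} (hK : ∀ i, IsCompact (K i))
    (hne : ∀ i, (K i).Nonempty) {l : ι → ℝ} (hl : ∀ i, 0 ≤ l i) {u : StrongDual ℝ E}
    {y : ι → E} (hy : ∀ i, y i ∈ K i) (h : ∑ i, l i • y i ∈ face (wsum K l) u) (i : ι)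
    (hi : l i ≠ 0) : y i ∈ face (K i) u := by
  have hb := fun i => (hK i).isBounded
  rw [mem_face_iff (isCompact_wsum hK l).isBounded, supportFun_wsum hK hne hl] at h
  have h1 := h.2
  rw [map_sum] at h1
  have h2 : ∀ j ∈ Finset.univ, l j * supportFun (K j) u ≤ u (l j • y j) := fun j _ => by
    rw [map_smul, smul_eq_mul]
    exact mul_le_mul_of_nonneg_left (supportFun_le (hb j) u (hy j)) (hl j)
  have h3 := (Finset.sum_eq_sum_iff_of_le h2).1 h1.symm i (Finset.mem_univ i)
  rw [map_smul, smul_eq_mul] at h3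
  exact (mem_face_iff (hb i)).2 ⟨hy i, (mul_left_cancel₀ hi h3).symm⟩

lemma sum_mem_face {K : ι → Set E} (hK : ∀ i, IsCompact (K i))
    (hne : ∀ i, (K i).Nonempty) {l : ι → ℝ} (hl : ∀ i, 0 ≤ l i) {u : StrongDual ℝ E}
    {y : ι → E} (hy : ∀ i, y i ∈ face (K i) u) : ∑ i, l i • y i ∈ face (wsum K l) u := by
  rw [mem_face_iff (isCompact_wsum hK l).isBounded, supportFun_wsum hK hne hl, map_sum]
  refine ⟨⟨y, fun i => (hy i).1, rfl⟩, Finset.sum_congr rfl fun i _ => ?_⟩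
  rw [map_smul, smul_eq_mul, ((mem_face_iff (hK i).isBounded).1 (hy i)).2]

/-- The face of a sum is the sum of the faces. A summand of weight zero need not lie in its face and
is replaced by the base point `q i`. -/
lemma face_wsum_translate {K : ι → Set E} (hK : ∀ i, IsCompact (K i))
    (hne : ∀ i, (K i).Nonempty) {l : ι → ℝ} (hl : ∀ i, 0 ≤ l i) {u : StrongDual ℝ E}
    {q : ι → E} (hq : ∀ i, q i ∈ face (K i) u) :
    {y : u.ker | ∑ i, l i • q i + (y : E) ∈ face (wsum K l) u} =
      wsum (fun i => {y : u.ker | q i + (y : E) ∈ face (K i) u}) l := by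
  have hb := fun i => (hK i).isBounded
  ext y
  constructor
  · intro hy
    have hy0 : ∑ i, l i • q i + (y : E) ∈ face (wsum K l) u := hy
    obtain ⟨x, hx, hsum⟩ := hy0.1
    rw [← hsum] at hy0
    have hf := fun i => mem_face_of_sum_mem_face hK hne hl hx hy0 i
    classical
    have hx' : ∀ i, (if l i = 0 then q i else x i) ∈ face (K i) u := fun i => by
      split_ifs with h0
      · exact hq i
      · exact hf i h0
    refine ⟨fun i => ⟨(if l i = 0 then q i else x i) - q i, ?_⟩, fun i => ?_, Subtype.ext ?_⟩
    · rw [LinearMap.mem_ker, ContinuousLinearMap.coe_coe, map_sub,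
        ((mem_face_iff (hb i)).1 (hx' i)).2, ((mem_face_iff (hb i)).1 (hq i)).2, sub_self]
    · simpa using hx' i
    · rw [Submodule.coe_sum]
      have h1 : (y : E) = ∑ i, l i • x i - ∑ i, l i • q i := by rw [hsum]; abel
      rw [h1, ← Finset.sum_sub_distrib]
      refine Finset.sum_congr rfl fun i _ => ?_
      rw [Submodule.coe_smul, smul_sub]
      split_ifs with h0
      · simp [h0]
      · rfl
  · rintro ⟨x, hx, rfl⟩
    have := sum_mem_face hK hne hl (u := u) hx
    simpa [smul_add, Finset.sum_add_distrib] using this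

lemma wsum_translate (K : ι → Set E) (q : ι → E) (l : ι → ℝ) :
    wsum (fun i => {y | q i + y ∈ K i}) l = (fun x => ∑ i, l i • q i + x) ⁻¹' wsum K l := by
  ext x
  constructor
  · rintro ⟨y, hy, rfl⟩
    exact ⟨fun i => q i + y i, hy, by simp [smul_add, Finset.sum_add_distrib]⟩
  · rintro ⟨y, hy, h⟩
    refine ⟨fun i => y i - q i, fun i => by simpa using hy i, ?_⟩
    dsimp only at h
    simp only [smul_sub, Finset.sum_sub_distrib, h]
    abel

lemma supportFun_smul (C : Set E) (u : StrongDual ℝ E) {c : ℝ} (hc : 0 ≤ c) :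
    supportFun C (c • u) = c * supportFun C u := by
  rw [supportFun, supportFun, ← smul_eq_mul, ← Real.sInf_smul_of_nonneg hc, ← Set.image_smul,
    Set.image_image]
  rfl

lemma supportFun_zero (C : Set E) : supportFun C (0 : StrongDual ℝ E) = 0 := by
  simpa using supportFun_smul C (0 : StrongDual ℝ E) le_rfl

end WeightedSums

/-! ### Systems of normal vectors -/

section Normals

open Filter Topology

variable {E : Type*} [NormedAddCommGroup E] [NormedSpace ℝ E]

/-- A finite set of nonzero functionals, no two of which are positively proportional. -/
def IsNormalSystem (U : Finset (StrongDual ℝ E)) : Prop :=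
  (∀ u ∈ U, u ≠ 0) ∧ ∀ u ∈ U, ∀ v ∈ U, ∀ c : ℝ, 0 < c → v = c • u → v = u

open scoped Classical in
/-- Rescaling of a system of slopes. -/
lemma wsum_eq_of_rescale {ι : Type*} [Fintype ι] {K : ι → Set E} {l : ι → ℝ}
    (U : Finset (StrongDual ℝ E))
    (h : wsum K l = {x | ∀ u ∈ U, ∑ i, l i * supportFun (K i) u ≤ u x})
    (r : StrongDual ℝ E → StrongDual ℝ E) (hr : ∀ u ∈ U, u ≠ 0 → ∃ c : ℝ, 0 < c ∧ u = c • r u) :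
    wsum K l = {x | ∀ u ∈ (U.filter (· ≠ 0)).image r, ∑ i, l i * supportFun (K i) u ≤ u x} := by
  have key : ∀ u ∈ U, u ≠ 0 → ∀ x, (∑ i, l i * supportFun (K i) u ≤ u x ↔
      ∑ i, l i * supportFun (K i) (r u) ≤ r u x) := by
    intro u hu h0 x
    obtain ⟨c, hc, hcu⟩ := hr u hu h0
    rw [show ∑ i, l i * supportFun (K i) u = c * ∑ i, l i * supportFun (K i) (r u) by
      rw [Finset.mul_sum]
      refine Finset.sum_congr rfl fun i _ => ?_
      conv_lhs => rw [hcu]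
      rw [supportFun_smul _ _ hc.le]; ring]
    conv_lhs => rw [hcu]
    rw [← hcu, show u x = c * r u x by conv_lhs => rw [hcu]
                                       rfl]
    exact mul_le_mul_iff_right₀ hc
  rw [h]
  ext x
  simp only [Set.mem_ofPred_eq, Finset.mem_image, Finset.mem_filter, forall_exists_index, and_imp]
  constructor
  · rintro hx _ u hu h0 rfl
    exact (key u hu h0 x).1 (hx u hu)
  · intro hx u hu
    by_cases h0 : u = 0
    · simp [h0, supportFun_zero]
    · exact (key u hu h0 x).2 (hx _ u hu h0 rfl)

/-- All weighted Minkowski sums of a family of polytopes are cut out by one normal system. -/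
lemma exists_isNormalSystem_wsum [FiniteDimensional ℝ E] {ι : Type*} [Fintype ι] {K : ι → Set E}
    (hK : ∀ i, IsHPoly (id : E → E) ⊤ (K i)) (hne : ∀ i, (K i).Nonempty) :
    ∃ U : Finset (StrongDual ℝ E), IsNormalSystem U ∧ ∀ l : ι → ℝ, (∀ i, 0 ≤ l i) →
      wsum K l = {x | ∀ u ∈ U, ∑ i, l i * supportFun (K i) u ≤ u x} := by
  classical
  obtain ⟨U, -, hU⟩ := exists_slopes_wsum (Module.finBasis ℝ E) ⊤ K
    (fun i => (hK i).mono _) hne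
  have hn : ∀ u : StrongDual ℝ E, u ≠ 0 → ‖‖u‖⁻¹ • u‖ = 1 := fun u hu => by
    rw [norm_smul, norm_inv, norm_norm, inv_mul_cancel₀ (norm_ne_zero_iff.2 hu)]
  -- Unit length selects one functional on each ray, so positively proportional members coincide.
  refine ⟨(U.filter (· ≠ 0)).image fun u => ‖u‖⁻¹ • u, ⟨?_, ?_⟩, fun l hl =>
    wsum_eq_of_rescale U (hU l hl) _ fun u _ h0 => ⟨‖u‖, norm_pos_iff.2 h0, ?_⟩⟩
  · intro u hu h0
    obtain ⟨v, hv, rfl⟩ := Finset.mem_image.1 hu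
    have := hn v (Finset.mem_filter.1 hv).2
    rw [h0, norm_zero] at this
    exact zero_ne_one this
  · intro u hu v hv c hc h
    obtain ⟨u', hu', rfl⟩ := Finset.mem_image.1 hu
    obtain ⟨v', hv', rfl⟩ := Finset.mem_image.1 hv
    have h1 := congrArg norm h
    rw [hn _ (Finset.mem_filter.1 hv').2, norm_smul, hn _ (Finset.mem_filter.1 hu').2,
      Real.norm_of_nonneg hc.le, mul_one] at h1
    rw [h, ← h1, one_smul]
  · rw [smul_smul, mul_inv_cancel₀ (norm_ne_zero_iff.2 h0), one_smul]

lemma isClosed_setOf_le (U : Finset (StrongDual ℝ E)) (b : StrongDual ℝ E → ℝ) :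
    IsClosed {x | ∀ u ∈ U, b u ≤ u x} := by
  have : {x | ∀ u ∈ U, b u ≤ u x} = {x | ∀ u : U, b u ≤ (u : StrongDual ℝ E) x} := by
    ext x; simp
  rw [this]
  exact isClosed_halfSpaces (fun u : U => (u : StrongDual ℝ E)) fun u => b u

variable [FiniteDimensional ℝ E] [MeasurableSpace E] [BorelSpace E]

/-- The measure of a polytope depends continuously on the positions of its sides. -/
lemma continuousOn_measureReal_halfSpaces (μ : Measure E) [μ.IsAddHaarMeasure]
    {U : Finset (StrongDual ℝ E)} (hU : ∀ u ∈ U, u ≠ 0) {I : Set ℝ} {b : ℝ → StrongDual ℝ E → ℝ}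
    (hb : ∀ u ∈ U, ContinuousOn (fun t => b t u) I) {B : Set E} (hB : Bornology.IsBounded B)
    (hsub : ∀ t ∈ I, {x | ∀ u ∈ U, b t u ≤ u x} ⊆ B) :
    ContinuousOn (fun t => μ.real {x | ∀ u ∈ U, b t u ≤ u x}) I := by
  have : ProperSpace E := FiniteDimensional.proper ℝ E
  intro t ht
  have hfin : μ (closure B) ≠ ∞ := hB.isCompact_closure.measure_lt_top.ne
  have hsub' : {x | ∀ u ∈ U, b t u ≤ u x} ⊆ closure B := (hsub t ht).trans subset_closure
  refine (ENNReal.tendsto_toReal (measure_ne_top_of_subset hsub' hfin)).comp ?_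
  refine tendsto_measure_of_ae_tendsto_indicator _ (isClosed_setOf_le U _).measurableSet
    (fun s => (isClosed_setOf_le U _).measurableSet) isClosed_closure.measurableSet hfin ?_ ?_
  · filter_upwards [self_mem_nhdsWithin] with s hs using (hsub s hs).trans subset_closure
  -- Away from the bounding hyperplanes, which are null, membership does not change under small
  -- displacements of the sides.
  · have hae : ∀ᵐ x ∂μ, ∀ u ∈ U, u x ≠ b t u := by
      rw [eventually_all_finset]
      intro u hu
      exact measure_eq_zero_iff_ae_notMem.1 (addHaar_level_eq_zero μ (hU u hu) (b t u))
    filter_upwards [hae] with x hx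
    have : ∀ᶠ s in 𝓝[I] t, ∀ u ∈ U, (b s u ≤ u x ↔ b t u ≤ u x) := by
      rw [eventually_all_finset]
      intro u hu
      have h1 := hb u hu t ht
      rcases lt_or_gt_of_ne (hx u hu) with h | h
      · filter_upwards [h1.eventually_const_lt h] with s hs
        exact ⟨fun h' => absurd hs h'.not_gt, fun h' => absurd h h'.not_gt⟩
      · filter_upwards [h1.eventually_lt_const h] with s hs
        exact ⟨fun _ => h.le, fun _ => hs.le⟩
    filter_upwards [this] with s hs
    exact forall₂_congr hs

/-- The integral of `f` over the face `C^u`, moved into the kernel of `u`. -/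
def faceIntegral {u : StrongDual ℝ E} (ν : Measure u.ker) (C : Set E) (p : E) (f : E → ℝ) : ℝ :=
  ∫ y in {y : u.ker | p + (y : E) ∈ face C u}, f (p + y) ∂ν

/-- The first variation of the integral of a continuous function over a polytope. -/
theorem tendsto_integral_boundaryLayer (μ : Measure E) [μ.IsAddHaarMeasure]
    {U : Finset (StrongDual ℝ E)} (hU : IsNormalSystem U) {Q : Set E} (hQ : Bornology.IsBounded Q)
    (hQU : Q = {x | ∀ u ∈ U, supportFun Q u ≤ u x})
    (ν : ∀ u : StrongDual ℝ E, Measure u.ker)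
    (hν : ∀ u ∈ U, (ν u).IsAddHaarMeasure ∧ IsDisintegration μ u (ν u))
    {h : StrongDual ℝ E → ℝ} (hh : ∀ u ∈ U, 0 ≤ h u) {p : StrongDual ℝ E → E}
    (hp : ∀ u ∈ U, p u ∈ face Q u)
    (hbd : Bornology.IsBounded {x | ∀ u ∈ U, supportFun Q u - h u ≤ u x})
    {φ : E → ℝ} (hφ : Continuous φ) :
    Tendsto (fun ε : ℝ =>
        ε⁻¹ * ∫ x in {x | ∀ u ∈ U, supportFun Q u - ε * h u ≤ u x} \ Q, φ x ∂μ) (𝓝[>] 0)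
      (𝓝 (∑ u ∈ U, h u * faceIntegral (ν u) Q (p u) φ)) := by
  -- An enumeration supplies the order by which the layer is cut into slabs.
  let e := U.equivFin
  let v : Fin U.card → StrongDual ℝ E := fun j => (e.symm j : StrongDual ℝ E)
  have hv : ∀ j, v j ∈ U := fun j => (e.symm j).2
  have hall : ∀ P : StrongDual ℝ E → Prop, (∀ j, P (v j)) ↔ ∀ u ∈ U, P u := fun P =>
    ⟨fun h u hu => by simpa [v] using h (e ⟨u, hu⟩), fun h j => h _ (hv j)⟩
  have hset : ∀ c : StrongDual ℝ E → ℝ, {x | ∀ j, c (v j) ≤ v j x} = {x | ∀ u ∈ U, c u ≤ u x} :=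
    fun c => by ext x; exact hall fun u => c u ≤ u x
  have hbd' : Bornology.IsBounded {x | ∀ j, supportFun Q (v j) - h (v j) ≤ v j x} := by
    rwa [hset fun u => supportFun Q u - h u]
  have hpar : ∀ j k, ∀ c : ℝ, 0 < c → v k = c • v j → k = j := fun j k c hc hck =>
    e.symm.injective (Subtype.ext (hU.2 _ (hv j) _ (hv k) c hc hck))
  have hlim := tendsto_finsetSum Finset.univ fun j _ => by
    have := (hν (v j) (hv j)).1
    exact tendsto_integral_slab μ v (fun j => hU.1 _ (hv j)) hpar j (ν (v j)) (hν _ (hv j)).2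
      (fun k => supportFun Q (v k)) (fun k => h (v k)) (fun k => hh _ (hv k)) (p (v j))
      (fun k => supportFun_le hQ _ (hp _ (hv j)).1) ((mem_face_iff hQ).1 (hp _ (hv j))).2 hbd' hφ
  have hface : ∀ j, {y : (v j).ker | ∀ k, supportFun Q (v k) ≤ v k (p (v j) + y)} =
      {y : (v j).ker | p (v j) + (y : E) ∈ face Q (v j)} := by
    intro j
    ext y
    have hy : v j (y : E) = 0 := y.2
    have h1 : v j (p (v j) + y) = supportFun Q (v j) := by
      rw [map_add, hy, add_zero, ((mem_face_iff hQ).1 (hp _ (hv j))).2]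
    simp only [Set.mem_ofPred_eq]
    rw [mem_face_iff hQ, h1]
    simp only [and_true]
    conv_rhs => rw [hQU]
    exact hall fun u => supportFun Q u ≤ u (p (v j) + y)
  have hsum : ∑ j, h (v j) * ∫ y in {y : (v j).ker | ∀ k, supportFun Q (v k) ≤ v k (p (v j) + y)},
      φ (p (v j) + y) ∂(ν (v j)) = ∑ u ∈ U, h u * faceIntegral (ν u) Q (p u) φ := by
    simp only [hface]
    rw [← Finset.sum_coe_sort U]
    exact Equiv.sum_comp e.symm fun u : U => h u * faceIntegral (ν u) Q (p u) φ
  rw [hsum] at hlim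
  refine hlim.congr' ?_
  filter_upwards [Ioc_mem_nhdsGT (zero_lt_one' ℝ)] with ε hε
  have hslab := iUnion_slab v (fun k => supportFun Q (v k)) (fun k => h (v k)) ε
  rw [hset (fun u => supportFun Q u - ε * h u), hset (fun u => supportFun Q u), ← hQU] at hslab
  rw [← hslab, integral_iUnion_fintype (fun j => measurableSet_slab _ _ _ _ _), Finset.mul_sum]
  · intro i j hij
    rw [Function.onFun, Set.disjoint_left]
    intro x hxi hxj
    rcases lt_or_gt_of_ne hij with hlt | hlt
    · exact absurd hxj.2.1 (hxi.2.2 j hlt).not_gt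
    · exact absurd hxi.2.1 (hxj.2.2 i hlt).not_gt
  · intro j
    refine integrableOn_of_isBounded μ (hbd'.subset fun x hx k => ?_) hφ
    have := hx.1 k
    have h2 := hh _ (hv k)
    nlinarith [hε.2]

end Normals

/-! ### The volume of a weighted Minkowski sum has degree `dim E` in the weights -/

section Degree

open Filter Topology

/-- Increasing the weights by ε d moves the side with normal u outwards by ε times -∑ d i Ψ_{K
i}(u). This is nonnegative since every body contains the origin, so the layer formula applies with φ
= 1, and the faces that occur are weighted sums of the faces of the `K i`. -/
lemma slope_tendsto_of_boundaryLayer {E : Type*} [NormedAddCommGroup E] [NormedSpace ℝ E]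
    [FiniteDimensional ℝ E] [MeasurableSpace E] [BorelSpace E]
    (μ : Measure E) [μ.IsAddHaarMeasure] {ι : Type*} [Fintype ι]
    {K : ι → Set E} (hK : ∀ i, IsCompact (K i)) (hne : ∀ i, (K i).Nonempty) (h0 : ∀ i, 0 ∈ K i)
    {U : Finset (StrongDual ℝ E)} (hU : IsNormalSystem U) (hUK : ∀ l : ι → ℝ, (∀ i, 0 ≤ l i) →
      wsum K l = {x | ∀ u ∈ U, ∑ i, l i * supportFun (K i) u ≤ u x})
    (ν : ∀ u : StrongDual ℝ E, Measure u.ker)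
    (hν : ∀ u ∈ U, (ν u).IsAddHaarMeasure ∧ IsDisintegration μ u (ν u))
    {q : StrongDual ℝ E → ι → E} (hq : ∀ u i, q u i ∈ face (K i) u)
    {l d : ι → ℝ} (hl : ∀ i, 0 ≤ l i) (hd : ∀ i, 0 ≤ d i) :
    Tendsto (fun ε : ℝ => ε⁻¹ * (μ.real (wsum K (l + ε • d)) - μ.real (wsum K l))) (𝓝[>] 0)
      (𝓝 (∑ u ∈ U, (-∑ i, d i * supportFun (K i) u) *
        (ν u).real (wsum (fun i => {y : u.ker | q u i + (y : E) ∈ face (K i) u}) l))) := by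
  have hb := fun i => (hK i).isBounded
  have hs := fun u => supportFun_wsum hK hne hl u
  have hQU : wsum K l = {x | ∀ u ∈ U, supportFun (wsum K l) u ≤ u x} := by
    simp only [hs]; exact hUK l hl
  have hld : ∀ {ε : ℝ}, 0 ≤ ε → ∀ i, 0 ≤ (l + ε • d) i := fun {ε} hε i =>
    add_nonneg (hl i) (mul_nonneg hε (hd i))
  have hset : ∀ {ε : ℝ}, 0 ≤ ε → wsum K (l + ε • d) =
      {x | ∀ u ∈ U, supportFun (wsum K l) u - ε * (-∑ i, d i * supportFun (K i) u) ≤ u x} := by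
    intro ε hε
    rw [hUK _ (hld hε)]
    ext x
    refine forall₂_congr fun u _ => ?_
    rw [hs, mul_neg, sub_neg_eq_add, Finset.mul_sum, ← Finset.sum_add_distrib]
    simp only [Pi.add_apply, Pi.smul_apply, smul_eq_mul, add_mul, mul_assoc]
  have hneg : ∀ u, ∀ i, supportFun (K i) u ≤ 0 := fun u i => by
    simpa using supportFun_le (hb i) u (h0 i)
  have key := tendsto_integral_boundaryLayer μ hU (isCompact_wsum hK l).isBounded hQU ν hν
    (h := fun u => -∑ i, d i * supportFun (K i) u)
    (fun u _ => by
      rw [← Finset.sum_neg_distrib]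
      exact Finset.sum_nonneg fun i _ => neg_nonneg.2 (mul_nonpos_of_nonneg_of_nonpos (hd i) (hneg u i)))
    (p := fun u => ∑ i, l i • q u i) (fun u _ => sum_mem_face hK hne hl (hq u))
    (by
      have := (isCompact_wsum hK (l + (1 : ℝ) • d)).isBounded
      rw [hset zero_le_one] at this
      simpa using this)
    (φ := fun _ => 1) continuous_const
  have hlim : ∑ u ∈ U, (-∑ i, d i * supportFun (K i) u) *
      faceIntegral (ν u) (wsum K l) (∑ i, l i • q u i) (fun _ => 1) =
      ∑ u ∈ U, (-∑ i, d i * supportFun (K i) u) *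
        (ν u).real (wsum (fun i => {y : u.ker | q u i + (y : E) ∈ face (K i) u}) l) := by
    refine Finset.sum_congr rfl fun u _ => ?_
    rw [faceIntegral, face_wsum_translate hK hne hl (hq u)]
    simp
  rw [hlim] at key
  refine key.congr' ?_
  filter_upwards [self_mem_nhdsWithin] with ε hε
  rw [Set.mem_Ioi] at hε
  have hsub : wsum K l ⊆ wsum K (l + ε • d) := by
    rw [hset hε.le]
    intro x hx u hu
    have h1 := supportFun_le (isCompact_wsum hK l).isBounded u hx
    have h2 : 0 ≤ -∑ i, d i * supportFun (K i) u := by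
      rw [← Finset.sum_neg_distrib]
      exact Finset.sum_nonneg fun i _ => neg_nonneg.2 (mul_nonpos_of_nonneg_of_nonpos (hd i) (hneg u i))
    have := mul_nonneg hε.le h2
    linarith
  rw [← hset hε.le]
  have h3 := measureReal_sdiff hsub (isCompact_wsum hK l).isClosed.measurableSet (μ := μ)
    (h₁ := (isCompact_wsum hK (l + ε • d)).measure_lt_top.ne)
  simp only [setIntegral_const, smul_eq_mul, mul_one, h3]

lemma IsHPoly.translate {E : Type*} [NormedAddCommGroup E] [NormedSpace ℝ E] {K : Set E}
    (hK : IsHPoly (id : E → E) ⊤ K) (q : E) : IsHPoly (id : E → E) ⊤ {y | q + y ∈ K} := by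
  classical
  obtain ⟨hb, H, -, h⟩ := hK
  refine ⟨?_, H.image fun h => (h.1, h.2 + h.1 q), fun _ _ _ => trivial, ?_⟩
  · have : {y | q + y ∈ K} = (fun x => -q + x) '' K := by
      ext y
      simp only [Set.mem_ofPred_eq, Set.mem_image]
      exact ⟨fun hy => ⟨_, hy, by simp⟩, by rintro ⟨x, hx, rfl⟩; simpa using hx⟩
    rw [this]
    exact (LipschitzWith.of_dist_le_mul (K := 1) fun x y => by simp).isBounded_image hb
  · ext y
    rw [Set.mem_ofPred_eq, h]
    simp only [Set.mem_ofPred_eq, Finset.mem_image, forall_exists_index, and_imp,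
      forall_apply_eq_imp_iff₂, map_add]
    exact forall₂_congr fun a _ => by rw [add_comm (a.1 q), add_assoc, add_comm (a.1 q)]

/-- This keeps the induction on the dimension within the class of polytopes. -/
lemma IsHPoly.face_translate {E : Type*} [NormedAddCommGroup E] [NormedSpace ℝ E] {K : Set E}
    (hK : IsHPoly (id : E → E) ⊤ K) {u : StrongDual ℝ E} {q : E} (hq : q ∈ face K u) :
    IsHPoly (id : u.ker → u.ker) ⊤ {y : u.ker | q + (y : E) ∈ face K u} := by
  classical
  obtain ⟨hb, H, -, h⟩ := (hK.translate q)
  have h1 : {y : u.ker | q + (y : E) ∈ face K u} = (fun y : u.ker => (y : E)) ⁻¹' {y | q + y ∈ K} := by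
    ext y
    have hy : u (y : E) = 0 := y.2
    simp only [face, Set.mem_ofPred_eq, Set.mem_preimage, map_add, hy, add_zero]
    exact ⟨fun h => h.1, fun h => ⟨h, hq.2⟩⟩
  refine ⟨?_, H.image fun h => (h.1.comp u.ker.subtypeL, h.2), fun _ _ _ => trivial, ?_⟩
  · rw [h1]
    exact isometry_subtype_coe.antilipschitz.isBounded_preimage hb
  · rw [h1, h]
    ext y
    simp only [Set.mem_ofPred_eq, Set.mem_preimage, Finset.mem_image, forall_exists_index, and_imp,
      forall_apply_eq_imp_iff₂, ContinuousLinearMap.comp_apply, Submodule.subtypeL_apply]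

universe v in
-- Induction on the dimension. Singling out one direction `d a`, the alternating sum is φ(0) - φ(1),
-- where φ(t) is the alternating sum over the other directions started at l + t d_a. The right
-- derivative of φ is a combination of the same alternating sums for faces, where both the dimension
-- and the number of directions have dropped, so it vanishes. Since φ is continuous, it is constant.
theorem sum_measureReal_wsum_of_polytope {ι κ : Type*} [Fintype ι] (n : ℕ) :
    ∀ {E : Type v} [NormedAddCommGroup E] [NormedSpace ℝ E] [FiniteDimensional ℝ E]
      [MeasurableSpace E] [BorelSpace E] (μ : Measure E) [μ.IsAddHaarMeasure]
      (_ : Module.finrank ℝ E = n) {K : ι → Set E} (_ : ∀ i, IsHPoly (id : E → E) ⊤ (K i))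
      (_ : ∀ i, (K i).Nonempty) (s : Finset κ) {d : κ → ι → ℝ} (_ : ∀ j i, 0 ≤ d j i)
      {l : ι → ℝ} (_ : ∀ i, 0 ≤ l i) (_ : n < s.card),
      ∑ I ∈ s.powerset, (-1 : ℝ) ^ I.card * μ.real (wsum K (l + ∑ j ∈ I, d j)) = 0 := by
  classical
  induction n using Nat.strong_induction_on with
  | _ n ih =>
  intro E _ _ _ _ _ μ _ hfin K hK hne s d hd l hl hs
  -- translate the polytopes so that they contain the origin
  wlog h0 : ∀ i, (0 : E) ∈ K i generalizing K with H
  · choose p hp using hne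
    have := H (K := fun i => {y | p i + y ∈ K i}) (fun i => (hK i).translate (p i))
      (fun i => ⟨0, by simpa using hp i⟩) (fun i => by simpa using hp i)
    simpa only [wsum_translate, measureReal_def, measure_preimage_add] using this
  have hKc := fun i => (hK i).isCompact
  obtain ⟨U, hU, hUK⟩ := exists_isNormalSystem_wsum hK hne
  have hνex : ∀ u : StrongDual ℝ E, ∃ ν : Measure u.ker, u ∈ U →
      ν.IsAddHaarMeasure ∧ IsDisintegration μ u ν := by
    intro u
    by_cases hu : u ∈ U
    · obtain ⟨ν, hν⟩ := exists_isDisintegration μ (hU.1 u hu)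
      exact ⟨ν, fun _ => hν⟩
    · exact ⟨0, fun h => absurd h hu⟩
  choose ν hν using hνex
  choose q hq using fun (u : StrongDual ℝ E) i => face_nonempty (hKc i) (hne i) u
  obtain ⟨a, s', ha, rfl⟩ : ∃ a s', a ∉ s' ∧ s = insert a s' := by
    obtain ⟨a, ha⟩ : s.Nonempty := Finset.card_pos.1 (by omega)
    exact ⟨a, s.erase a, Finset.notMem_erase a s, (Finset.insert_erase ha).symm⟩
  rw [Finset.card_insert_of_notMem ha] at hs
  rw [Finset.sum_powerset_insert ha]
  set V : (ι → ℝ) → ℝ := fun l => μ.real (wsum K l) with hV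
  set lam : ℝ → Finset κ → ι → ℝ := fun t I => l + t • d a + ∑ j ∈ I, d j with hlam
  have hlam0 : ∀ {t : ℝ}, 0 ≤ t → ∀ I i, 0 ≤ lam t I i := by
    intro t ht I i
    simp only [hlam, Pi.add_apply, Pi.smul_apply, smul_eq_mul, Finset.sum_apply]
    exact add_nonneg (add_nonneg (hl i) (mul_nonneg ht (hd a i))) (Finset.sum_nonneg fun j _ => hd j i)
  set φ : ℝ → ℝ := fun t => ∑ I ∈ s'.powerset, (-1 : ℝ) ^ I.card * V (lam t I) with hφ
  have hcont : ContinuousOn φ (Set.Icc 0 1) := by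
    refine continuousOn_finsetSum _ fun I _ => continuousOn_const.mul ?_
    have h1 : ContinuousOn (fun t => μ.real {x | ∀ u ∈ U,
        ∑ i, lam t I i * supportFun (K i) u ≤ u x}) (Set.Icc 0 1) := by
      refine continuousOn_measureReal_halfSpaces μ hU.1 (fun u _ => ?_)
        (B := {x | ∃ c ∈ Set.Icc (0 : ℝ) 1, x ∈ wsum K (lam c I)}) ?_ fun t ht x hx => ?_
      · refine Continuous.continuousOn ?_
        simp only [hlam, Pi.add_apply, Pi.smul_apply, smul_eq_mul]
        fun_prop
      · choose C hC using fun i => (hKc i).isBounded.exists_norm_le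
        refine (Metric.isBounded_closedBall (x := (0 : E))
          (r := ∑ i, lam 1 I i * C i)).subset ?_
        rintro x ⟨t, ht, hx⟩
        refine wsum_subset_closedBall hC (hlam0 ht.1 I) (fun i => ?_) hx
        simp only [hlam, Pi.add_apply, Pi.smul_apply, smul_eq_mul]
        gcongr
        · exact hd a i
        · exact ht.2
      · rw [← hUK _ (hlam0 ht.1 I)] at hx
        exact ⟨t, ht, hx⟩
    refine h1.congr fun t ht => ?_
    simp only [hV]
    rw [hUK _ (hlam0 ht.1 I)]
  have hderiv : ∀ t ∈ Set.Ico (0 : ℝ) 1, HasDerivWithinAt φ 0 (Set.Ici t) t := by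
    intro t ht
    rw [← hasDerivWithinAt_Ioi_iff_Ici, hasDerivWithinAt_iff_tendsto_slope' Set.self_notMem_Ioi]
    have h1 := tendsto_finsetSum s'.powerset fun I _ => (slope_tendsto_of_boundaryLayer μ hKc hne h0
      hU hUK ν hν hq (hlam0 ht.1 I) (hd a)).const_mul ((-1 : ℝ) ^ I.card)
    have h2 : ∑ I ∈ s'.powerset, (-1 : ℝ) ^ I.card * ∑ u ∈ U, (-∑ i, d a i * supportFun (K i) u) *
        (ν u).real (wsum (fun i => {y : u.ker | q u i + (y : E) ∈ face (K i) u}) (lam t I)) = 0 := by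
      simp_rw [Finset.mul_sum]
      rw [Finset.sum_comm]
      refine Finset.sum_eq_zero fun u hu => ?_
      have hfk : Module.finrank ℝ u.ker < Module.finrank ℝ E :=
        Submodule.finrank_lt fun htop => hU.1 u hu (ContinuousLinearMap.ext fun x => by
          have : x ∈ u.ker := htop ▸ Submodule.mem_top
          simpa using this)
      have := (hν u hu).1
      have h3 := ih (Module.finrank ℝ u.ker) (hfin ▸ hfk) (ν u) rfl
        (K := fun i => {y : u.ker | q u i + (y : E) ∈ face (K i) u})
        (fun i => (hK i).face_translate (hq u i)) (fun i => ⟨0, by simpa using hq u i⟩)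
        s' hd (l := l + t • d a)
        (fun i => add_nonneg (hl i) (mul_nonneg ht.1 (hd a i))) (by omega)
      rw [← mul_zero (-∑ i, d a i * supportFun (K i) u), ← h3, Finset.mul_sum]
      refine Finset.sum_congr rfl fun I _ => ?_
      simp only [hlam]
      ring
    rw [h2] at h1
    have h4 : Tendsto (fun x : ℝ => x - t) (𝓝[>] t) (𝓝[>] 0) := by
      refine tendsto_nhdsWithin_iff.2 ⟨?_, ?_⟩
      · have : Continuous fun x : ℝ => x - t := by fun_prop
        simpa using (this.tendsto t).mono_left nhdsWithin_le_nhds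
      · filter_upwards [self_mem_nhdsWithin] with x hx using sub_pos.2 (Set.mem_Ioi.1 hx)
    refine (h1.comp h4).congr fun x => ?_
    simp only [Function.comp_apply, slope_def_field, hφ, div_eq_inv_mul]
    rw [← Finset.sum_sub_distrib, Finset.mul_sum]
    refine Finset.sum_congr rfl fun I _ => ?_
    have h5 : lam t I + (x - t) • d a = lam x I := by
      simp only [hlam, sub_smul]; abel
    rw [h5]
    ring
  have hfinal := constant_of_has_deriv_right_zero hcont hderiv 1 ⟨zero_le_one, le_rfl⟩
  have e0 : ∑ I ∈ s'.powerset, (-1 : ℝ) ^ I.card * V (l + ∑ j ∈ I, d j) = φ 0 := by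
    simp [hφ, hlam]
  have e1 : ∑ I ∈ s'.powerset, (-1 : ℝ) ^ (insert a I).card * V (l + ∑ j ∈ insert a I, d j) =
      -φ 1 := by
    simp only [hφ]
    rw [← Finset.sum_neg_distrib]
    refine Finset.sum_congr rfl fun I hI => ?_
    have haI : a ∉ I := fun h => ha (Finset.mem_powerset.1 hI h)
    rw [Finset.card_insert_of_notMem haI, Finset.sum_insert haI, pow_succ]
    simp only [hlam, one_smul, add_assoc]
    ring
  rw [e0, e1, hfinal]
  ring

/-- Outer approximation of a compact convex set by polytopes. -/
lemma exists_polytope_subset_thickening {E : Type*} [NormedAddCommGroup E] [NormedSpace ℝ E]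
    [FiniteDimensional ℝ E] {K : Set E} (hK : IsCompact K) (hc : Convex ℝ K) {δ : ℝ} (hδ : 0 < δ) :
    ∃ P, IsHPoly (id : E → E) ⊤ P ∧ K ⊆ P ∧ P ⊆ Metric.thickening δ K := by
  classical
  have : ProperSpace E := FiniteDimensional.proper ℝ E
  let b := Module.finBasis ℝ E
  let e := b.equivFunL
  obtain ⟨C, hC⟩ := (hK.image e.continuous).isBounded.exists_norm_le
  let f : Fin (Module.finrank ℝ E) → StrongDual ℝ E := fun k =>
    (ContinuousLinearMap.proj k).comp (e : E →L[ℝ] (Fin (Module.finrank ℝ E) → ℝ))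
  have hf : ∀ k x, f k x = e x k := fun k x => rfl
  let H0 : Finset (StrongDual ℝ E × ℝ) :=
    Finset.univ.image (fun k => (f k, C)) ∪ Finset.univ.image (fun k => (-f k, C))
  let B : Set E := {x | ∀ h ∈ H0, 0 ≤ h.1 x + h.2}
  have hB : ∀ x, x ∈ B ↔ ∀ k, |e x k| ≤ C := by
    intro x
    simp only [B, H0, Set.mem_ofPred_eq, Finset.mem_union, Finset.mem_image, Finset.mem_univ,
      true_and]
    constructor
    · intro h k
      have h1 := h _ (Or.inl ⟨k, rfl⟩)
      have h2 := h _ (Or.inr ⟨k, rfl⟩)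
      simp only [neg_apply, hf] at h1 h2
      exact abs_le.2 ⟨by linarith, by linarith⟩
    · rintro h _ (⟨k, rfl⟩ | ⟨k, rfl⟩)
      · have := (abs_le.1 (h k)).1
        simp only [hf]
        linarith
      · have := (abs_le.1 (h k)).2
        simp only [neg_apply, hf]
        linarith
  have hBc : IsCompact B := by
    have h1 : B = e.symm '' (Set.univ.pi fun _ => Set.Icc (-C) C) := by
      ext x
      rw [hB]
      constructor
      · intro h
        exact ⟨e x, fun k _ => abs_le.1 (h k), by simp⟩
      · rintro ⟨y, hy, rfl⟩ k
        simpa using abs_le.2 (hy k (Set.mem_univ k))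
    rw [h1]
    exact (isCompact_univ_pi fun _ => isCompact_Icc).image e.symm.continuous
  have hKB : K ⊆ B := fun x hx => (hB x).2 fun k =>
    (norm_le_pi_norm (e x) k).trans (hC _ ⟨x, hx, rfl⟩)
  -- `B` is a box containing `K`. Every point of the compact set `T` is strictly cut off from `K` by
  -- a half-space, and finitely many of these half-spaces, together with the box, cut off all of
  -- `T`.
  let T := B \ Metric.thickening δ K
  have hT : IsCompact T := hBc.diff Metric.isOpen_thickening
  have hsep : ∀ x ∈ T, ∃ h : StrongDual ℝ E × ℝ, h.1 x + h.2 < 0 ∧ ∀ y ∈ K, 0 ≤ h.1 y + h.2 := by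
    intro x hx
    have hxK : x ∉ K := fun h => hx.2 (Metric.self_subset_thickening hδ K h)
    obtain ⟨g, c, h1, h2⟩ := geometric_hahn_banach_point_closed hc hK.isClosed hxK
    exact ⟨(g, -c), by simpa using h1, fun y hy => by simpa using (h2 y hy).le⟩
  choose! g hg1 hg2 using hsep
  obtain ⟨t, htT, ht⟩ := hT.elim_nhds_subcover (fun x => {y | (g x).1 y + (g x).2 < 0})
    fun x hx => (isOpen_lt ((g x).1.continuous.add continuous_const) continuous_const).mem_nhds
      (hg1 x hx)
  refine ⟨{x | ∀ h ∈ H0 ∪ t.image g, 0 ≤ h.1 x + h.2},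
    ⟨hBc.isBounded.subset fun x hx h hh => hx h (Finset.mem_union_left _ hh), _,
      fun _ _ _ => trivial, rfl⟩, fun x hx h hh => ?_, fun x hx => ?_⟩
  · rcases Finset.mem_union.1 hh with hh | hh
    · exact hKB hx h hh
    · obtain ⟨y, hy, rfl⟩ := Finset.mem_image.1 hh
      exact hg2 y (htT y hy) x hx
  · by_contra hcon
    have hxT : x ∈ T := ⟨fun h hh => hx h (Finset.mem_union_left _ hh), hcon⟩
    obtain ⟨y, hy, hxy⟩ := Set.mem_iUnion₂.1 (ht hxT)
    exact absurd hxy (hx _ (Finset.mem_union_right _ (Finset.mem_image_of_mem _ hy))).not_gt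

/-- The volume of a weighted Minkowski sum of convex bodies is a polynomial of degree at most
`dim E` in the weights: its differences of higher order vanish. -/
theorem sum_measureReal_wsum {E : Type*} [NormedAddCommGroup E] [NormedSpace ℝ E]
    [FiniteDimensional ℝ E] [MeasurableSpace E] [BorelSpace E] (μ : Measure E) [μ.IsAddHaarMeasure]
    {ι κ : Type*} [Fintype ι] {K : ι → Set E} (hK : ∀ i, IsCompact (K i))
    (hc : ∀ i, Convex ℝ (K i)) (hne : ∀ i, (K i).Nonempty) (s : Finset κ) {d : κ → ι → ℝ}
    (hd : ∀ j i, 0 ≤ d j i) {l : ι → ℝ} (hl : ∀ i, 0 ≤ l i) (hs : Module.finrank ℝ E < s.card) :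
    ∑ I ∈ s.powerset, (-1 : ℝ) ^ I.card * μ.real (wsum K (l + ∑ j ∈ I, d j)) = 0 := by
  have : ProperSpace E := FiniteDimensional.proper ℝ E
  choose P hP hKP hPK using fun (m : ℕ) i =>
    exists_polytope_subset_thickening (hK i) (hc i) (δ := 1 / ((m : ℝ) + 1)) (by positivity)
  -- The sum of the approximating polytopes lies between the sum of the bodies and its thickening of
  -- radius (∑ l i) / (m + 1), whose measure converges because the sum of the bodies is compact.
  have hlim : ∀ l : ι → ℝ, (∀ i, 0 ≤ l i) →
      Tendsto (fun m => μ.real (wsum (P m) l)) atTop (𝓝 (μ.real (wsum K l))) := by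
    intro l hl
    have hW := isCompact_wsum hK l
    refine (ENNReal.tendsto_toReal hW.measure_lt_top.ne).comp ?_
    have h1 : Tendsto (fun m : ℕ => (∑ i, l i) * (1 / ((m : ℝ) + 1))) atTop (𝓝 0) := by
      simpa using tendsto_one_div_add_atTop_nhds_zero_nat.const_mul (∑ i, l i)
    have h2 := (tendsto_measure_cthickening_of_isCompact (μ := μ) hW).comp h1
    refine tendsto_of_tendsto_of_tendsto_of_le_of_le tendsto_const_nhds h2
      (fun m => measure_mono ?_) fun m => measure_mono ?_
    · rintro _ ⟨y, hy, rfl⟩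
      exact ⟨y, fun i => hKP m i (hy i), rfl⟩
    · rintro _ ⟨y, hy, rfl⟩
      choose z hz hyz using fun i => Metric.mem_thickening_iff.1 (hPK m i (hy i))
      refine Metric.mem_cthickening_of_dist_le _ (∑ i, l i • z i) _ _ ⟨z, hz, rfl⟩ ?_
      dsimp only
      rw [Finset.sum_mul]
      refine (dist_sum_sum_le _ _ _).trans (Finset.sum_le_sum fun i _ => ?_)
      rw [dist_smul₀, Real.norm_of_nonneg (hl i)]
      exact mul_le_mul_of_nonneg_left (hyz i).le (hl i)
  have h3 := tendsto_finsetSum s.powerset fun I _ => (hlim (l + ∑ j ∈ I, d j) fun i => by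
    rw [Pi.add_apply, Finset.sum_apply]
    exact add_nonneg (hl i) (Finset.sum_nonneg fun j _ => hd j i)).const_mul ((-1 : ℝ) ^ I.card)
  refine tendsto_nhds_unique h3 ?_
  refine tendsto_const_nhds.congr fun m => ?_
  exact (sum_measureReal_wsum_of_polytope _ μ rfl (hP m) (fun i => (hne i).mono (hKP m i)) s hd hl
    hs).symm

end Degree

/-! ### Weighted sup-convolutions -/

section SupConvolution

open Filter Topology

variable {E : Type*} [NormedAddCommGroup E] [NormedSpace ℝ E]

/-- The sup-convolution of the functions `l i * g i (· / l i)`, a function on `wsum Q l`. -/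
def wfun {ι : Type*} [Fintype ι] (Q : ι → Set E) (g : ι → E → ℝ) (l : ι → ℝ) (x : E) : ℝ :=
  sSup {s | ∃ y : ι → E, (∀ i, y i ∈ Q i) ∧ ∑ i, l i • y i = x ∧ s = ∑ i, l i * g i (y i)}

variable {ι : Type*} [Fintype ι] {Q : ι → Set E} {g : ι → E → ℝ}

lemma continuousOn_sum_apply (hg : ∀ i, ContinuousOn (g i) (Q i)) (l : ι → ℝ) :
    ContinuousOn (fun y : ι → E => ∑ i, l i * g i (y i)) (Set.univ.pi Q) :=
  continuousOn_finsetSum _ fun i _ => continuousOn_const.mul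
    ((hg i).comp (continuous_apply i).continuousOn fun _ hy => hy i (Set.mem_univ i))

lemma isGreatest_wfun (hQ : ∀ i, IsCompact (Q i)) (hg : ∀ i, ContinuousOn (g i) (Q i))
    {l : ι → ℝ} {x : E} (hx : x ∈ wsum Q l) :
    IsGreatest {s | ∃ y : ι → E, (∀ i, y i ∈ Q i) ∧ ∑ i, l i • y i = x ∧
      s = ∑ i, l i * g i (y i)} (wfun Q g l x) := by
  have h1 : {s | ∃ y : ι → E, (∀ i, y i ∈ Q i) ∧ ∑ i, l i • y i = x ∧ s = ∑ i, l i * g i (y i)} =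
      (fun y : ι → E => ∑ i, l i * g i (y i)) ''
        (Set.univ.pi Q ∩ {y | ∑ i, l i • y i = x}) := by
    ext s
    simp only [Set.mem_ofPred_eq, Set.mem_image, Set.mem_inter_iff, Set.mem_pi, Set.mem_univ,
      true_implies]
    constructor
    · rintro ⟨y, hy, h2, rfl⟩
      exact ⟨y, ⟨hy, h2⟩, rfl⟩
    · rintro ⟨y, ⟨hy, h2⟩, rfl⟩
      exact ⟨y, hy, h2, rfl⟩
  rw [wfun, h1]
  refine IsCompact.isGreatest_sSup ?_ ?_
  · refine ((isCompact_univ_pi hQ).inter_right ?_).image_of_continuousOn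
      ((continuousOn_sum_apply hg l).mono Set.inter_subset_left)
    exact isClosed_eq (by fun_prop) continuous_const
  · obtain ⟨y, hy, h2⟩ := hx
    exact ⟨_, y, ⟨fun i _ => hy i, h2⟩, rfl⟩

lemma exists_wfun_eq (hQ : ∀ i, IsCompact (Q i)) (hg : ∀ i, ContinuousOn (g i) (Q i))
    {l : ι → ℝ} {x : E} (hx : x ∈ wsum Q l) :
    ∃ y : ι → E, (∀ i, y i ∈ Q i) ∧ ∑ i, l i • y i = x ∧ wfun Q g l x = ∑ i, l i * g i (y i) :=
  (isGreatest_wfun hQ hg hx).1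

lemma le_wfun (hQ : ∀ i, IsCompact (Q i)) (hg : ∀ i, ContinuousOn (g i) (Q i))
    {l : ι → ℝ} {y : ι → E} (hy : ∀ i, y i ∈ Q i) :
    ∑ i, l i * g i (y i) ≤ wfun Q g l (∑ i, l i • y i) :=
  (isGreatest_wfun hQ hg ⟨y, hy, rfl⟩).2 ⟨y, hy, rfl, rfl⟩

lemma concaveOn_wfun (hQ : ∀ i, IsCompact (Q i)) (hg : ∀ i, ContinuousOn (g i) (Q i))
    (hc : ∀ i, ConcaveOn ℝ (Q i) (g i)) {l : ι → ℝ} (hl : ∀ i, 0 ≤ l i) :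
    ConcaveOn ℝ (wsum Q l) (wfun Q g l) := by
  refine ⟨convex_wsum (fun i => (hc i).1) l, fun x hx y hy a b ha hb hab => ?_⟩
  obtain ⟨x', hx', rfl, hxe⟩ := exists_wfun_eq hQ hg hx
  obtain ⟨y', hy', rfl, hye⟩ := exists_wfun_eq hQ hg hy
  have h1 : a • ∑ i, l i • x' i + b • ∑ i, l i • y' i = ∑ i, l i • (a • x' i + b • y' i) := by
    rw [Finset.smul_sum, Finset.smul_sum, ← Finset.sum_add_distrib]
    refine Finset.sum_congr rfl fun i _ => ?_
    rw [smul_add, smul_comm (l i), smul_comm (l i)]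
  rw [h1, hxe, hye]
  refine le_trans ?_ (le_wfun hQ hg fun i => (hc i).1 (hx' i) (hy' i) ha hb hab)
  simp only [smul_eq_mul]
  rw [Finset.mul_sum, Finset.mul_sum, ← Finset.sum_add_distrib]
  refine Finset.sum_le_sum fun i _ => ?_
  have := mul_le_mul_of_nonneg_left ((hc i).2 (hx' i) (hy' i) ha hb hab) (hl i)
  simp only [smul_eq_mul] at this
  linarith

lemma exists_abs_le (hQ : ∀ i, IsCompact (Q i)) (hg : ∀ i, ContinuousOn (g i) (Q i)) :
    ∃ C, 0 ≤ C ∧ ∀ i, ∀ x ∈ Q i, |g i x| ≤ C := by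
  choose C hC using fun i => (hQ i).exists_bound_of_continuousOn (hg i)
  refine ⟨∑ i, |C i|, Finset.sum_nonneg fun i _ => abs_nonneg _, fun i x hx => ?_⟩
  exact ((hC i x hx).trans (le_abs_self _)).trans
    (Finset.single_le_sum (f := fun i => |C i|) (fun i _ => abs_nonneg _) (Finset.mem_univ i))

lemma abs_wfun_le (hQ : ∀ i, IsCompact (Q i)) (hg : ∀ i, ContinuousOn (g i) (Q i)) {C : ℝ}
    (hC : ∀ i, ∀ x ∈ Q i, |g i x| ≤ C) {l : ι → ℝ} (hl : ∀ i, 0 ≤ l i) {x : E}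
    (hx : x ∈ wsum Q l) : |wfun Q g l x| ≤ ∑ i, l i * C := by
  obtain ⟨y, hy, -, h⟩ := exists_wfun_eq hQ hg hx
  rw [h]
  refine (Finset.abs_sum_le_sum_abs _ _).trans (Finset.sum_le_sum fun i _ => ?_)
  rw [abs_mul, abs_of_nonneg (hl i)]
  exact mul_le_mul_of_nonneg_left (hC i _ (hy i)) (hl i)

/-- Upper semicontinuity: the families of points with total value at least c form a compact set, so
the sums they produce form a closed set, and x is not in it. -/
lemma eventually_wfun_lt (hQ : ∀ i, IsCompact (Q i)) (hg : ∀ i, ContinuousOn (g i) (Q i))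
    {l : ι → ℝ} {x : E} {c : ℝ} (hc : wfun Q g l x < c) :
    ∀ᶠ x' in 𝓝[wsum Q l] x, wfun Q g l x' < c := by
  have h1 : IsCompact ((fun y : ι → E => ∑ i, l i • y i) ''
      (Set.univ.pi Q ∩ (fun y : ι → E => ∑ i, l i * g i (y i)) ⁻¹' Set.Ici c)) := by
    refine IsCompact.image ?_ (by fun_prop)
    exact (isCompact_univ_pi hQ).of_isClosed_subset
      ((continuousOn_sum_apply hg l).preimage_isClosed_of_isClosed
        (isCompact_univ_pi hQ).isClosed isClosed_Ici) Set.inter_subset_left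
  have h2 : x ∉ (fun y : ι → E => ∑ i, l i • y i) ''
      (Set.univ.pi Q ∩ (fun y : ι → E => ∑ i, l i * g i (y i)) ⁻¹' Set.Ici c) := by
    rintro ⟨y, ⟨hy, hcy⟩, rfl⟩
    have h3 : c ≤ ∑ i, l i * g i (y i) := hcy
    exact absurd hc ((h3.trans (le_wfun hQ hg fun i => hy i (Set.mem_univ i))).not_gt)
  filter_upwards [mem_nhdsWithin_of_mem_nhds (h1.isClosed.isOpen_compl.mem_nhds h2),
    self_mem_nhdsWithin] with x' hx' hx'Q
  by_contra hcon
  obtain ⟨y, hy, rfl, h⟩ := exists_wfun_eq hQ hg hx'Q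
  exact hx' ⟨y, ⟨fun i _ => hy i, by rw [h] at hcon; exact not_lt.1 hcon⟩, rfl⟩

/-- A bounded concave function on a polytope is lower semicontinuous. -/
lemma eventually_lt_of_concaveOn {U : Finset (StrongDual ℝ E)} {b : StrongDual ℝ E → ℝ}
    {φ : E → ℝ} (hφ : ConcaveOn ℝ {x | ∀ u ∈ U, b u ≤ u x} φ) {C : ℝ}
    (hC : ∀ x ∈ {x | ∀ u ∈ U, b u ≤ u x}, |φ x| ≤ C) {x : E} (hx : ∀ u ∈ U, b u ≤ u x) {c : ℝ}
    (hc : c < φ x) : ∀ᶠ x' in 𝓝[{x | ∀ u ∈ U, b u ≤ u x}] x, c < φ x' := by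
  have hC0 : 0 ≤ C := (abs_nonneg _).trans (hC x hx)
  -- If x' = (1 - s) x + s z with z in the polytope, concavity and the bound C give φ(x') ≥ φ(x) - 2
  -- s C; s is chosen to make this exceed c.
  obtain ⟨s, hs0, hs1, hs⟩ : ∃ s : ℝ, 0 < s ∧ s ≤ 1 ∧ 2 * s * C < φ x - c := by
    have hpos : 0 < φ x - c := sub_pos.2 hc
    refine ⟨min 1 ((φ x - c) / (2 * C + 1)), by positivity, min_le_left _ _, ?_⟩
    have h1 : min 1 ((φ x - c) / (2 * C + 1)) * (2 * C + 1) ≤ φ x - c := by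
      rw [← le_div_iff₀ (by positivity)]
      exact min_le_right _ _
    have h2 : 0 < min 1 ((φ x - c) / (2 * C + 1)) := by positivity
    linarith
  -- The point z is x' dilated from x by the factor 1/s. Constraints active at x survive any
  -- dilation from x; the finitely many others hold near x by continuity.
  have hz : ∀ᶠ x' in 𝓝[{x | ∀ u ∈ U, b u ≤ u x}] x, ∀ u ∈ U, b u ≤ u (x + s⁻¹ • (x' - x)) := by
    rw [eventually_all_finset]
    intro u hu
    rcases (hx u hu).eq_or_lt with h | h
    · filter_upwards [self_mem_nhdsWithin] with x' hx'
      have h1 : b u ≤ u x' := hx' u hu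
      have h2 : 0 ≤ s⁻¹ * (u x' - u x) := mul_nonneg (inv_nonneg.2 hs0.le) (by linarith)
      simp only [map_add, map_smul, map_sub, smul_eq_mul]
      linarith
    · have h1 : Continuous fun x' => u (x + s⁻¹ • (x' - x)) := by fun_prop
      have h2 := h1.tendsto x
      simp only [sub_self, smul_zero, add_zero] at h2
      exact ((h2.eventually_const_lt h).filter_mono nhdsWithin_le_nhds).mono fun _ h => h.le
  filter_upwards [hz] with x' hx'
  have h1 := hφ.2 hx hx' (sub_nonneg.2 hs1) hs0.le (sub_add_cancel 1 s)
  have h2 : (1 - s) • x + s • (x + s⁻¹ • (x' - x)) = x' := by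
    rw [smul_add, smul_smul, mul_inv_cancel₀ hs0.ne', one_smul, sub_smul, one_smul]
    abel
  rw [h2, smul_eq_mul, smul_eq_mul] at h1
  have h3 := (abs_le.1 (hC _ hx')).1
  have h4 := (abs_le.1 (hC x hx)).2
  nlinarith

/-- Upper semicontinuity comes from compactness, lower semicontinuity from concavity and boundedness
on a polytope. -/
lemma continuousOn_wfun [FiniteDimensional ℝ E] (hQ : ∀ i, IsHPoly (id : E → E) ⊤ (Q i))
    (hne : ∀ i, (Q i).Nonempty) (hg : ∀ i, ContinuousOn (g i) (Q i))
    (hc : ∀ i, ConcaveOn ℝ (Q i) (g i)) {l : ι → ℝ} (hl : ∀ i, 0 ≤ l i) :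
    ContinuousOn (wfun Q g l) (wsum Q l) := by
  have hQc := fun i => (hQ i).isCompact
  obtain ⟨U, -, hU⟩ := exists_isNormalSystem_wsum hQ hne
  obtain ⟨C, -, hC⟩ := exists_abs_le hQc hg
  intro x hx
  refine tendsto_order.2 ⟨fun c hcx => ?_, fun c hcx => eventually_wfun_lt hQc hg hcx⟩
  have h1 := concaveOn_wfun hQc hg hc hl
  have h2 := fun x hx => abs_wfun_le hQc hg hC hl (x := x) hx
  rw [hU l hl] at h1 h2 hx ⊢
  exact eventually_lt_of_concaveOn h1 h2 hx hcx

/-- The part of the hypograph of `φ : D → ℝ` above `0`. -/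
def subgraph (D : Set E) (φ : E → ℝ) : Set (E × ℝ) :=
  {z | z.1 ∈ D ∧ 0 ≤ z.2 ∧ z.2 ≤ φ z.1}

/-- The subgraph is the image of D × [0, 1] under (x, c) ↦ (x, c φ(x)). -/
lemma isCompact_subgraph {D : Set E} {φ : E → ℝ} (hD : IsCompact D) (hφ : ContinuousOn φ D)
    (h0 : ∀ x ∈ D, 0 ≤ φ x) : IsCompact (subgraph D φ) := by
  have h1 : subgraph D φ = (fun z : E × ℝ => (z.1, z.2 * φ z.1)) '' (D ×ˢ Set.Icc 0 1) := by
    ext ⟨x, t⟩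
    simp only [subgraph, Set.mem_ofPred_eq, Set.mem_image, Set.mem_prod, Set.mem_Icc, Prod.exists,
      Prod.mk.injEq]
    constructor
    · rintro ⟨hx, ht0, ht⟩
      rcases (h0 x hx).eq_or_lt with h | h
      · exact ⟨x, 0, ⟨hx, le_rfl, zero_le_one⟩, rfl, by linarith⟩
      · exact ⟨x, t / φ x, ⟨hx, by positivity, (div_le_one h).2 ht⟩, rfl, div_mul_cancel₀ _ h.ne'⟩
    · rintro ⟨x', c, ⟨hx, hc0, hc1⟩, rfl, rfl⟩
      exact ⟨hx, mul_nonneg hc0 (h0 _ hx), by nlinarith [h0 _ hx]⟩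
  rw [h1]
  refine (hD.prod isCompact_Icc).image_of_continuousOn ?_
  exact continuousOn_fst.prodMk (continuousOn_snd.mul (hφ.comp continuousOn_fst fun z hz => hz.1))

lemma convex_subgraph {D : Set E} {φ : E → ℝ} (hφ : ConcaveOn ℝ D φ) :
    Convex ℝ (subgraph D φ) := by
  rintro ⟨x, s⟩ ⟨hx, hs0, hs⟩ ⟨y, t⟩ ⟨hy, ht0, ht⟩ a b ha hb hab
  refine ⟨hφ.1 hx hy ha hb hab, add_nonneg (mul_nonneg ha hs0) (mul_nonneg hb ht0),
    le_trans ?_ (hφ.2 hx hy ha hb hab)⟩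
  exact add_le_add (mul_le_mul_of_nonneg_left hs ha) (mul_le_mul_of_nonneg_left ht hb)

/-- This turns integrals of sup-convolutions into volumes of Minkowski sums. A point below the graph
is reached by taking an optimal decomposition and lowering all heights by one common factor. -/
lemma wsum_subgraph (hQ : ∀ i, IsCompact (Q i)) (hg : ∀ i, ContinuousOn (g i) (Q i))
    (h0 : ∀ i, ∀ x ∈ Q i, 0 ≤ g i x) {l : ι → ℝ} (hl : ∀ i, 0 ≤ l i) :
    wsum (fun i => subgraph (Q i) (g i)) l = subgraph (wsum Q l) (wfun Q g l) := by
  ext ⟨x, t⟩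
  constructor
  · rintro ⟨z, hz, h⟩
    have h1 : ∑ i, l i • (z i).1 = x := by
      have := congrArg Prod.fst h
      simpa [Prod.fst_sum] using this
    have h2 : ∑ i, l i * (z i).2 = t := by
      have := congrArg Prod.snd h
      simpa [Prod.snd_sum] using this
    refine ⟨⟨_, fun i => (hz i).1, h1⟩, ?_, ?_⟩
    · rw [← h2]
      exact Finset.sum_nonneg fun i _ => mul_nonneg (hl i) (hz i).2.1
    · dsimp only
      rw [← h2, ← h1]
      refine le_trans (Finset.sum_le_sum fun i _ => ?_) (le_wfun hQ hg fun i => (hz i).1)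
      exact mul_le_mul_of_nonneg_left (hz i).2.2 (hl i)
  · rintro ⟨hx, ht0, ht⟩
    dsimp only at hx ht0 ht
    obtain ⟨y, hy, rfl, h⟩ := exists_wfun_eq hQ hg hx
    rw [h] at ht
    set G := ∑ i, l i * g i (y i) with hG
    have hGnn : 0 ≤ G := Finset.sum_nonneg fun i _ => mul_nonneg (hl i) (h0 i _ (hy i))
    -- If G = 0 then t = 0 as well, and the convention t / 0 = 0 gives the right heights.
    have hcG : t / G * G = t := by
      rcases hGnn.eq_or_lt with h1 | h1
      · rw [← h1] at ht ⊢
        simp [le_antisymm ht ht0]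
      · exact div_mul_cancel₀ _ h1.ne'
    have hc0 : 0 ≤ t / G := div_nonneg ht0 hGnn
    have hc1 : t / G ≤ 1 := div_le_one_of_le₀ ht hGnn
    refine ⟨fun i => (y i, t / G * g i (y i)), fun i => ⟨hy i, mul_nonneg hc0 (h0 i _ (hy i)), ?_⟩,
      ?_⟩
    · have := h0 i _ (hy i)
      dsimp only
      nlinarith
    · refine Prod.ext ?_ ?_
      · simp [Prod.fst_sum]
      · rw [Prod.snd_sum]
        simp only [Prod.smul_snd, smul_eq_mul]
        have h2 : ∑ i, t / G * (l i * g i (y i)) = t := by rw [← Finset.mul_sum, ← hG, hcG]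
        rw [← h2]
        refine Finset.sum_congr rfl fun i _ => ?_
        rw [h2]
        ring

lemma wfun_add_const (hQ : ∀ i, IsCompact (Q i)) (hg : ∀ i, ContinuousOn (g i) (Q i)) (C : ℝ)
    {l : ι → ℝ} {x : E} (hx : x ∈ wsum Q l) :
    wfun Q (fun i x => g i x + C) l x = wfun Q g l x + (∑ i, l i) * C := by
  have hg' : ∀ i, ContinuousOn (fun x => g i x + C) (Q i) := fun i => (hg i).add continuousOn_const
  have hs : ∀ y : ι → E, ∑ i, l i * (g i (y i) + C) = ∑ i, l i * g i (y i) + (∑ i, l i) * C := by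
    intro y
    rw [Finset.sum_mul, ← Finset.sum_add_distrib]
    exact Finset.sum_congr rfl fun i _ => mul_add _ _ _
  refine le_antisymm ?_ ?_
  · obtain ⟨y, hy, rfl, h⟩ := exists_wfun_eq hQ hg' hx
    rw [h, hs]
    gcongr
    exact le_wfun hQ hg hy
  · obtain ⟨y, hy, rfl, h⟩ := exists_wfun_eq hQ hg hx
    rw [h, ← hs]
    exact le_wfun hQ hg' hy

end SupConvolution

/-! ### Vanishing differences for integrals of sup-convolutions -/

section DegreeFunctions

variable {E : Type*} [NormedAddCommGroup E] [NormedSpace ℝ E] [FiniteDimensional ℝ E]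
  [MeasurableSpace E] [BorelSpace E] {ι κ : Type*} [Fintype ι] {Q : ι → Set E} {g : ι → E → ℝ}

lemma measureReal_subgraph (μ : Measure E) [μ.IsAddHaarMeasure] {D : Set E} {φ : E → ℝ}
    (hD : IsCompact D) (hφ : ContinuousOn φ D) (h0 : ∀ x ∈ D, 0 ≤ φ x) :
    (μ.prod volume).real (subgraph D φ) = ∫ x in D, φ x ∂μ := by
  have hm := (isCompact_subgraph hD hφ h0).isClosed.measurableSet
  have hDm := hD.isClosed.measurableSet
  rw [integral_eq_lintegral_of_nonneg_ae ((ae_restrict_iff' hDm).2 (ae_of_all _ h0))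
    (hφ.aestronglyMeasurable hDm), Measure.real, Measure.prod_apply hm,
    ← lintegral_indicator hDm]
  congr 1
  refine lintegral_congr fun x => ?_
  by_cases hx : x ∈ D
  · rw [Set.indicator_of_mem hx]
    have : Prod.mk x ⁻¹' subgraph D φ = Set.Icc 0 (φ x) := by
      ext t; simp [subgraph, hx]
    rw [this, Real.volume_Icc, sub_zero]
  · rw [Set.indicator_of_notMem hx]
    have : Prod.mk x ⁻¹' subgraph D φ = ∅ := by
      ext t; simp [subgraph, hx]
    rw [this, measure_empty]

/-- The integral of a weighted sup-convolution is a polynomial of degree at most `dim E + 1` in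
the weights. -/
theorem sum_integral_wfun (μ : Measure E) [μ.IsAddHaarMeasure]
    (hQ : ∀ i, IsHPoly (id : E → E) ⊤ (Q i)) (hne : ∀ i, (Q i).Nonempty)
    (hg : ∀ i, ContinuousOn (g i) (Q i)) (hc : ∀ i, ConcaveOn ℝ (Q i) (g i)) (s : Finset κ)
    {d : κ → ι → ℝ} (hd : ∀ j i, 0 ≤ d j i) {l : ι → ℝ} (hl : ∀ i, 0 ≤ l i)
    (hs : Module.finrank ℝ E + 1 < s.card) :
    ∑ I ∈ s.powerset, (-1 : ℝ) ^ I.card *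
      ∫ x in wsum Q (l + ∑ j ∈ I, d j), wfun Q g (l + ∑ j ∈ I, d j) x ∂μ = 0 := by
  have hQc := fun i => (hQ i).isCompact
  obtain ⟨C, hC0, hC⟩ := exists_abs_le hQc hg
  have hl' : ∀ I : Finset κ, ∀ i, 0 ≤ (l + ∑ j ∈ I, d j) i := fun I i => by
    rw [Pi.add_apply, Finset.sum_apply]
    exact add_nonneg (hl i) (Finset.sum_nonneg fun j _ => hd j i)
  set F : Finset κ → ℝ := fun I =>
    ∫ x in wsum Q (l + ∑ j ∈ I, d j), wfun Q g (l + ∑ j ∈ I, d j) x ∂μ with hF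
  set V : Finset κ → ℝ := fun I =>
    (∑ i, (l + ∑ j ∈ I, d j) i) * μ.real (wsum Q (l + ∑ j ∈ I, d j)) with hV
  -- Adding k makes all functions nonnegative, and the integrals become volumes of sums of subgraphs
  -- in dimension dim E + 1. The shift adds k times V, which two values of k separate from F.
  have key : ∀ k : ℝ, C ≤ k → ∑ I ∈ s.powerset, (-1 : ℝ) ^ I.card * (F I + k * V I) = 0 := by
    intro k hk
    have hg' : ∀ i, ContinuousOn (fun x => g i x + k) (Q i) := fun i =>
      (hg i).add continuousOn_const
    have hc' : ∀ i, ConcaveOn ℝ (Q i) (fun x => g i x + k) := fun i =>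
      (hc i).add (concaveOn_const k (hc i).1)
    have h0 : ∀ i, ∀ x ∈ Q i, 0 ≤ g i x + k := fun i x hx => by
      linarith [(abs_le.1 (hC i x hx)).1]
    have h1 := sum_measureReal_wsum (μ.prod volume)
      (K := fun i => subgraph (Q i) (fun x => g i x + k))
      (fun i => isCompact_subgraph (hQc i) (hg' i) (h0 i)) (fun i => convex_subgraph (hc' i))
      (fun i => let ⟨x, hx⟩ := hne i; ⟨(x, 0), hx, le_rfl, h0 i x hx⟩) s hd hl (by simpa using hs)
    rw [← h1]
    refine Finset.sum_congr rfl fun I _ => ?_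
    congr 1
    have hW := isCompact_wsum hQc (l + ∑ j ∈ I, d j)
    rw [wsum_subgraph hQc hg' h0 (hl' I), measureReal_subgraph μ hW
      (continuousOn_wfun hQ hne hg' hc' (hl' I)), setIntegral_congr_fun hW.isClosed.measurableSet
      (fun x hx => wfun_add_const hQc hg k hx), integral_add
      ((continuousOn_wfun hQ hne hg hc (hl' I)).integrableOn_compact hW)
      (integrableOn_const hW.measure_lt_top.ne), setIntegral_const, smul_eq_mul]
    · simp only [hF, hV]
      ring
    · intro x hx
      obtain ⟨y, hy, rfl, h⟩ := exists_wfun_eq hQc hg' hx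
      rw [h]
      exact Finset.sum_nonneg fun i _ => mul_nonneg (hl' I i) (h0 i _ (hy i))
  have h1 := key C le_rfl
  have h2 := key (C + 1) (by linarith)
  simp only [mul_add, Finset.sum_add_distrib, mul_left_comm _ C, mul_left_comm _ (C + 1),
    ← Finset.mul_sum] at h1 h2
  have h3 : ∑ I ∈ s.powerset, (-1 : ℝ) ^ I.card * V I = 0 := by
    simp only [add_mul, one_mul] at h2
    linarith
  rw [h3] at h1
  linarith

end DegreeFunctions

/-! ### Gradients of concave functions -/

section Gradient

open Filter Topology

variable {E : Type*} [NormedAddCommGroup E] [NormedSpace ℝ E]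

lemma legendre_le {Q : Set E} {g : E → ℝ} (hQ : IsCompact Q) (hg : ContinuousOn g Q)
    (v : StrongDual ℝ E) {x : E} (hx : x ∈ Q) : legendre Q g v ≤ v x - g x :=
  csInf_le ((hQ.image_of_continuousOn (v.continuous.continuousOn.sub hg)).bddBelow) ⟨x, hx, rfl⟩

lemma le_legendre {Q : Set E} {g : E → ℝ} (hne : Q.Nonempty) {v : StrongDual ℝ E} {a : ℝ}
    (h : ∀ x ∈ Q, a ≤ v x - g x) : a ≤ legendre Q g v :=
  le_csInf (hne.image _) (by rintro _ ⟨x, hx, rfl⟩; exact h x hx)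

lemma exists_legendre_eq {Q : Set E} {g : E → ℝ} (hQ : IsCompact Q) (hne : Q.Nonempty)
    (hg : ContinuousOn g Q) (v : StrongDual ℝ E) : ∃ x ∈ Q, v x - g x = legendre Q g v :=
  (hQ.image_of_continuousOn (v.continuous.continuousOn.sub hg)).sInf_mem (hne.image _)

/-- The derivative of a concave function is a supergradient. -/
lemma le_add_fderiv {Q : Set E} {g : E → ℝ} (hg : ConcaveOn ℝ Q g) {x y : E}
    (hx : x ∈ Q) (hd : DifferentiableAt ℝ g x) (hy : y ∈ Q) :
    g y ≤ g x + fderiv ℝ g x (y - x) := by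
  have h1 := hd.hasFDerivAt.hasLineDerivAt (y - x) |>.tendsto_slope_zero_right
  have h2 : g y - g x ≤ fderiv ℝ g x (y - x) := by
    refine ge_of_tendsto h1 ?_
    filter_upwards [Ioc_mem_nhdsGT (zero_lt_one' ℝ)] with t ht
    have h3 := hg.2 hx hy (sub_nonneg.2 ht.2) ht.1.le (sub_add_cancel 1 t)
    have h4 : (1 - t) • x + t • y = x + t • (y - x) := by rw [sub_smul, smul_sub, one_smul]; abel
    rw [h4, smul_eq_mul, smul_eq_mul] at h3
    rw [smul_eq_mul, inv_mul_eq_div, le_div_iff₀ ht.1]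
    linarith
  linarith

lemma legendre_fderiv {Q : Set E} {g : E → ℝ} (hQ : IsCompact Q) (hg : ConcaveOn ℝ Q g)
    (hgc : ContinuousOn g Q) {x : E} (hx : x ∈ Q) (hd : DifferentiableAt ℝ g x) :
    legendre Q g (fderiv ℝ g x) = fderiv ℝ g x x - g x := by
  refine le_antisymm (legendre_le hQ hgc _ hx) (le_legendre ⟨x, hx⟩ fun y hy => ?_)
  have := le_add_fderiv hg hx hd hy
  rw [map_sub] at this
  linarith

/-- A supergradient at a point of differentiability is the derivative. -/
lemma eq_fderiv_of_legendre_eq {Q : Set E} {g : E → ℝ} (hQ : IsCompact Q)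
    (hgc : ContinuousOn g Q) {x : E} (hx : x ∈ interior Q) (hd : DifferentiableAt ℝ g x)
    {v : StrongDual ℝ E} (h : v x - g x ≤ legendre Q g v) : v = fderiv ℝ g x := by
  have hmin : IsLocalMin (fun y => v y - g y) x := by
    filter_upwards [mem_interior_iff_mem_nhds.1 hx] with y hy
    exact h.trans (legendre_le hQ hgc v hy)
  exact sub_eq_zero.1 (hmin.hasFDerivAt_eq_zero (v.hasFDerivAt.sub hd.hasFDerivAt))

/-- If w strictly separates x from Q, the dual grows from v to v + w by more than w(x), which
contradicts the supergradient inequality. -/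
lemma mem_of_mem_supDiff_legendre {Q : Set E} {g : E → ℝ} (hQ : IsCompact Q) (hne : Q.Nonempty)
    (hg : ConcaveOn ℝ Q g) (hgc : ContinuousOn g Q) {x : E} {v : StrongDual ℝ E}
    (hx : x ∈ supDiff (legendre Q g) v) : x ∈ Q := by
  by_contra hxQ
  obtain ⟨w, c, h1, h2⟩ := geometric_hahn_banach_point_closed hg.1 hQ.isClosed hxQ
  have h3 : legendre Q g v + c ≤ legendre Q g (v + w) := le_legendre hne fun y hy => by
    have := legendre_le hQ hgc v hy
    have := h2 y hy
    simp only [add_apply]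
    linarith
  have h4 := hx (v + w)
  simp only [add_sub_cancel_left] at h4
  linarith

/-- By duality, x is a supergradient of the dual at v exactly when v is a supergradient of g at x;
at a point of differentiability the latter is unique. -/
lemma mem_supDiff_legendre_iff {Q : Set E} {g : E → ℝ} (hQ : IsCompact Q)
    (hg : ConcaveOn ℝ Q g) (hgc : ContinuousOn g Q) {x : E} (hx : x ∈ interior Q)
    (hd : DifferentiableAt ℝ g x) (v : StrongDual ℝ E) :
    x ∈ supDiff (legendre Q g) v ↔ v = fderiv ℝ g x := by
  have hxQ := interior_subset hx
  have h0 := legendre_fderiv hQ hg hgc hxQ hd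
  constructor
  · intro h
    refine eq_fderiv_of_legendre_eq hQ hgc hx hd ?_
    have := h (fderiv ℝ g x)
    rw [h0, sub_apply] at this
    linarith
  · rintro rfl w
    have := legendre_le hQ hgc w hxQ
    rw [h0, sub_apply]
    linarith

variable [FiniteDimensional ℝ E] [MeasurableSpace E] [BorelSpace E]

/-- The frontier of a convex set is null, and Rademacher's theorem applies locally because a concave
function is locally Lipschitz in the interior. -/
lemma ae_mem_interior_and_differentiableAt (μ : Measure E) [μ.IsAddHaarMeasure] {Q : Set E}
    {g : E → ℝ} (hg : ConcaveOn ℝ Q g) :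
    ∀ᵐ x ∂μ, x ∈ Q → x ∈ interior Q ∧ DifferentiableAt ℝ g x := by
  have h1 : ∀ᵐ x ∂μ, x ∉ frontier Q := measure_eq_zero_iff_ae_notMem.1 (hg.1.addHaar_frontier μ)
  have h2 : ∀ᵐ x ∂μ, x ∉ {x | x ∈ interior Q ∧ ¬ DifferentiableAt ℝ g x} := by
    refine measure_eq_zero_iff_ae_notMem.1 (measure_null_of_locally_null _ fun x hx => ?_)
    obtain ⟨C, t, ht, hC⟩ := hg.locallyLipschitzOn_interior hx.1
    rw [isOpen_interior.nhdsWithin_eq hx.1] at ht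
    obtain ⟨o, hot, ho, hxo⟩ := mem_nhds_iff.1 ht
    refine ⟨{x | x ∈ interior Q ∧ ¬ DifferentiableAt ℝ g x} ∩ o,
      inter_mem_nhdsWithin _ (ho.mem_nhds hxo), ?_⟩
    have h3 := (hC.mono hot).ae_differentiableWithinAt_of_mem (μ := μ)
    refine measure_mono_null ?_ h3
    rintro y ⟨hy, hyo⟩ hcon
    exact hy.2 ((hcon hyo).differentiableAt (ho.mem_nhds hyo))
  filter_upwards [h1, h2] with x hx1 hx2 hxQ
  have hxi : x ∈ interior Q := by
    by_contra hcon
    exact hx1 ⟨subset_closure hxQ, hcon⟩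
  refine ⟨hxi, ?_⟩
  by_contra hcon
  exact hx2 ⟨hxi, hcon⟩

/-- The real Monge-Ampère measure of a Legendre-Fenchel dual is the image of the Haar measure
under the gradient. -/
theorem mongeAmpere_legendre (μ : Measure E) [μ.IsAddHaarMeasure] {Q : Set E}
    {g : E → ℝ} (hQ : IsCompact Q) (hne : Q.Nonempty) (hg : ConcaveOn ℝ Q g)
    (hgc : ContinuousOn g Q) :
    mongeAmpere μ (legendre Q g) = (μ.restrict Q).map (fderiv ℝ g) := by
  obtain ⟨C, hC⟩ := exists_lipschitzWith_legendre hQ hne hgc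
  ext A hA
  rw [mongeAmpere_apply μ hC.continuous hA, Measure.map_apply (measurable_fderiv ℝ g) hA,
    Measure.restrict_apply (measurable_fderiv ℝ g hA)]
  refine measure_congr (eventuallyEq_set.2 ?_)
  filter_upwards [ae_mem_interior_and_differentiableAt μ hg] with x hx
  simp only [Set.mem_iUnion, exists_prop, Set.mem_inter_iff, Set.mem_preimage]
  constructor
  · rintro ⟨v, hvA, hxv⟩
    have hxQ := mem_of_mem_supDiff_legendre hQ hne hg hgc hxv
    obtain ⟨hxi, hd⟩ := hx hxQ
    rw [mem_supDiff_legendre_iff hQ hg hgc hxi hd] at hxv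
    exact ⟨hxv ▸ hvA, hxQ⟩
  · rintro ⟨hA, hxQ⟩
    obtain ⟨hxi, hd⟩ := hx hxQ
    exact ⟨_, hA, (mem_supDiff_legendre_iff hQ hg hgc hxi hd _).2 rfl⟩

lemma one_add_pow_le (n : ℕ) {η : ℝ} (h0 : 0 ≤ η) (h1 : η ≤ 1) :
    (1 + η) ^ n ≤ 1 + (2 ^ n - 1) * η := by
  induction n with
  | zero => simp
  | succ n ih =>
    have h2 : (1 : ℝ) ≤ 2 ^ n := one_le_pow₀ one_le_two
    calc (1 + η) ^ (n + 1) = (1 + η) ^ n * (1 + η) := pow_succ _ _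
      _ ≤ (1 + (2 ^ n - 1) * η) * (1 + η) := by gcongr
      _ = 1 + 2 ^ n * η + (2 ^ n - 1) * (η * η) := by ring
      _ ≤ 1 + 2 ^ n * η + (2 ^ n - 1) * η := by
        have : η * η ≤ η := by nlinarith
        have := mul_le_mul_of_nonneg_left this (sub_nonneg.2 h2)
        linarith
      _ = _ := by ring

/-- Integrals over a convex set of radial difference quotients are bounded. -/
lemma integral_radial_le (μ : Measure E) [μ.IsAddHaarMeasure] {Q : Set E} {f : E → ℝ}
    (hQ : IsCompact Q) (hQc : Convex ℝ Q) (hf : ContinuousOn f Q) (h0 : ∀ x ∈ Q, 0 ≤ f x) {o : E}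
    (ho : o ∈ Q) {η : ℝ} (hη0 : 0 ≤ η) (hη1 : η ≤ 1) :
    ∫ x in Q, f ((1 + η)⁻¹ • x + (1 - (1 + η)⁻¹) • o) ∂μ ≤
      (1 + (2 ^ Module.finrank ℝ E - 1) * η) * ∫ x in Q, f x ∂μ := by
  have hQm := hQ.isClosed.measurableSet
  set r := (1 + η)⁻¹ with hr
  have hr0 : 0 < r := by positivity
  have hr1 : r ≤ 1 := inv_le_one_of_one_le₀ (by linarith)
  have hmem : ∀ x ∈ Q, r • x + (1 - r) • o ∈ Q := fun x hx =>
    hQc hx ho hr0.le (sub_nonneg.2 hr1) (by ring)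
  set F := Q.indicator f with hF
  have hFi : Integrable F μ := (integrable_indicator_iff hQm).2 (hf.integrableOn_compact hQ)
  have hF0 : ∀ x, 0 ≤ F x := fun x => Set.indicator_nonneg (fun x hx => h0 x hx) x
  have hFi2 : Integrable (fun x => F (r • x + (1 - r) • o)) μ :=
    (hFi.comp_add_right ((1 - r) • o)).comp_smul hr0.ne'
  calc ∫ x in Q, f (r • x + (1 - r) • o) ∂μ
      = ∫ x in Q, F (r • x + (1 - r) • o) ∂μ :=
        setIntegral_congr_fun hQm fun x hx => (Set.indicator_of_mem (hmem x hx) f).symm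
    _ ≤ ∫ x, F (r • x + (1 - r) • o) ∂μ :=
        setIntegral_le_integral hFi2 (ae_of_all _ fun x => hF0 _)
    -- The contraction towards o has Jacobian r^(dim E), and maps Q into itself, so only this factor
    -- is lost.
    _ = |(r ^ Module.finrank ℝ E)⁻¹| • ∫ x, F (x + (1 - r) • o) ∂μ :=
        Measure.integral_comp_smul μ (fun x => F (x + (1 - r) • o)) r
    _ = (1 + η) ^ Module.finrank ℝ E * ∫ x in Q, f x ∂μ := by
        rw [integral_add_right_eq_self, integral_indicator hQm, abs_of_pos (by positivity),
          smul_eq_mul, hr, inv_pow, inv_inv]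
    _ ≤ _ := by
        gcongr
        · exact setIntegral_nonneg hQm h0
        · exact one_add_pow_le _ hη0 hη1

/-- The gradient of a concave function on a convex body is integrable. -/
theorem integrableOn_fderiv (μ : Measure E) [μ.IsAddHaarMeasure] {Q : Set E}
    {g : E → ℝ} (hQ : IsCompact Q) (hg : ConcaveOn ℝ Q g) (hgc : ContinuousOn g Q) :
    IntegrableOn (fderiv ℝ g) Q μ := by
  have hae := ae_mem_interior_and_differentiableAt μ hg
  have hQm := hQ.isClosed.measurableSet
  rcases (interior Q).eq_empty_or_nonempty with hemp | ⟨o, ho⟩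
  · have : μ Q = 0 := measure_eq_zero_iff_ae_notMem.2 (hae.mono fun x hx hxQ => by
      have := (hx hxQ).1
      rw [hemp] at this
      exact this)
    rw [IntegrableOn, Measure.restrict_eq_zero.2 this]
    exact integrable_zero_measure
  have hoQ := interior_subset ho
  obtain ⟨r, hr0, hr⟩ := Metric.nhds_basis_closedBall.mem_iff.1 (mem_interior_iff_mem_nhds.1 ho)
  obtain ⟨G, hG⟩ := hQ.exists_bound_of_continuousOn hgc
  have hG' : ∀ x ∈ Q, |g x| ≤ G := hG
  have hG0 : 0 ≤ G := (abs_nonneg _).trans (hG' o hoQ)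
  -- the radial derivative, made nonnegative
  set ψ : E → ℝ := fun x => fderiv ℝ g x (o - x) + 2 * G with hψ
  have hψm : Measurable ψ := by
    have h1 : Measurable fun x => (fderiv ℝ g x, o - x) :=
      (measurable_fderiv ℝ g).prodMk (measurable_const.sub measurable_id)
    have h2 : Continuous fun p : StrongDual ℝ E × E => p.1 p.2 := by fun_prop
    exact (h2.measurable.comp h1).add_const _
  let η : ℕ → ℝ := fun k => 1 / ((k : ℝ) + 1)
  have hη0 : ∀ k, 0 < η k := fun k => by positivity
  have hη1 : ∀ k, η k ≤ 1 := fun k => by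
    rw [div_le_one (by positivity)]; linarith [Nat.cast_nonneg (α := ℝ) k]
  -- The contraction towards o by the factor 1/(1 + η) moves x by e times o - x. The radial
  -- difference quotients with step e are therefore accessible to `integral_radial_le`.
  let e : ℕ → ℝ := fun k => 1 - (1 + η k)⁻¹
  have he : ∀ k, e k = η k / (1 + η k) := fun k => by
    have := hη0 k
    simp only [e]; field_simp; ring
  have he0 : ∀ k, 0 < e k := fun k => by rw [he]; have := hη0 k; positivity
  have he1 : ∀ k, e k ≤ 1 := fun k => by
    simp only [e]; have := hη0 k; linarith [inv_pos.2 (show 0 < 1 + η k by linarith)]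
  let T : ℕ → E → E := fun k x => (1 + η k)⁻¹ • x + (1 - (1 + η k)⁻¹) • o
  have hTe : ∀ k x, T k x = x + e k • (o - x) := fun k x => by
    simp only [T, e, sub_smul, smul_sub, one_smul]; abel
  have hTQ : ∀ k, ∀ x ∈ Q, T k x ∈ Q := fun k x hx =>
    hg.1 hx hoQ (by have := hη0 k; positivity) (he0 k).le (by ring)
  let h : ℕ → E → ℝ := fun k x => (e k)⁻¹ * (g (T k x) - g x) + 2 * G
  have hnn : ∀ k, ∀ x ∈ Q, 0 ≤ h k x := by
    intro k x hx
    have h1 := hg.2 hx hoQ (sub_nonneg.2 (he1 k)) (he0 k).le (sub_add_cancel 1 (e k))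
    have h2 : (1 - e k) • x + e k • o = T k x := by
      rw [hTe, sub_smul, smul_sub, one_smul]; abel
    rw [h2, smul_eq_mul, smul_eq_mul] at h1
    have h3 : g o - g x ≤ (e k)⁻¹ * (g (T k x) - g x) := by
      rw [inv_mul_eq_div, le_div_iff₀ (he0 k)]
      linarith
    have := abs_le.1 (hG' x hx)
    have := abs_le.1 (hG' o hoQ)
    simp only [h]
    linarith
  have hcont : ∀ k, ContinuousOn (h k) Q := fun k =>
    (continuousOn_const.mul ((hgc.comp (by fun_prop) (hTQ k)).sub hgc)).add continuousOn_const
  -- The leading 2 bounds η / e = 1 + η; the second factor is the first-order cost of the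
  -- contraction.
  set M := 2 * (2 ^ Module.finrank ℝ E - 1) * ∫ x in Q, (g x + G) ∂μ + 2 * G * μ.real Q with hM
  have hbound : ∀ k, ∫ x in Q, h k x ∂μ ≤ M := by
    intro k
    have hi1 : IntegrableOn (fun x => g x + G) Q μ :=
      (hgc.add continuousOn_const).integrableOn_compact hQ
    have hi2 : IntegrableOn (fun x => g (T k x) + G) Q μ :=
      ((hgc.comp (by fun_prop) (hTQ k)).add continuousOn_const).integrableOn_compact hQ
    have h1 := integral_radial_le μ hQ hg.1 (f := fun x => g x + G) (hgc.add continuousOn_const)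
      (fun x hx => by linarith [(abs_le.1 (hG' x hx)).1]) hoQ (hη0 k).le (hη1 k)
    have h2 : ∀ x, h k x = (e k)⁻¹ * ((g (T k x) + G) - (g x + G)) + 2 * G := fun x => by
      simp only [h]; ring
    simp only [h2]
    have hi3 : IntegrableOn (fun x => (e k)⁻¹ * ((g (T k x) + G) - (g x + G))) Q μ :=
      (hi2.sub hi1).const_mul _
    rw [integral_add hi3 (integrableOn_const hQ.measure_lt_top.ne),
      integral_const_mul, integral_sub hi2 hi1, setIntegral_const, smul_eq_mul, hM,
      mul_comm (μ.real Q)]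
    have hI0 : 0 ≤ ∫ x in Q, (g x + G) ∂μ :=
      setIntegral_nonneg hQm fun x hx => by linarith [(abs_le.1 (hG' x hx)).1]
    have h4 : (0 : ℝ) ≤ 2 ^ Module.finrank ℝ E - 1 := sub_nonneg.2 (one_le_pow₀ one_le_two)
    have h5 : (∫ x in Q, (g (T k x) + G) ∂μ) - ∫ x in Q, (g x + G) ∂μ ≤
        (2 ^ Module.finrank ℝ E - 1) * η k * ∫ x in Q, (g x + G) ∂μ := by
      have h6 : (∫ x in Q, (g (T k x) + G) ∂μ) ≤
        (1 + (2 ^ Module.finrank ℝ E - 1) * η k) * ∫ x in Q, (g x + G) ∂μ := h1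
      linarith
    have h7 : (e k)⁻¹ * ((∫ x in Q, (g (T k x) + G) ∂μ) - ∫ x in Q, (g x + G) ∂μ) ≤
        (e k)⁻¹ * ((2 ^ Module.finrank ℝ E - 1) * η k * ∫ x in Q, (g x + G) ∂μ) :=
      mul_le_mul_of_nonneg_left h5 (inv_nonneg.2 (he0 k).le)
    have h8 : (e k)⁻¹ * η k ≤ 2 := by
      rw [he, inv_div, div_mul_cancel₀ _ (hη0 k).ne']
      linarith [hη1 k]
    have h9 : (e k)⁻¹ * ((2 ^ Module.finrank ℝ E - 1) * η k * ∫ x in Q, (g x + G) ∂μ) ≤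
        2 * (2 ^ Module.finrank ℝ E - 1) * ∫ x in Q, (g x + G) ∂μ := by
      calc _ = ((e k)⁻¹ * η k) * ((2 ^ Module.finrank ℝ E - 1) * ∫ x in Q, (g x + G) ∂μ) := by ring
        _ ≤ 2 * ((2 ^ Module.finrank ℝ E - 1) * ∫ x in Q, (g x + G) ∂μ) := by gcongr
        _ = _ := by ring
    linarith
  have hlim : ∀ᵐ x ∂(μ.restrict Q), Tendsto (fun k => h k x) atTop (𝓝 (ψ x)) := by
    rw [ae_restrict_iff' hQm]
    filter_upwards [hae] with x hx hxQ
    have h1 := ((hx hxQ).2.hasFDerivAt.hasLineDerivAt (o - x)).tendsto_slope_zero_right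
    have he' : Tendsto e atTop (𝓝[>] 0) := by
      refine tendsto_nhdsWithin_iff.2 ⟨?_, Eventually.of_forall he0⟩
      have h2 : Tendsto η atTop (𝓝 0) := tendsto_one_div_add_atTop_nhds_zero_nat
      have h3 := ((tendsto_const_nhds (x := (1 : ℝ))).add h2).inv₀ (by norm_num)
      simpa using (tendsto_const_nhds (x := (1 : ℝ))).sub h3
    refine ((h1.comp he').add_const (2 * G)).congr fun k => ?_
    simp only [h, Function.comp_apply, smul_eq_mul, hTe]
  -- Fatou's lemma: the difference quotients are nonnegative, converge almost everywhere to ψ, and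
  -- have integrals bounded by M.
  have hψi : IntegrableOn ψ Q μ := by
    have hψ0 : ∀ᵐ x ∂(μ.restrict Q), 0 ≤ ψ x := by
      filter_upwards [hlim, (ae_restrict_mem hQm)] with x hx hxQ
      exact ge_of_tendsto' hx fun k => hnn k x hxQ
    refine ⟨hψm.aestronglyMeasurable, ?_⟩
    rw [hasFiniteIntegral_iff_ofReal hψ0]
    calc ∫⁻ x in Q, ENNReal.ofReal (ψ x) ∂μ
        = ∫⁻ x in Q, liminf (fun k => ENNReal.ofReal (h k x)) atTop ∂μ := by
          refine lintegral_congr_ae ?_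
          filter_upwards [hlim] with x hx
          exact ((ENNReal.continuous_ofReal.tendsto _).comp hx).liminf_eq.symm
      _ ≤ liminf (fun k => ∫⁻ x in Q, ENNReal.ofReal (h k x) ∂μ) atTop :=
          lintegral_liminf_le' fun k => ((hcont k).aemeasurable hQm).ennreal_ofReal
      _ ≤ liminf (fun _ : ℕ => ENNReal.ofReal M) atTop := by
          refine liminf_le_liminf (Eventually.of_forall fun k => ?_)
          rw [← ofReal_integral_eq_lintegral_ofReal ((hcont k).integrableOn_compact hQ)
            ((ae_restrict_iff' hQm).2 (ae_of_all _ (hnn k)))]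
          exact ENNReal.ofReal_le_ofReal (hbound k)
      _ = ENNReal.ofReal M := liminf_const _
      _ < ∞ := ENNReal.ofReal_lt_top
  refine Integrable.mono' (hψi.const_mul r⁻¹) (measurable_fderiv ℝ g).aestronglyMeasurable ?_
  rw [ae_restrict_iff' hQm]
  filter_upwards [hae] with x hx hxQ
  obtain ⟨hxi, hd⟩ := hx hxQ
  have hψx : 0 ≤ ψ x := by
    have h1 := le_add_fderiv hg hxQ hd hoQ
    have := abs_le.1 (hG' x hxQ)
    have := abs_le.1 (hG' o hoQ)
    simp only [hψ]
    linarith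
  -- The supergradient inequality at the point of the ball around o in the direction of a bounds
  -- every directional derivative by the radial one.
  have hdir : ∀ a : E, -fderiv ℝ g x a ≤ r⁻¹ * ψ x * ‖a‖ := by
    intro a
    rcases eq_or_ne a 0 with rfl | ha
    · simp
    have hna : 0 < ‖a‖ := norm_pos_iff.2 ha
    have hy : o + (r / ‖a‖) • a ∈ Q := hr (by
      rw [Metric.mem_closedBall, dist_eq_norm, add_sub_cancel_left, norm_smul,
        Real.norm_of_nonneg (by positivity), div_mul_cancel₀ _ hna.ne'])
    have h1 := le_add_fderiv hg hxQ hd hy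
    have h2 : o + (r / ‖a‖) • a - x = (o - x) + (r / ‖a‖) • a := by abel
    rw [h2, map_add, map_smul, smul_eq_mul] at h1
    have := abs_le.1 (hG' x hxQ)
    have := abs_le.1 (hG' _ hy)
    have h3 : r / ‖a‖ * (-fderiv ℝ g x a) ≤ ψ x := by
      simp only [hψ]
      linarith
    rw [div_mul_eq_mul_div, div_le_iff₀ hna] at h3
    rw [mul_assoc, inv_mul_eq_div, le_div_iff₀ hr0]
    linarith
  refine ContinuousLinearMap.opNorm_le_bound _ (by positivity) fun a => ?_
  rw [Real.norm_eq_abs, abs_le]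
  have h1 := hdir a
  have h2 := hdir (-a)
  rw [map_neg, norm_neg, neg_neg] at h2
  exact ⟨by linarith, h2⟩

lemma integrableOn_comp_fderiv (μ : Measure E) [μ.IsAddHaarMeasure] {Q : Set E}
    {g : E → ℝ} (hQ : IsCompact Q) (hg : ConcaveOn ℝ Q g) (hgc : ContinuousOn g Q) {C : ℝ≥0}
    {f : StrongDual ℝ E → ℝ} (hf : LipschitzWith C f) :
    IntegrableOn (fun x => f (fderiv ℝ g x)) Q μ := by
  have h1 : IntegrableOn (fun x => |f 0| + C * ‖fderiv ℝ g x‖) Q μ :=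
    (integrableOn_const hQ.measure_lt_top.ne).add
      ((integrableOn_fderiv μ hQ hg hgc).norm.const_mul _)
  refine h1.mono' (hf.continuous.measurable.comp (measurable_fderiv ℝ g)).aestronglyMeasurable
    (ae_of_all _ fun x => ?_)
  have h2 := hf.dist_le_mul (fderiv ℝ g x) 0
  rw [dist_zero_right, Real.dist_eq] at h2
  have := abs_sub_abs_le_abs_sub (f (fderiv ℝ g x)) (f 0)
  rw [Real.norm_eq_abs]
  linarith

end Gradient

/-! ### The first variation of the integral of a concave function -/

section FirstVariation

open Filter Topology

variable {E : Type*} [NormedAddCommGroup E] [NormedSpace ℝ E]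

/-- `G ε` is the sup-convolution of `g` and of the dilation by `ε` of `g₀`. -/
structure IsDilation (Q : Set E) (g : E → ℝ) (Q₀ : Set E) (g₀ : E → ℝ) (G : ℝ → E → ℝ) :
    Prop where
  le : ∀ ε, 0 ≤ ε → ∀ q ∈ Q, ∀ y ∈ Q₀, g q + ε * g₀ y ≤ G ε (q + ε • y)
  exists_eq : ∀ ε, 0 ≤ ε → ∀ x ∈ Q + ε • Q₀, ∃ q ∈ Q, ∃ y ∈ Q₀, q + ε • y = x ∧
    g q + ε * g₀ y = G ε x
  cont : ∀ ε, 0 ≤ ε → ContinuousOn (G ε) (Q + ε • Q₀)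

variable {Q Q₀ : Set E} {g g₀ : E → ℝ} {G : ℝ → E → ℝ}

lemma mem_add_smul_iff {ε : ℝ} {x : E} :
    x ∈ Q + ε • Q₀ ↔ ∃ q ∈ Q, ∃ y ∈ Q₀, q + ε • y = x := by
  simp only [Set.mem_add, Set.mem_smul_set]
  constructor
  · rintro ⟨q, hq, _, ⟨y, hy, rfl⟩, h⟩
    exact ⟨q, hq, y, hy, h⟩
  · rintro ⟨q, hq, y, hy, h⟩
    exact ⟨q, hq, _, ⟨y, hy, rfl⟩, h⟩

lemma isClosed_face {C : Set E} (hC : IsCompact C) (u : StrongDual ℝ E) : IsClosed (face C u) := by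
  have : face C u = C ∩ {x | u x ≤ supportFun C u} := by
    ext x
    rw [mem_face_iff hC.isBounded]
    exact ⟨fun h => ⟨h.1, h.2.le⟩,
      fun h => ⟨h.1, le_antisymm h.2 (supportFun_le hC.isBounded u h.1)⟩⟩
  rw [this]
  exact hC.isClosed.inter (isClosed_le u.continuous continuous_const)

lemma exists_continuous_extension {K : Set E} (hK : IsClosed K) {f : E → ℝ}
    (hf : ContinuousOn f K) : ∃ F : E → ℝ, Continuous F ∧ ∀ x ∈ K, F x = f x := by
  obtain ⟨F, hF⟩ := ContinuousMap.exists_restrict_eq (Y := ℝ) hK ⟨K.domRestrict f, hf.domRestrict⟩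
  exact ⟨F, F.continuous, fun x hx => congr($hF ⟨x, hx⟩)⟩

variable [FiniteDimensional ℝ E] [MeasurableSpace E] [BorelSpace E]

lemma faceIntegral_congr {u : StrongDual ℝ E} {ν : Measure u.ker} {C : Set E} (hC : IsClosed (face C u))
    {p : E} {f f' : E → ℝ} (h : ∀ x ∈ C, f x = f' x) :
    faceIntegral ν C p f = faceIntegral ν C p f' :=
  setIntegral_congr_fun (hC.measurableSet.preimage (by fun_prop : Continuous fun y : u.ker =>
    p + (y : E)).measurable) fun _ hy => h _ hy.1

/-- The supergradient inequality for g bounds the difference quotient by -g₀^∨(∇g(x)). A minimiser y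
in the definition of g₀^∨(∇g(x)), used with x - ε y in Q, gives the matching lower bound in the
limit. The choice y = 0 supplies a constant lower bound, so dominated convergence applies, by
integrability of the gradient. -/
lemma IsDilation.tendsto_slope_inside (μ : Measure E) [μ.IsAddHaarMeasure] (hQ : IsCompact Q)
    (hg : ConcaveOn ℝ Q g) (hgc : ContinuousOn g Q) (hQ₀ : IsCompact Q₀)
    (hg₀ : ContinuousOn g₀ Q₀) (h0 : (0 : E) ∈ Q₀) (hG : IsDilation Q g Q₀ g₀ G) :
    Tendsto (fun ε : ℝ => ε⁻¹ * ((∫ x in Q, G ε x ∂μ) - ∫ x in Q, g x ∂μ)) (𝓝[>] 0)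
      (𝓝 (-∫ x in Q, legendre Q₀ g₀ (fderiv ℝ g x) ∂μ)) := by
  have hQm := hQ.isClosed.measurableSet
  have hae := ae_mem_interior_and_differentiableAt μ hg
  have hsub : ∀ ε : ℝ, Q ⊆ Q + ε • Q₀ := fun ε x hx =>
    mem_add_smul_iff.2 ⟨x, hx, 0, h0, by simp⟩
  obtain ⟨C, hC⟩ := exists_lipschitzWith_legendre hQ₀ ⟨0, h0⟩ hg₀
  have hint := integrableOn_comp_fderiv μ hQ hg hgc hC
  have hgi := hgc.integrableOn_compact (μ := μ) hQ
  have hGi : ∀ ε, 0 ≤ ε → IntegrableOn (G ε) Q μ := fun ε hε =>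
    ((hG.cont ε hε).mono (hsub ε)).integrableOn_compact hQ
  have hlow : ∀ ε, 0 < ε → ∀ x ∈ Q, g₀ 0 ≤ ε⁻¹ * (G ε x - g x) := by
    intro ε hε x hx
    have := hG.le ε hε.le x hx 0 h0
    rw [smul_zero, add_zero] at this
    rw [inv_mul_eq_div, le_div_iff₀ hε]
    linarith
  have hup : ∀ ε, 0 < ε → ∀ x ∈ Q, DifferentiableAt ℝ g x →
      ε⁻¹ * (G ε x - g x) ≤ -legendre Q₀ g₀ (fderiv ℝ g x) := by
    intro ε hε x hx hd
    obtain ⟨q, hq, y, hy, hxy, he⟩ := hG.exists_eq ε hε.le x (hsub ε hx)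
    have h1 := le_add_fderiv hg hx hd hq
    have h2 : q - x = -(ε • y) := by rw [← hxy]; abel
    rw [h2, map_neg, map_smul, smul_eq_mul] at h1
    have h3 := legendre_le hQ₀ hg₀ (fderiv ℝ g x) hy
    rw [inv_mul_eq_div, div_le_iff₀ hε, ← he]
    nlinarith
  have hlim : ∀ᵐ x ∂(μ.restrict Q), Tendsto (fun ε => ε⁻¹ * (G ε x - g x)) (𝓝[>] 0)
      (𝓝 (-legendre Q₀ g₀ (fderiv ℝ g x))) := by
    rw [ae_restrict_iff' hQm]
    filter_upwards [hae] with x hx hxQ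
    obtain ⟨hxi, hd⟩ := hx hxQ
    obtain ⟨y, hy, hye⟩ := exists_legendre_eq hQ₀ ⟨0, h0⟩ hg₀ (fderiv ℝ g x)
    have h1 := (hd.hasFDerivAt.hasLineDerivAt (-y)).tendsto_slope_zero_right.add_const (g₀ y)
    have h2 : fderiv ℝ g x (-y) + g₀ y = -legendre Q₀ g₀ (fderiv ℝ g x) := by
      rw [← hye, map_neg]; ring
    rw [h2] at h1
    have hmem : ∀ᶠ ε : ℝ in 𝓝[>] 0, x + ε • (-y) ∈ Q := by
      have hc : Tendsto (fun ε : ℝ => x + ε • (-y)) (𝓝[>] 0) (𝓝 x) := by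
        have : Continuous fun ε : ℝ => x + ε • (-y) := by fun_prop
        simpa using (this.tendsto 0).mono_left nhdsWithin_le_nhds
      exact hc (mem_interior_iff_mem_nhds.1 hxi)
    refine tendsto_of_tendsto_of_tendsto_of_le_of_le' h1 tendsto_const_nhds ?_ ?_
    · filter_upwards [hmem, self_mem_nhdsWithin] with ε hmε hε
      have hε : 0 < ε := hε
      have h3 := hG.le ε hε.le _ hmε y hy
      have h4 : x + ε • (-y) + ε • y = x := by rw [smul_neg]; abel
      rw [h4] at h3
      have h5 : g₀ y = ε⁻¹ * (ε * g₀ y) := by field_simp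
      rw [smul_eq_mul, h5, ← mul_add]
      exact mul_le_mul_of_nonneg_left (by linarith) (inv_nonneg.2 hε.le)
    · filter_upwards [self_mem_nhdsWithin] with ε hε
      exact hup ε hε x hxQ hd
  have hbi : IntegrableOn (fun x => |g₀ 0| + |legendre Q₀ g₀ (fderiv ℝ g x)|) Q μ :=
    (integrableOn_const hQ.measure_lt_top.ne).add hint.abs
  have h := tendsto_integral_filter_of_dominated_convergence _
    (F := fun ε x => ε⁻¹ * (G ε x - g x)) (l := 𝓝[>] (0 : ℝ)) (μ := μ.restrict Q) ?_ ?_ hbi hlim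
  · rw [integral_neg] at h
    refine h.congr' ?_
    filter_upwards [self_mem_nhdsWithin] with ε hε
    rw [integral_const_mul, integral_sub (hGi ε (le_of_lt hε)) hgi]
  · filter_upwards [self_mem_nhdsWithin] with ε hε
    exact (((hGi ε (le_of_lt hε)).sub hgi).const_mul _).aestronglyMeasurable
  · filter_upwards [self_mem_nhdsWithin] with ε hε
    rw [ae_restrict_iff' hQm]
    filter_upwards [hae] with x hx hxQ
    have h1 := hlow ε hε x hxQ
    have h2 := hup ε hε x hxQ (hx hxQ).2
    rw [Real.norm_eq_abs, abs_le]
    have := neg_abs_le (g₀ 0)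
    have := neg_abs_le (legendre Q₀ g₀ (fderiv ℝ g x))
    have := abs_nonneg (g₀ 0)
    have := abs_nonneg (legendre Q₀ g₀ (fderiv ℝ g x))
    constructor <;> linarith

/-- Every point of Q + ε Q₀ is q + ε y, where `G ε` takes the value f(q) + ε g₀(y); the claim is
uniform continuity of f on compact sets. -/
lemma IsDilation.eventually_abs_sub_le (hQ : IsCompact Q) (hQ₀ : IsCompact Q₀)
    (hg₀ : ContinuousOn g₀ Q₀) (hG : IsDilation Q g Q₀ g₀ G) {f : E → ℝ} (hf : Continuous f)
    (hfg : ∀ x ∈ Q, f x = g x) {η : ℝ} (hη : 0 < η) :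
    ∀ᶠ ε : ℝ in 𝓝[>] 0, ∀ x ∈ Q + ε • Q₀, |G ε x - f x| ≤ η := by
  obtain ⟨C, hC⟩ := hQ₀.exists_bound_of_continuousOn hg₀
  have hK : IsCompact (Q ×ˢ Q₀) := hQ.prod hQ₀
  have h1 : ∀ᶠ ε : ℝ in 𝓝 0, ∀ z ∈ Q ×ˢ Q₀, |f (z.1 + ε • z.2) - f z.1| < η / 2 := by
    refine hK.eventually_forall_of_forall_eventually fun z _ => ?_
    have hc : Continuous fun w : ℝ × (E × E) => |f (w.2.1 + w.1 • w.2.2) - f w.2.1| := by fun_prop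
    have := hc.tendsto (0, z)
    simp only [zero_smul, add_zero, sub_self, abs_zero] at this
    exact this (Iio_mem_nhds (by positivity))
  have h2 : ∀ᶠ ε : ℝ in 𝓝 0, |ε| * C < η / 2 := by
    have hc : Continuous fun ε : ℝ => |ε| * C := by fun_prop
    have := hc.tendsto 0
    simp only [abs_zero, zero_mul] at this
    exact this (Iio_mem_nhds (by positivity))
  filter_upwards [nhdsWithin_le_nhds h1, nhdsWithin_le_nhds h2, self_mem_nhdsWithin]
    with ε he1 he2 hε x hx
  obtain ⟨q, hq, y, hy, hxy, he⟩ := hG.exists_eq ε (le_of_lt hε) x hx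
  have h3 := he1 (q, y) ⟨hq, hy⟩
  simp only [hxy, hfg q hq] at h3
  have h4 : |ε * g₀ y| ≤ |ε| * C := by
    rw [abs_mul]
    exact mul_le_mul_of_nonneg_left (hC y hy) (abs_nonneg _)
  rw [← he]
  have h5 := abs_lt.1 h3
  have h6 := abs_le.1 h4
  rw [abs_le]
  constructor <;> linarith

/-- The polytopes `Q + ε • Q₀` are all cut out by the normals `U`. -/
def IsDilationNormals (U : Finset (StrongDual ℝ E)) (Q Q₀ : Set E) : Prop :=
  ∀ ε : ℝ, 0 ≤ ε → Q + ε • Q₀ = {x | ∀ u ∈ U, supportFun Q u + ε * supportFun Q₀ u ≤ u x}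

lemma isCompact_add_smul (hQ : IsCompact Q) (hQ₀ : IsCompact Q₀) (ε : ℝ) :
    IsCompact (Q + ε • Q₀) := hQ.add (hQ₀.smul ε)

/-- The first variation in the direction of a function whose domain contains the origin. -/
theorem IsDilation.tendsto_slope_of_zero_mem (μ : Measure E) [μ.IsAddHaarMeasure]
    (hQ : IsCompact Q)
    (hg : ConcaveOn ℝ Q g) (hgc : ContinuousOn g Q) (hQ₀ : IsCompact Q₀)
    (hg₀ : ContinuousOn g₀ Q₀) (h0 : (0 : E) ∈ Q₀) (hG : IsDilation Q g Q₀ g₀ G)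
    {U : Finset (StrongDual ℝ E)} (hU : IsNormalSystem U) (hUQ : IsDilationNormals U Q Q₀)
    (ν : ∀ u : StrongDual ℝ E, Measure u.ker)
    (hν : ∀ u ∈ U, (ν u).IsAddHaarMeasure ∧ IsDisintegration μ u (ν u))
    {p : StrongDual ℝ E → E} (hp : ∀ u ∈ U, p u ∈ face Q u) :
    Tendsto (fun ε : ℝ => ε⁻¹ * ((∫ x in Q + ε • Q₀, G ε x ∂μ) - ∫ x in Q, g x ∂μ)) (𝓝[>] 0)
      (𝓝 (-(∑ u ∈ U, supportFun Q₀ u * faceIntegral (ν u) Q (p u) g)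
        - ∫ x in Q, legendre Q₀ g₀ (fderiv ℝ g x) ∂μ)) := by
  have hQm := hQ.isClosed.measurableSet
  have hsub : ∀ ε : ℝ, Q ⊆ Q + ε • Q₀ := fun ε x hx =>
    mem_add_smul_iff.2 ⟨x, hx, 0, h0, by simp⟩
  have hcpt := isCompact_add_smul hQ hQ₀
  -- The layer lies outside Q, where the values of g are irrelevant, so g is replaced by a
  -- continuous extension.
  obtain ⟨f, hf, hfg⟩ := exists_continuous_extension hQ.isClosed hgc
  have hin := hG.tendsto_slope_inside μ hQ hg hgc hQ₀ hg₀ h0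
  have hset : ∀ ε : ℝ, 0 ≤ ε →
      {x : E | ∀ u ∈ U, supportFun Q u - ε * (-supportFun Q₀ u) ≤ u x} = Q + ε • Q₀ := by
    intro ε hε
    rw [hUQ ε hε]
    simp only [mul_neg, sub_neg_eq_add]
  have hQU : Q = {x | ∀ u ∈ U, supportFun Q u ≤ u x} := by
    have := hset 0 le_rfl
    simp only [zero_mul, sub_zero] at this
    rw [this, Set.zero_smul_set ⟨0, h0⟩, add_zero]
  have hbl : ∀ φ : E → ℝ, Continuous φ → Tendsto (fun ε : ℝ => ε⁻¹ * ∫ x in (Q + ε • Q₀) \ Q, φ x ∂μ)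
      (𝓝[>] 0) (𝓝 (∑ u ∈ U, -supportFun Q₀ u * faceIntegral (ν u) Q (p u) φ)) := by
    intro φ hφ
    refine (tendsto_integral_boundaryLayer μ hU hQ.isBounded hQU ν hν (h := fun u => -supportFun Q₀ u)
      (fun u _ => ?_) hp ?_ hφ).congr' ?_
    · have := supportFun_le hQ₀.isBounded u h0
      rw [map_zero] at this
      linarith
    · have := hset 1 zero_le_one
      simp only [one_mul] at this
      rw [this]
      exact (hcpt 1).isBounded
    · filter_upwards [self_mem_nhdsWithin] with ε hε
      rw [hset ε (le_of_lt hε)]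
  have hface : ∀ u ∈ U, faceIntegral (ν u) Q (p u) f = faceIntegral (ν u) Q (p u) g := by
    intro u _
    exact faceIntegral_congr (isClosed_face hQ u) hfg
  have hbf := hbl f hf
  -- The case φ = 1 shows that the layer has measure O(ε), so a uniformly small error in the
  -- integrand contributes o(ε).
  have hb1 := hbl (fun _ => 1) continuous_const
  set c1 := ∑ u ∈ U, -supportFun Q₀ u * faceIntegral (ν u) Q (p u) (fun _ => 1)
  have hGi : ∀ ε, 0 ≤ ε → IntegrableOn (G ε) (Q + ε • Q₀) μ := fun ε hε =>
    (hG.cont ε hε).integrableOn_compact (hcpt ε)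
  have hfi : ∀ ε, IntegrableOn f (Q + ε • Q₀) μ := fun ε =>
    hf.continuousOn.integrableOn_compact (hcpt ε)
  -- the error made by replacing `G ε` by the extension `f`
  have herr : Tendsto (fun ε : ℝ => ε⁻¹ * ∫ x in (Q + ε • Q₀) \ Q, (G ε x - f x) ∂μ) (𝓝[>] 0)
      (𝓝 0) := by
    rw [Metric.tendsto_nhds]
    intro η hη
    have h1 : ∀ᶠ ε : ℝ in 𝓝[>] 0, ε⁻¹ * ∫ x in (Q + ε • Q₀) \ Q, (1 : ℝ) ∂μ < |c1| + 1 :=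
      hb1 (Iio_mem_nhds (by linarith [le_abs_self c1]))
    have hη' : 0 < η / (|c1| + 1) := by positivity
    filter_upwards [h1, hG.eventually_abs_sub_le hQ hQ₀ hg₀ hf hfg hη', self_mem_nhdsWithin]
      with ε he1 he2 hε
    have hε : 0 < ε := hε
    have h2 : |∫ x in (Q + ε • Q₀) \ Q, (G ε x - f x) ∂μ| ≤
        η / (|c1| + 1) * μ.real ((Q + ε • Q₀) \ Q) :=
      norm_setIntegral_le_of_norm_le_const (f := fun x => G ε x - f x)
        ((measure_mono Set.sdiff_subset).trans_lt (hcpt ε).measure_lt_top)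
        fun x hx => he2 x hx.1
    rw [setIntegral_const, smul_eq_mul, mul_one] at he1
    rw [dist_zero_right, norm_mul, Real.norm_eq_abs, Real.norm_eq_abs, abs_of_pos (inv_pos.2 hε)]
    calc ε⁻¹ * |∫ x in (Q + ε • Q₀) \ Q, (G ε x - f x) ∂μ|
        ≤ ε⁻¹ * (η / (|c1| + 1) * μ.real ((Q + ε • Q₀) \ Q)) := by gcongr
      _ = η / (|c1| + 1) * (ε⁻¹ * μ.real ((Q + ε • Q₀) \ Q)) := by ring
      _ < η / (|c1| + 1) * (|c1| + 1) := by gcongr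
      _ = η := by field_simp
  have htot := (herr.add hbf).add hin
  have heq : 0 + ∑ u ∈ U, -supportFun Q₀ u * faceIntegral (ν u) Q (p u) f +
      -∫ x in Q, legendre Q₀ g₀ (fderiv ℝ g x) ∂μ =
      -(∑ u ∈ U, supportFun Q₀ u * faceIntegral (ν u) Q (p u) g)
        - ∫ x in Q, legendre Q₀ g₀ (fderiv ℝ g x) ∂μ := by
    rw [Finset.sum_congr rfl fun u hu => by rw [hface u hu, neg_mul], Finset.sum_neg_distrib]
    ring
  rw [heq] at htot
  refine htot.congr' ?_
  filter_upwards [self_mem_nhdsWithin] with ε hε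
  have hε : 0 < ε := hε
  rw [← Set.union_sdiff_cancel (hsub ε), setIntegral_union Set.disjoint_sdiff_right
    ((hcpt ε).isClosed.measurableSet.diff hQm) ((hGi ε hε.le).mono_set (hsub ε))
    ((hGi ε hε.le).mono_set Set.sdiff_subset), Set.union_sdiff_cancel (hsub ε),
    integral_sub ((hGi ε hε.le).mono_set Set.sdiff_subset) ((hfi ε).mono_set Set.sdiff_subset)]
  ring

lemma mem_preimage_const_add_smul {ε : ℝ} {a x : E} :
    x ∈ Q + ε • {y | a + y ∈ Q₀} ↔ x + ε • a ∈ Q + ε • Q₀ := by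
  rw [mem_add_smul_iff, mem_add_smul_iff]
  constructor
  · rintro ⟨q, hq, y, hy, rfl⟩
    exact ⟨q, hq, a + y, hy, by rw [smul_add]; abel⟩
  · rintro ⟨q, hq, y, hy, h⟩
    refine ⟨q, hq, y - a, by simpa using hy, ?_⟩
    rw [smul_sub, ← add_sub_assoc, h, add_sub_cancel_right]

/-- Translating Q₀ only shifts the argument of `G ε`; this brings the origin into the domain. -/
lemma IsDilation.translate (hG : IsDilation Q g Q₀ g₀ G) (a : E) :
    IsDilation Q g {y | a + y ∈ Q₀} (fun y => g₀ (a + y)) (fun ε x => G ε (x + ε • a)) where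
  le ε hε q hq y hy := by
    have := hG.le ε hε q hq (a + y) hy
    convert this using 2
    rw [smul_add]; abel
  exists_eq ε hε x hx := by
    rw [mem_preimage_const_add_smul] at hx
    obtain ⟨q, hq, y, hy, hxy, he⟩ := hG.exists_eq ε hε _ hx
    refine ⟨q, hq, y - a, by simpa using hy, ?_, by simpa using he⟩
    rw [smul_sub, ← add_sub_assoc, hxy, add_sub_cancel_right]
  cont ε hε := (hG.cont ε hε).comp (by fun_prop) fun x hx => mem_preimage_const_add_smul.1 hx

lemma supportFun_preimage_const_add (hQ₀ : IsCompact Q₀) (hne : Q₀.Nonempty) (a : E)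
    (u : StrongDual ℝ E) : supportFun {y | a + y ∈ Q₀} u = supportFun Q₀ u - u a := by
  have hb : BddBelow (u '' {y | a + y ∈ Q₀}) := by
    refine ⟨supportFun Q₀ u - u a, ?_⟩
    rintro _ ⟨y, hy, rfl⟩
    have := supportFun_le hQ₀.isBounded u hy
    rw [map_add] at this
    linarith
  obtain ⟨y, hy, hyu⟩ := exists_eq_supportFun hQ₀ hne u
  refine le_antisymm ?_ (le_supportFun ⟨y - a, by simpa using hy⟩ fun x hx => ?_)
  · refine csInf_le hb ⟨y - a, by simpa using hy, ?_⟩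
    rw [map_sub, hyu]
  · have := supportFun_le hQ₀.isBounded u hx
    rw [map_add] at this
    linarith

lemma legendre_preimage_const_add (hQ₀ : IsCompact Q₀) (hne : Q₀.Nonempty)
    (hg₀ : ContinuousOn g₀ Q₀) (a : E) (v : StrongDual ℝ E) :
    legendre {y | a + y ∈ Q₀} (fun y => g₀ (a + y)) v = legendre Q₀ g₀ v - v a := by
  obtain ⟨y, hy, hyu⟩ := exists_legendre_eq hQ₀ hne hg₀ v
  have hle : ∀ x ∈ {y | a + y ∈ Q₀}, legendre Q₀ g₀ v - v a ≤ v x - g₀ (a + x) := fun x hx => by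
    have := legendre_le hQ₀ hg₀ v hx
    rw [map_add] at this
    linarith
  refine le_antisymm ?_ (le_legendre ⟨y - a, by simpa using hy⟩ hle)
  refine csInf_le ⟨legendre Q₀ g₀ v - v a, ?_⟩ ⟨y - a, by simpa using hy, ?_⟩
  · rintro _ ⟨x, hx, rfl⟩
    exact hle x hx
  · simp only [map_sub, add_sub_cancel, ← hyu]
    ring

lemma IsDilationNormals.translate {U : Finset (StrongDual ℝ E)} (hUQ : IsDilationNormals U Q Q₀)
    (hQ₀ : IsCompact Q₀) (hne : Q₀.Nonempty) (a : E) :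
    IsDilationNormals U Q {y | a + y ∈ Q₀} := by
  intro ε hε
  ext x
  rw [mem_preimage_const_add_smul, hUQ ε hε]
  simp only [Set.mem_ofPred_eq, supportFun_preimage_const_add hQ₀ hne, map_add, map_smul, smul_eq_mul]
  refine forall₂_congr fun u _ => ?_
  constructor <;> intro h <;> linarith

lemma isCompact_preimage_const_add (hQ₀ : IsCompact Q₀) (a : E) : IsCompact {y | a + y ∈ Q₀} :=
  (Homeomorph.addLeft a).isCompact_preimage.2 hQ₀

lemma continuousOn_comp_const_add (hg₀ : ContinuousOn g₀ Q₀) (a : E) :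
    ContinuousOn (fun y => g₀ (a + y)) {y | a + y ∈ Q₀} :=
  hg₀.comp (by fun_prop) fun _ hx => hx

lemma setIntegral_translate_dilation (μ : Measure E) [μ.IsAddHaarMeasure] (hQ : IsCompact Q)
    (hQ₀ : IsCompact Q₀) (a : E) (ε : ℝ) :
    ∫ x in Q + ε • {y | a + y ∈ Q₀}, G ε (x + ε • a) ∂μ = ∫ x in Q + ε • Q₀, G ε x ∂μ := by
  rw [← integral_indicator (isCompact_add_smul hQ hQ₀ ε).isClosed.measurableSet,
    ← integral_indicator (isCompact_add_smul hQ
      (isCompact_preimage_const_add hQ₀ a) ε).isClosed.measurableSet,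
    ← integral_add_right_eq_self ((Q + ε • Q₀).indicator (G ε)) (ε • a)]
  congr 1
  ext x
  by_cases hx : x + ε • a ∈ Q + ε • Q₀
  · rw [Set.indicator_of_mem (mem_preimage_const_add_smul.2 hx), Set.indicator_of_mem hx]
  · rw [Set.indicator_of_notMem (mt mem_preimage_const_add_smul.1 hx), Set.indicator_of_notMem hx]

/-- The divergence theorem for a concave function on a polytope. -/
theorem sum_apply_mul_faceIntegral_add_integral_fderiv (μ : Measure E) [μ.IsAddHaarMeasure]
    (hQ : IsCompact Q)
    (hg : ConcaveOn ℝ Q g) (hgc : ContinuousOn g Q)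
    {U : Finset (StrongDual ℝ E)} (hU : IsNormalSystem U)
    (ν : ∀ u : StrongDual ℝ E, Measure u.ker)
    (hν : ∀ u ∈ U, (ν u).IsAddHaarMeasure ∧ IsDisintegration μ u (ν u))
    {p : StrongDual ℝ E → E} (hp : ∀ u ∈ U, p u ∈ face Q u) {B : Set E} {g' : E → ℝ}
    (hB : IsCompact B) (hB0 : B ∈ 𝓝 0) (hg' : ContinuousOn g' B) (hG : IsDilation Q g B g' G)
    (hUB : IsDilationNormals U Q B) (a : E) :
    ∑ u ∈ U, u a * faceIntegral (ν u) Q (p u) g + ∫ x in Q, fderiv ℝ g x a ∂μ = 0 := by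
  have h0B : (0 : E) ∈ B := mem_of_mem_nhds hB0
  -- Both B and its translate by -a contain the origin and yield the same integrals, so their two
  -- first variations agree. The support functions differ by u(a) and the duals by the value at a;
  -- what remains is the claim.
  have key : ∀ a ∈ B,
      ∑ u ∈ U, u a * faceIntegral (ν u) Q (p u) g + ∫ x in Q, fderiv ℝ g x a ∂μ = 0 := by
    intro a ha
    have h1 := hG.tendsto_slope_of_zero_mem μ hQ hg hgc hB hg' h0B hU hUB ν hν hp
    have h2 := (hG.translate a).tendsto_slope_of_zero_mem μ hQ hg hgc
      (isCompact_preimage_const_add hB a)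
      (continuousOn_comp_const_add hg' a) (by simpa using ha) hU
      (hUB.translate hB ⟨0, h0B⟩ a) ν hν hp
    simp only [setIntegral_translate_dilation μ hQ hB] at h2
    have h3 := tendsto_nhds_unique h1 h2
    simp only [supportFun_preimage_const_add hB ⟨0, h0B⟩, sub_mul, Finset.sum_sub_distrib,
      legendre_preimage_const_add hB ⟨0, h0B⟩ hg'] at h3
    obtain ⟨C, hC⟩ := exists_lipschitzWith_legendre hB ⟨0, h0B⟩ hg'
    rw [integral_sub (integrableOn_comp_fderiv μ hQ hg hgc hC)
      ((integrableOn_fderiv μ hQ hg hgc).apply_continuousLinearMap a)] at h3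
    linarith
  -- The identity is linear in a, so it suffices to prove it for a small positive multiple.
  have hc : ∀ᶠ t : ℝ in 𝓝[>] 0, t • a ∈ B := by
    have : Tendsto (fun t : ℝ => t • a) (𝓝[>] 0) (𝓝 0) := by
      have h : Continuous fun t : ℝ => t • a := by fun_prop
      simpa using (h.tendsto 0).mono_left nhdsWithin_le_nhds
    exact this hB0
  obtain ⟨t, htB, ht⟩ := (hc.and self_mem_nhdsWithin).exists
  have h := key _ htB
  simp only [map_smul, smul_eq_mul, mul_assoc, integral_const_mul, ← Finset.mul_sum] at h
  rw [← mul_add] at h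
  exact (mul_eq_zero.1 h).resolve_left (ne_of_gt ht)

/-- The first variation of the integral of a concave function. -/
theorem IsDilation.tendsto_slope (μ : Measure E) [μ.IsAddHaarMeasure]
    (hQ : IsCompact Q)
    (hg : ConcaveOn ℝ Q g) (hgc : ContinuousOn g Q) (hQ₀ : IsCompact Q₀) (hne₀ : Q₀.Nonempty)
    (hg₀ : ContinuousOn g₀ Q₀) (hG : IsDilation Q g Q₀ g₀ G)
    {U : Finset (StrongDual ℝ E)} (hU : IsNormalSystem U) (hUQ : IsDilationNormals U Q Q₀)
    (ν : ∀ u : StrongDual ℝ E, Measure u.ker)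
    (hν : ∀ u ∈ U, (ν u).IsAddHaarMeasure ∧ IsDisintegration μ u (ν u))
    {p : StrongDual ℝ E → E} (hp : ∀ u ∈ U, p u ∈ face Q u) {B : Set E} {g' : E → ℝ}
    {G' : ℝ → E → ℝ} (hB : IsCompact B) (hB0 : B ∈ 𝓝 0) (hg' : ContinuousOn g' B)
    (hG' : IsDilation Q g B g' G') (hUB : IsDilationNormals U Q B) :
    Tendsto (fun ε : ℝ => ε⁻¹ * ((∫ x in Q + ε • Q₀, G ε x ∂μ) - ∫ x in Q, g x ∂μ)) (𝓝[>] 0)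
      (𝓝 (-(∑ u ∈ U, supportFun Q₀ u * faceIntegral (ν u) Q (p u) g)
        - ∫ x in Q, legendre Q₀ g₀ (fderiv ℝ g x) ∂μ)) := by
  -- After translation by a point of Q₀ the origin lies in the domain; the terms this introduces
  -- cancel by the divergence theorem.
  obtain ⟨a, ha⟩ := hne₀
  have h := (hG.translate a).tendsto_slope_of_zero_mem μ hQ hg hgc
    (isCompact_preimage_const_add hQ₀ a)
    (continuousOn_comp_const_add hg₀ a) (by simpa using ha) hU
    (hUQ.translate hQ₀ ⟨a, ha⟩ a) ν hν hp
  simp only [setIntegral_translate_dilation μ hQ hQ₀] at h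
  convert h using 2
  obtain ⟨C, hC⟩ := exists_lipschitzWith_legendre hQ₀ ⟨a, ha⟩ hg₀
  have hdiv := sum_apply_mul_faceIntegral_add_integral_fderiv μ hQ hg hgc hU ν hν hp hB hB0 hg'
    hG' hUB a
  simp only [supportFun_preimage_const_add hQ₀ ⟨a, ha⟩, sub_mul, Finset.sum_sub_distrib,
    legendre_preimage_const_add hQ₀ ⟨a, ha⟩ hg₀]
  rw [integral_sub (integrableOn_comp_fderiv μ hQ hg hgc hC)
    ((integrableOn_fderiv μ hQ hg hgc).apply_continuousLinearMap a)]
  linarith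

end FirstVariation

/-! ### Lattices and primitive vectors -/

section LatticeVectors

open Filter Topology

variable {E : Type*} [NormedAddCommGroup E] [NormedSpace ℝ E]

lemma isPrimitive_of_apply_eq_one {M : Submodule ℤ E} {u : StrongDual ℝ E}
    (hu : u ∈ dualLattice M) {w : E} (hw : w ∈ M) (h : u w = 1) : IsPrimitive M u := by
  refine ⟨hu, fun h0 => by simp [h0] at h, fun u' hu' k hk hku => ?_⟩
  obtain ⟨j, hj⟩ := hu' w hw
  have h1 : (k : ℝ) * j = 1 := by rw [← hj, ← h, ← hku]; simp
  have h2 : (k : ℤ) * j = 1 := by exact_mod_cast h1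
  have h3 : (k : ℤ) = 1 := Int.eq_one_of_mul_eq_one_right (by positivity) h2
  have h4 : k = 1 := by exact_mod_cast h3
  rw [← hku, h4, one_smul]

/-- A nonzero vector of the dual lattice is a multiple of one that takes the value `1` on the
lattice. -/
lemma exists_eq_smul_apply_eq_one {M : Submodule ℤ E} (hM : Submodule.span ℝ (M : Set E) = ⊤)
    {u : StrongDual ℝ E} (hu : u ∈ dualLattice M) (h0 : u ≠ 0) :
    ∃ k : ℕ, 0 < k ∧ ∃ u' ∈ dualLattice M, (∃ w ∈ M, u' w = 1) ∧ k • u' = u := by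
  -- The values of `u` on the lattice form a subgroup aℤ, nonzero because the lattice spans;
  -- dividing `u` by |a| makes 1 a value.
  let H : AddSubgroup ℤ :=
    { carrier := {k | ∃ m ∈ M, u m = k}
      zero_mem' := ⟨0, M.zero_mem, by simp⟩
      add_mem' := by
        rintro a b ⟨m, hm, h⟩ ⟨m', hm', h'⟩
        exact ⟨m + m', M.add_mem hm hm', by rw [map_add, h, h']; push_cast; rfl⟩
      neg_mem' := by
        rintro a ⟨m, hm, h⟩
        exact ⟨-m, M.neg_mem hm, by rw [map_neg, h]; push_cast; rfl⟩ }
  obtain ⟨a, ha⟩ := Int.subgroup_cyclic H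
  have hmem : ∀ k : ℤ, k ∈ H ↔ ∃ j : ℤ, j * a = k := fun k => by
    rw [ha, AddSubgroup.mem_closure_singleton]
    simp
  have ha0 : a ≠ 0 := by
    rintro rfl
    refine h0 (ContinuousLinearMap.ext fun x => ?_)
    have hx : x ∈ Submodule.span ℝ (M : Set E) := by rw [hM]; trivial
    induction hx using Submodule.span_induction with
    | mem m hm =>
      obtain ⟨k, hk⟩ := hu m hm
      obtain ⟨j, hj⟩ := (hmem k).1 ⟨m, hm, hk⟩
      rw [hk, ← hj]; simp
    | zero => simp
    | add x y _ _ hx hy => simpa using by rw [hx, hy]; simp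
    | smul c x _ hx => rw [map_smul, hx]; simp
  obtain ⟨d, hda⟩ : ∃ d : ℕ, (d : ℤ) = |a| := ⟨a.natAbs, Int.natCast_natAbs a⟩
  have hdpos : 0 < d := by
    have : (0 : ℤ) < d := hda ▸ abs_pos.2 ha0
    exact_mod_cast this
  have hd0 : (0 : ℝ) < d := by exact_mod_cast hdpos
  refine ⟨d, hdpos, (d : ℝ)⁻¹ • u, ?_, ?_, ?_⟩
  · intro m hm
    obtain ⟨k, hk⟩ := hu m hm
    obtain ⟨j, hj⟩ := (hmem k).1 ⟨m, hm, hk⟩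
    have h1 : |a| ∣ k := (abs_dvd a k).2 ⟨j, by rw [← hj, mul_comm]⟩
    obtain ⟨i, hi⟩ := h1
    refine ⟨i, ?_⟩
    rw [smul_apply, hk, hi, ← hda]
    push_cast
    rw [smul_eq_mul, inv_mul_cancel_left₀ hd0.ne']
  · have h1 : |a| ∈ H := by
      rcases abs_choice a with h | h
      · exact (hmem _).2 ⟨1, by rw [h, one_mul]⟩
      · exact (hmem _).2 ⟨-1, by rw [h]; ring⟩
    obtain ⟨w, hw, h⟩ := h1
    refine ⟨w, hw, ?_⟩
    rw [smul_apply, h, ← hda]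
    push_cast
    rw [smul_eq_mul, inv_mul_cancel₀ hd0.ne']
  · ext x
    simp [hd0.ne']

lemma IsPrimitive.exists_apply_eq_one {M : Submodule ℤ E}
    (hM : Submodule.span ℝ (M : Set E) = ⊤) {u : StrongDual ℝ E} (hu : IsPrimitive M u) :
    ∃ w ∈ M, u w = 1 := by
  obtain ⟨k, hk, u', hu', hw, h⟩ := exists_eq_smul_apply_eq_one hM hu.1 hu.2.1
  rwa [hu.2.2 u' hu' k hk h] at hw

/-- Primitive vectors on the same ray agree. -/
lemma IsPrimitive.eq_of_eq_smul {M : Submodule ℤ E}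
    (hM : Submodule.span ℝ (M : Set E) = ⊤) {u v : StrongDual ℝ E} (hu : IsPrimitive M u)
    (hv : IsPrimitive M v) {c : ℝ} (hc : 0 < c) (h : v = c • u) : v = u := by
  obtain ⟨w, hw, huw⟩ := hu.exists_apply_eq_one hM
  -- Evaluating at a lattice vector where u is 1 shows that c is a positive integer, and primitivity
  -- of v applies.
  obtain ⟨j, hj⟩ := hv.1 w hw
  rw [h, smul_apply, huw, smul_eq_mul, mul_one] at hj
  have hj0 : 0 < j := by rw [hj] at hc; exact_mod_cast hc
  lift j to ℕ using hj0.le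
  refine (hv.2.2 u hu.1 j (by exact_mod_cast hj0) ?_).symm
  rw [h, hj]
  ext x
  simp

end LatticeVectors

/-! ### Lattice volumes of hyperplanes and rational normals -/

section LatticeMeasure

open Filter Topology

variable {E : Type*} [NormedAddCommGroup E] [NormedSpace ℝ E] [FiniteDimensional ℝ E]

lemma discreteTopology_perpLattice (M : Submodule ℤ E) [DiscreteTopology M]
    (u : StrongDual ℝ E) : DiscreteTopology (perpLattice M u) :=
  ZLattice.comap_discreteTopology ℝ M (e := u.ker.subtype) continuous_subtype_val
    Subtype.val_injective

/-- The projection onto the kernel of `u` along `w`. -/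
def kerProj (u : StrongDual ℝ E) (w : E) (hw : u w = 1) : E →L[ℝ] u.ker :=
  (ContinuousLinearMap.snd ℝ ℝ u.ker).comp (hyperplaneEquiv u w hw).symm.toContinuousLinearMap

lemma coe_kerProj (u : StrongDual ℝ E) (w : E) (hw : u w = 1) (x : E) :
    (kerProj u w hw x : E) = x - u x • w := rfl

lemma kerProj_coe (u : StrongDual ℝ E) (w : E) (hw : u w = 1) (y : u.ker) :
    kerProj u w hw y = y := by
  have h : u (y : E) = 0 := y.2
  exact Subtype.ext (by rw [coe_kerProj, h, zero_smul, sub_zero])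

lemma mem_perpLattice {M : Submodule ℤ E} {u : StrongDual ℝ E} {y : u.ker} :
    y ∈ perpLattice M u ↔ (y : E) ∈ M := Iff.rfl

lemma kerProj_mem {M : Submodule ℤ E} {u : StrongDual ℝ E} (hu : u ∈ dualLattice M) {w : E}
    (hwM : w ∈ M) (hw : u w = 1) {m : E} (hm : m ∈ M) : kerProj u w hw m ∈ perpLattice M u := by
  obtain ⟨k, hk⟩ := hu m hm
  rw [mem_perpLattice, coe_kerProj, hk, Int.cast_smul_eq_zsmul]
  exact M.sub_mem hm (M.smul_mem k hwM)

/-- The projection along a lattice vector w with u(w) = 1 subtracts an integral multiple of w, so it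
maps M into M(u) and carries a spanning set to a spanning set. -/
lemma isZLattice_perpLattice (M : Submodule ℤ E) [DiscreteTopology M] [IsZLattice ℝ M]
    {u : StrongDual ℝ E} (hu : u ∈ dualLattice M) {w : E} (hwM : w ∈ M) (hw : u w = 1) :
    haveI := discreteTopology_perpLattice M u
    IsZLattice ℝ (perpLattice M u) := by
  have := discreteTopology_perpLattice M u
  refine ⟨top_le_iff.1 fun y _ => ?_⟩
  have h1 : (y : E) ∈ Submodule.span ℝ (M : Set E) := by
    rw [IsZLattice.span_top]; trivial
  have h2 : kerProj u w hw (y : E) ∈ (Submodule.span ℝ (M : Set E)).map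
      (kerProj u w hw : E →ₗ[ℝ] u.ker) := Submodule.mem_map_of_mem h1
  rw [kerProj_coe, Submodule.map_span] at h2
  refine Submodule.span_mono ?_ h2
  rintro _ ⟨m, hm, rfl⟩
  exact kerProj_mem hu hwM hw hm

variable [MeasurableSpace E] [BorelSpace E]

instance isAddHaarMeasure_latticeVolume (L : Submodule ℤ E) [DiscreteTopology L] [IsZLattice ℝ L] :
    (latticeVolume L).IsAddHaarMeasure :=
  Measure.IsAddHaarMeasure.smul _ (ENNReal.inv_ne_zero.2 ENNReal.ofReal_ne_top)
    (ENNReal.inv_ne_top.2 (ENNReal.ofReal_pos.2 (ZLattice.covolume_pos L _)).ne')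

lemma latticeVolume_fundamentalDomain (L : Submodule ℤ E) [DiscreteTopology L] [IsZLattice ℝ L]
    {F : Set E} (hF : IsAddFundamentalDomain L F (Measure.addHaar : Measure E)) :
    latticeVolume L F = 1 := by
  have h1 := ZLattice.covolume_eq_measure_fundamentalDomain L (Measure.addHaar : Measure E) hF
  have h2 := ZLattice.covolume_pos L (Measure.addHaar : Measure E)
  have h3 : (Measure.addHaar : Measure E) F ≠ ∞ := fun h0 => by
    rw [h1, Measure.real, h0] at h2
    simp at h2
  rw [latticeVolume, Measure.smul_apply, smul_eq_mul, h1, Measure.real,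
    ENNReal.ofReal_toReal h3]
  refine ENNReal.inv_mul_cancel (fun h0 => ?_) h3
  rw [h1, Measure.real, h0] at h2
  simp at h2

/-- Two Haar measures are proportional, and the factor is read off on a common fundamental domain.
-/
lemma eq_latticeVolume (L : Submodule ℤ E) [DiscreteTopology L] [IsZLattice ℝ L]
    (μ : Measure E) [μ.IsAddHaarMeasure] {F : Set E}
    (hF : ∀ ν : Measure E, IsAddFundamentalDomain L F ν) (h : μ F = 1) :
    μ = latticeVolume L := by
  have h1 := Measure.isAddLeftInvariant_eq_smul μ (latticeVolume L)
  have h2 := latticeVolume_fundamentalDomain L (hF _)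
  rw [h1, Measure.smul_apply, h2, ENNReal.smul_def, smul_eq_mul, mul_one] at h
  rw [h1, ENNReal.smul_def, h, one_smul]

/-- The lattice volume of `E` is compatible with the lattice volume of the kernel of a primitive
vector. -/
lemma isDisintegration_latticeVolume (M : Submodule ℤ E) [DiscreteTopology M] [IsZLattice ℝ M]
    {u : StrongDual ℝ E} (hu : IsPrimitive M u) :
    (latticeVolume (perpLattice M u)).IsAddHaarMeasure ∧
      IsDisintegration (latticeVolume M) u (latticeVolume (perpLattice M u)) := by
  obtain ⟨w, hwM, hw⟩ := hu.exists_apply_eq_one (IsZLattice.span_top (K := ℝ) (L := M))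
  have := discreteTopology_perpLattice M u
  have := isZLattice_perpLattice M hu.1 hwM hw
  refine ⟨inferInstance, w, hw, ?_⟩
  set ν := latticeVolume (perpLattice M u)
  set T := hyperplaneEquiv u w hw
  let b := (Module.Free.chooseBasis ℤ (perpLattice M u))
  set F := ZSpan.fundamentalDomain (b.ofZLatticeBasis ℝ)
  have hF : ∀ y : u.ker, ∃! l : perpLattice M u, (l : u.ker) + y ∈ F := by
    have h1 := ZSpan.exist_unique_vadd_mem_fundamentalDomain (b.ofZLatticeBasis ℝ)
    have h2 : ∀ L : Submodule ℤ u.ker, Submodule.span ℤ (Set.range (b.ofZLatticeBasis ℝ)) = L →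
        ∀ y : u.ker, ∃! l : L, (l : u.ker) + y ∈ F := by
      rintro _ rfl
      exact h1
    exact h2 _ (b.ofZLatticeBasis_span ℝ)
  have hFm : MeasurableSet F := ZSpan.fundamentalDomain_measurableSet _
  -- Since M is the direct sum of ℤw and M(u), the unit interval along w times a fundamental domain
  -- of M(u) is a fundamental domain of M.
  let F' : Set E := {x | u x ∈ Set.Ico 0 1 ∧ kerProj u w hw x ∈ F}
  have hF'm : MeasurableSet F' :=
    (u.continuous.measurable measurableSet_Ico).inter ((kerProj u w hw).continuous.measurable hFm)
  have hF'fd : ∀ m : Measure E, IsAddFundamentalDomain M F' m := by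
    intro m
    refine IsAddFundamentalDomain.mk' hF'm.nullMeasurableSet fun x => ?_
    obtain ⟨l, hl, hl'⟩ := hF (kerProj u w hw x)
    have hlw : ((l : u.ker) : E) ∈ M := l.2
    have hul : u ((l : u.ker) : E) = 0 := (l : u.ker).2
    have hPw : kerProj u w hw w = 0 := Subtype.ext (by rw [coe_kerProj, hw]; simp)
    refine ⟨⟨-⌊u x⌋ • w + (l : u.ker), M.add_mem (M.smul_mem _ hwM) hlw⟩, ⟨?_, ?_⟩, ?_⟩
    · change u (-⌊u x⌋ • w + (l : u.ker) + x) ∈ Set.Ico 0 1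
      rw [map_add, map_add, hul, map_zsmul, hw]
      have := Int.fract_nonneg (u x)
      have := Int.fract_lt_one (u x)
      simp only [zsmul_eq_mul, Int.cast_neg, mul_one, add_zero, Set.mem_Ico]
      constructor <;> linarith [Int.self_sub_floor (u x)]
    · change kerProj u w hw (-⌊u x⌋ • w + (l : u.ker) + x) ∈ F
      rw [map_add, map_add, map_zsmul, hPw, smul_zero, zero_add, kerProj_coe]
      exact hl
    · rintro ⟨m, hm⟩ ⟨h1, h2⟩
      change u (m + x) ∈ Set.Ico 0 1 at h1
      change kerProj u w hw (m + x) ∈ F at h2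
      rw [map_add] at h1 h2
      obtain ⟨k, hk⟩ := hu.1 m hm
      have h3 := hl' ⟨_, kerProj_mem hu.1 hwM hw hm⟩ h2
      have h4 : m - u m • w = ((l : u.ker) : E) := congr((($h3 : u.ker) : E))
      have h5 : k = -⌊u x⌋ := by
        rw [hk] at h1
        have : ⌊u x⌋ = -k := Int.floor_eq_iff.2 ⟨by push_cast; linarith [h1.1], by
          push_cast; linarith [h1.2]⟩
        omega
      refine Subtype.ext ?_
      change m = -⌊u x⌋ • w + ((l : u.ker) : E)
      rw [← h4, hk, ← h5, Int.cast_smul_eq_zsmul]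
      abel
  have hHaar : ((volume.prod ν).map T).IsAddHaarMeasure := T.isAddHaarMeasure_map _
  refine ⟨T.continuous.measurable, eq_latticeVolume M ((volume.prod ν).map T) hF'fd ?_⟩
  have hpre : T ⁻¹' F' = Set.Ico (0 : ℝ) 1 ×ˢ F := by
    ext p
    have h1 : u (T p) = p.1 := congr(($(T.symm_apply_apply p)).1)
    have h2 : kerProj u w hw (T p) = p.2 := congr(($(T.symm_apply_apply p)).2)
    change u (T p) ∈ _ ∧ kerProj u w hw (T p) ∈ F ↔ _
    rw [h1, h2]; rfl
  rw [Measure.map_apply T.continuous.measurable hF'm, hpre, Measure.prod_prod,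
    latticeVolume_fundamentalDomain _ (ZLattice.isAddFundamentalDomain b _)]
  simp

/-! ### Rational polytopes -/

/-- Integrality on a basis suffices. This expresses membership in the dual lattice by coefficients
in the subring ℤ of ℝ, the form in which elimination preserves it. -/
lemma mem_dualLattice_iff (M : Submodule ℤ E) [DiscreteTopology M] [IsZLattice ℝ M]
    {κ : Type*} (b : Module.Basis κ ℤ M) (u : StrongDual ℝ E) : u ∈ dualLattice M ↔
      ∀ k, u (b.ofZLatticeBasis ℝ M k) ∈ (Int.castRingHom ℝ).range := by
  constructor
  · intro hu k
    obtain ⟨j, hj⟩ := hu (b.ofZLatticeBasis ℝ M k) (by rw [b.ofZLatticeBasis_apply ℝ]; exact (b k).2)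
    exact ⟨j, hj.symm⟩
  · intro hu m hm
    rw [← b.ofZLatticeBasis_span ℝ] at hm
    induction hm using Submodule.span_induction with
    | mem x hx =>
      obtain ⟨k, rfl⟩ := hx
      obtain ⟨j, hj⟩ := hu k
      exact ⟨j, hj.symm⟩
    | zero => exact ⟨0, by simp⟩
    | add x y _ _ hx hy =>
      obtain ⟨i, hi⟩ := hx
      obtain ⟨j, hj⟩ := hy
      exact ⟨i + j, by rw [map_add, hi, hj]; push_cast; rfl⟩
    | smul c x _ hx =>
      obtain ⟨i, hi⟩ := hx
      exact ⟨c * i, by rw [map_zsmul, hi]; push_cast; rw [zsmul_eq_mul]⟩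

lemma isRationalPolytope_iff (M : Submodule ℤ E) [DiscreteTopology M] [IsZLattice ℝ M]
    {κ : Type*} (b : Module.Basis κ ℤ M) (Q : Set E) :
    IsRationalPolytope M Q ↔ IsHPoly (b.ofZLatticeBasis ℝ) (Int.castRingHom ℝ).range Q := by
  simp only [IsRationalPolytope, IsHPoly, mem_dualLattice_iff M b]

lemma IsRationalPolytope.isHPoly {M : Submodule ℤ E} {Q : Set E} (h : IsRationalPolytope M Q) :
    IsHPoly (id : E → E) ⊤ Q :=
  ⟨h.1, h.2.imp fun _ hH => ⟨fun _ _ _ => trivial, hH.2⟩⟩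

/-- A rational polytope that is a neighbourhood of the origin. -/
lemma exists_isRationalPolytope_mem_nhds (M : Submodule ℤ E) [DiscreteTopology M]
    [IsZLattice ℝ M] : ∃ B, IsRationalPolytope M B ∧ B ∈ 𝓝 0 := by
  classical
  let b := Module.Free.chooseBasis ℤ M
  let β := b.ofZLatticeBasis ℝ M
  let c : Module.Free.ChooseBasisIndex ℤ M → StrongDual ℝ E := fun k =>
    LinearMap.toContinuousLinearMap (β.coord k)
  have hc : ∀ k x, c k x = β.repr x k := fun k x => rfl
  -- A cube in the coordinates of a lattice basis, whose coordinate functionals belong to the dual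
  -- lattice.
  let B : Set E := {x | ∀ k, |c k x| ≤ 1}
  refine ⟨B, ⟨?_, Finset.univ.image (fun k => (c k, 1)) ∪ Finset.univ.image (fun k => (-c k, 1)),
    ?_, ?_⟩, ?_⟩
  · refine isBounded_iff_forall_norm_le.2 ⟨∑ k, ‖β k‖, fun x hx => ?_⟩
    calc ‖x‖ = ‖∑ k, β.repr x k • β k‖ := by rw [β.sum_repr]
      _ ≤ ∑ k, ‖β.repr x k • β k‖ := norm_sum_le _ _
      _ ≤ ∑ k, ‖β k‖ := Finset.sum_le_sum fun k _ => by
        rw [norm_smul]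
        exact mul_le_of_le_one_left (norm_nonneg _) (hx k)
  · have hcd : ∀ k, c k ∈ dualLattice M := fun k m hm =>
      ⟨b.repr ⟨m, hm⟩ k, by rw [hc]; exact b.ofZLatticeBasis_repr_apply ℝ M ⟨m, hm⟩ k⟩
    intro h hh
    simp only [Finset.mem_union, Finset.mem_image, Finset.mem_univ, true_and] at hh
    rcases hh with ⟨k, rfl⟩ | ⟨k, rfl⟩
    · exact hcd k
    · intro m hm
      obtain ⟨j, hj⟩ := hcd k m hm
      exact ⟨-j, by simp [hj]⟩
  · ext x
    simp only [B, Finset.mem_union, Finset.mem_image, Finset.mem_univ, true_and,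
      Set.mem_ofPred_eq, abs_le]
    constructor
    · rintro h _ (⟨k, rfl⟩ | ⟨k, rfl⟩)
      · linarith [(h k).1]
      · simp only [neg_apply]; linarith [(h k).2]
    · intro h k
      have h1 := h _ (Or.inl ⟨k, rfl⟩)
      have h2 := h _ (Or.inr ⟨k, rfl⟩)
      simp only [neg_apply] at h1 h2
      constructor <;> linarith
  · have : ∀ᶠ x in 𝓝 (0 : E), ∀ k, |c k x| < 1 := by
      refine eventually_all.2 fun k => ?_
      have h : Continuous fun x => |c k x| := by fun_prop
      have h1 := h.tendsto 0
      rw [map_zero, abs_zero] at h1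
      exact h1 (Iio_mem_nhds zero_lt_one)
    filter_upwards [this] with x hx k
    exact (hx k).le

/-- The weighted sums of rational polytopes are all cut out by the same finitely many primitive
normals. -/
lemma exists_primitive_normals {ι : Type*} [Fintype ι] (M : Submodule ℤ E) [DiscreteTopology M]
    [IsZLattice ℝ M] {K : ι → Set E} (hK : ∀ i, IsRationalPolytope M (K i))
    (hne : ∀ i, (K i).Nonempty) :
    ∃ U : Finset (StrongDual ℝ E), IsNormalSystem U ∧ (∀ u ∈ U, IsPrimitive M u) ∧
      ∀ l : ι → ℝ, (∀ i, 0 ≤ l i) →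
        wsum K l = {x | ∀ u ∈ U, ∑ i, l i * supportFun (K i) u ≤ u x} := by
  classical
  let b := Module.Free.chooseBasis ℤ M
  have hspan : Submodule.span ℝ (M : Set E) = ⊤ := IsZLattice.span_top
  -- Elimination over ℤ produces slopes in the dual lattice; the nonzero ones are then divided down
  -- to primitive vectors.
  obtain ⟨U, hUR, hU⟩ := exists_slopes_wsum (b.ofZLatticeBasis ℝ M) (Int.castRingHom ℝ).range K
    (fun i => (isRationalPolytope_iff M b _).1 (hK i)) hne
  have hr : ∀ u : StrongDual ℝ E, ∃ u' : StrongDual ℝ E, u ∈ U → u ≠ 0 →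
      IsPrimitive M u' ∧ ∃ c : ℝ, 0 < c ∧ u = c • u' := by
    intro u
    by_cases h : u ∈ U ∧ u ≠ 0
    · have hu : u ∈ dualLattice M := (mem_dualLattice_iff M b u).2 (hUR u h.1)
      obtain ⟨k, hk, u', hu', ⟨w, hw, h1⟩, h2⟩ := exists_eq_smul_apply_eq_one hspan hu h.2
      exact ⟨u', fun _ _ => ⟨isPrimitive_of_apply_eq_one hu' hw h1, k, by exact_mod_cast hk, by
        rw [← h2, Nat.cast_smul_eq_nsmul]⟩⟩
    · exact ⟨0, fun h1 h2 => absurd ⟨h1, h2⟩ h⟩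
  choose r hr using hr
  have hprim : ∀ u ∈ (U.filter (· ≠ 0)).image r, IsPrimitive M u := by
    intro u hu
    obtain ⟨v, hv, rfl⟩ := Finset.mem_image.1 hu
    exact (hr v (Finset.mem_filter.1 hv).1 (Finset.mem_filter.1 hv).2).1
  refine ⟨(U.filter (· ≠ 0)).image r, ⟨fun u hu => (hprim u hu).2.1, fun u hu v hv c hc h =>
    (hprim u hu).eq_of_eq_smul hspan (hprim v hv) hc h⟩, hprim, fun l hl => ?_⟩
  rw [wsum_eq_of_rescale U (hU l hl) r fun u hu h0 => (hr u hu h0).2]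

end LatticeMeasure

/-! ### Sup-convolutions as weighted sums -/

section Reindexing

variable {E : Type*} [NormedAddCommGroup E] [NormedSpace ℝ E]
  {ι κ : Type*} [Fintype ι] [Fintype κ]

lemma exists_extend {e : κ → ι} (he : Function.Injective e) {K : ι → Set E}
    (hne : ∀ i, (K i).Nonempty) {y : κ → E} (hy : ∀ j, y j ∈ K (e j)) :
    ∃ z : ι → E, (∀ i, z i ∈ K i) ∧ ∀ j, z (e j) = y j := by
  choose q hq using hne
  refine ⟨Function.extend e y q, fun i => ?_, fun j => he.extend_apply y q j⟩
  by_cases h : ∃ j, e j = i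
  · obtain ⟨j, rfl⟩ := h
    rw [he.extend_apply]
    exact hy j
  · rw [Function.extend_apply' _ _ _ h]
    exact hq i

/-- Summands of weight zero can be left out. -/
lemma wsum_comp {e : κ → ι} (he : Function.Injective e) {K : ι → Set E}
    (hne : ∀ i, (K i).Nonempty) {l : ι → ℝ} (hl : ∀ i ∉ Set.range e, l i = 0) :
    wsum (fun j => K (e j)) (fun j => l (e j)) = wsum K l := by
  have hsum : ∀ z : ι → E, ∑ j, l (e j) • z (e j) = ∑ i, l i • z i := fun z =>
    Fintype.sum_of_injective e he _ _ (fun i hi => by rw [hl i hi, zero_smul]) fun _ => rfl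
  ext x
  constructor
  · rintro ⟨y, hy, rfl⟩
    obtain ⟨z, hz, hzy⟩ := exists_extend he hne hy
    exact ⟨z, hz, by simp only [← hsum, hzy]⟩
  · rintro ⟨z, hz, rfl⟩
    exact ⟨fun j => z (e j), fun j => hz _, hsum z⟩

lemma wfun_comp {e : κ → ι} (he : Function.Injective e) {K : ι → Set E} (g : ι → E → ℝ)
    (hne : ∀ i, (K i).Nonempty) {l : ι → ℝ} (hl : ∀ i ∉ Set.range e, l i = 0) :
    wfun (fun j => K (e j)) (fun j => g (e j)) (fun j => l (e j)) = wfun K g l := by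
  have hsum : ∀ z : ι → E, ∑ j, l (e j) • z (e j) = ∑ i, l i • z i := fun z =>
    Fintype.sum_of_injective e he _ _ (fun i hi => by rw [hl i hi, zero_smul]) fun _ => rfl
  have hsum' : ∀ z : ι → E, ∑ j, l (e j) * g (e j) (z (e j)) = ∑ i, l i * g i (z i) := fun z =>
    Fintype.sum_of_injective e he _ _ (fun i hi => by rw [hl i hi, zero_mul]) fun _ => rfl
  ext x
  rw [wfun, wfun]
  congr 1
  ext s
  constructor
  · rintro ⟨y, hy, rfl, rfl⟩
    obtain ⟨z, hz, hzy⟩ := exists_extend he hne hy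
    exact ⟨z, hz, by simp only [← hsum, hzy], by simp only [← hsum', hzy]⟩
  · rintro ⟨z, hz, rfl, rfl⟩
    exact ⟨fun j => z (e j), fun j => hz _, hsum z, (hsum' z).symm⟩

open scoped Classical in
/-- The weights of the sum over `I`. -/
def weight (I : Finset ι) (i : ι) : ℝ := if i ∈ I then 1 else 0

lemma weight_nonneg (I : Finset ι) (i : ι) : 0 ≤ weight I i := by
  rw [weight]; split_ifs <;> norm_num

lemma weight_smul_sum (I : Finset ι) (y : ι → E) : ∑ i, weight I i • y i = ∑ i ∈ I, y i := by
  classical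
  simp [weight, ite_smul]

lemma weight_mul_sum (I : Finset ι) (y : ι → ℝ) : ∑ i, weight I i * y i = ∑ i ∈ I, y i := by
  classical
  simp [weight]

lemma weight_map {e : κ ↪ ι} (I : Finset κ) :
    (fun j => weight (I.map e) (e j)) = weight I := by
  classical
  ext j
  rw [weight, weight]
  exact if_congr (Finset.mem_map' e) rfl rfl

lemma weight_map_eq_zero {e : κ ↪ ι} (I : Finset κ) (i : ι) (hi : i ∉ Set.range e) :
    weight (I.map e) i = 0 := by
  rw [weight, if_neg]
  intro h
  obtain ⟨j, -, hj⟩ := Finset.mem_map.1 h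
  exact hi ⟨j, hj⟩

lemma exists_extend_finset {I : Finset ι} {K : ι → Set E}
    (hne : ∀ i, (K i).Nonempty) {y : ι → E} (hy : ∀ i ∈ I, y i ∈ K i) :
    ∃ z : ι → E, (∀ i, z i ∈ K i) ∧ ∀ i ∈ I, z i = y i := by
  classical
  choose q hq using hne
  refine ⟨fun i => if i ∈ I then y i else q i, fun i => ?_, fun i hi => if_pos hi⟩
  dsimp only
  split_ifs with h
  exacts [hy i h, hq i]

lemma sum_eq_wsum {K : ι → Set E} (hne : ∀ i, (K i).Nonempty) (I : Finset ι) :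
    ∑ i ∈ I, K i = wsum K (weight I) := by
  ext x
  rw [Set.mem_finsetSum]
  constructor
  · rintro ⟨y, hy, rfl⟩
    obtain ⟨z, hz, hzy⟩ := exists_extend_finset hne fun i hi => hy hi
    exact ⟨z, hz, by rw [weight_smul_sum]; exact Finset.sum_congr rfl hzy⟩
  · rintro ⟨z, hz, rfl⟩
    exact ⟨z, fun {i} _ => hz i, (weight_smul_sum I z).symm⟩

lemma supConv_eq_wfun {K : ι → Set E} (hne : ∀ i, (K i).Nonempty) (g : ι → E → ℝ) (I : Finset ι) :
    supConv I K g = wfun K g (weight I) := by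
  ext x
  rw [supConv, wfun]
  congr 1
  ext s
  constructor
  · rintro ⟨y, hy, rfl, rfl⟩
    obtain ⟨z, hz, hzy⟩ := exists_extend_finset hne hy
    refine ⟨z, hz, ?_, ?_⟩
    · rw [weight_smul_sum]; exact Finset.sum_congr rfl hzy
    · rw [weight_mul_sum]; exact Finset.sum_congr rfl fun i hi => by rw [hzy i hi]
  · rintro ⟨z, hz, rfl, rfl⟩
    exact ⟨z, fun i _ => hz i, (weight_smul_sum I z).symm, weight_mul_sum I _⟩

end Reindexing

/-! ### The derivative in one weight -/

section Slope

open Filter Topology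

variable {E : Type*} [NormedAddCommGroup E] [NormedSpace ℝ E] [FiniteDimensional ℝ E]
  {ι : Type*} [Fintype ι] [DecidableEq ι]

lemma sum_add_single_smul (l : ι → ℝ) (a : ι) (ε : ℝ) (y : ι → E) :
    ∑ i, (l + Pi.single a ε : ι → ℝ) i • y i = ∑ i, l i • y i + ε • y a := by
  simp [add_smul, Finset.sum_add_distrib, Pi.single_apply, ite_smul]

lemma sum_add_single_mul (l : ι → ℝ) (a : ι) (ε : ℝ) (y : ι → ℝ) :
    ∑ i, (l + Pi.single a ε : ι → ℝ) i * y i = ∑ i, l i * y i + ε * y a :=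
  sum_add_single_smul l a ε y

lemma sum_smul_update {l : ι → ℝ} {a : ι} (ha : l a = 0) (y : ι → E) (z : E) :
    ∑ i, l i • Function.update y a z i = ∑ i, l i • y i := by
  refine Finset.sum_congr rfl fun i _ => ?_
  rcases eq_or_ne i a with rfl | h
  · rw [ha, zero_smul, zero_smul]
  · rw [Function.update_of_ne h]

lemma update_mem {K : ι → Set E} {a : ι} {y : ι → E} (hy : ∀ i, y i ∈ K i) {z : E}
    (hz : z ∈ K a) (i : ι) : Function.update y a z i ∈ K i := by
  rcases eq_or_ne i a with rfl | h
  · rwa [Function.update_self]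
  · rw [Function.update_of_ne h]; exact hy i

lemma wsum_add_single (K : ι → Set E) {l : ι → ℝ} {a : ι} (ha : l a = 0) (ε : ℝ) :
    wsum K (l + Pi.single a ε) = wsum K l + ε • K a := by
  ext x
  rw [mem_add_smul_iff]
  constructor
  · rintro ⟨y, hy, rfl⟩
    exact ⟨_, ⟨y, hy, rfl⟩, y a, hy a, (sum_add_single_smul l a ε y).symm⟩
  · rintro ⟨_, ⟨y, hy, rfl⟩, z, hz, rfl⟩
    refine ⟨Function.update y a z, update_mem hy hz, ?_⟩
    rw [sum_add_single_smul, sum_smul_update ha, Function.update_self]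

lemma add_single_nonneg {l : ι → ℝ} (hl : ∀ i, 0 ≤ l i) (a : ι) {ε : ℝ} (hε : 0 ≤ ε) (i : ι) :
    0 ≤ (l + Pi.single a ε : ι → ℝ) i := by
  rw [Pi.add_apply, Pi.single_apply]
  split_ifs
  · exact add_nonneg (hl i) hε
  · simpa using hl i

variable {K : ι → Set E} {g : ι → E → ℝ}

/-- At weight zero the a-th summand affects neither the point nor the value, so it can be chosen
freely when weight ε is added at a. -/
lemma isDilation_wfun (hK : ∀ i, IsHPoly (id : E → E) ⊤ (K i)) (hne : ∀ i, (K i).Nonempty)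
    (hg : ∀ i, ContinuousOn (g i) (K i)) (hc : ∀ i, ConcaveOn ℝ (K i) (g i)) {l : ι → ℝ}
    (hl : ∀ i, 0 ≤ l i) {a : ι} (ha : l a = 0) :
    IsDilation (wsum K l) (wfun K g l) (K a) (g a) fun ε => wfun K g (l + Pi.single a ε) where
  le ε hε q hq z hz := by
    have hKc := fun i => (hK i).isCompact
    obtain ⟨y, hy, rfl, hye⟩ := exists_wfun_eq hKc hg hq
    have h := le_wfun hKc hg (l := l + Pi.single a ε) (update_mem hy hz)
    rw [sum_add_single_smul, sum_add_single_mul, sum_smul_update ha, Function.update_self] at h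
    rw [hye]
    refine (le_of_eq ?_).trans h
    congr 1
    refine Finset.sum_congr rfl fun i _ => ?_
    rcases eq_or_ne i a with rfl | h
    · rw [ha, zero_mul, zero_mul]
    · rw [Function.update_of_ne h]
  exists_eq ε hε x hx := by
    have hKc := fun i => (hK i).isCompact
    rw [← wsum_add_single K ha] at hx
    obtain ⟨y, hy, rfl, hye⟩ := exists_wfun_eq hKc hg hx
    rw [sum_add_single_mul] at hye
    refine ⟨∑ i, l i • y i, ⟨y, hy, rfl⟩, y a, hy a, (sum_add_single_smul l a ε y).symm,
      le_antisymm ?_ ?_⟩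
    · obtain ⟨y', hy', hyy, hye'⟩ := exists_wfun_eq hKc hg (l := l) ⟨y, hy, rfl⟩
      have h := le_wfun hKc hg (l := l + Pi.single a ε) (update_mem hy' (hy a))
      rw [sum_add_single_smul, sum_add_single_mul, sum_smul_update ha, Function.update_self,
        hyy, ← sum_add_single_smul] at h
      refine (le_of_eq ?_).trans h
      rw [hye']
      congr 1
      refine Finset.sum_congr rfl fun i _ => ?_
      rcases eq_or_ne i a with rfl | h
      · rw [ha, zero_mul, zero_mul]
      · rw [Function.update_of_ne h]
    · rw [hye]
      gcongr
      exact le_wfun hKc hg hy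
  cont ε hε := by
    rw [← wsum_add_single K ha]
    exact continuousOn_wfun hK hne hg hc (add_single_nonneg hl a hε)

lemma isDilationNormals_wsum (hK : ∀ i, IsCompact (K i)) (hne : ∀ i, (K i).Nonempty)
    {U : Finset (StrongDual ℝ E)} (hU : ∀ l : ι → ℝ, (∀ i, 0 ≤ l i) →
      wsum K l = {x | ∀ u ∈ U, ∑ i, l i * supportFun (K i) u ≤ u x}) {l : ι → ℝ}
    (hl : ∀ i, 0 ≤ l i) {a : ι} (ha : l a = 0) : IsDilationNormals U (wsum K l) (K a) := by
  intro ε hε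
  rw [← wsum_add_single K ha, hU _ (add_single_nonneg hl a hε)]
  simp only [sum_add_single_mul, supportFun_wsum hK hne hl]

variable [MeasurableSpace E] [BorelSpace E]

/-- The first variation of the integrals of sup-convolutions on rational polytopes. -/
theorem exists_normals_tendsto_slope (M : Submodule ℤ E) [DiscreteTopology M] [IsZLattice ℝ M]
    (hK : ∀ i, IsRationalPolytope M (K i)) (hne : ∀ i, (K i).Nonempty)
    (hg : ∀ i, ContinuousOn (g i) (K i)) (hc : ∀ i, ConcaveOn ℝ (K i) (g i)) :
    ∃ U₀ : Finset (StrongDual ℝ E), (∀ u ∈ U₀, IsPrimitive M u) ∧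
      ∀ U : Finset (StrongDual ℝ E), U₀ ⊆ U → (∀ u ∈ U, IsPrimitive M u) →
      ∀ l : ι → ℝ, (∀ i, 0 ≤ l i) → ∀ a, l a = 0 →
      ∀ p : StrongDual ℝ E → E, (∀ u ∈ U, p u ∈ face (wsum K l) u) →
      Tendsto (fun ε : ℝ => ε⁻¹ *
        ((∫ x in wsum K (l + Pi.single a ε), wfun K g (l + Pi.single a ε) x ∂latticeVolume M) -
          ∫ x in wsum K l, wfun K g l x ∂latticeVolume M)) (𝓝[>] 0)
        (𝓝 (-(∑ u ∈ U, supportFun (K a) u *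
            faceIntegral (latticeVolume (perpLattice M u)) (wsum K l) (p u) (wfun K g l))
          - ∫ x in wsum K l, legendre (K a) (g a) (fderiv ℝ (wfun K g l) x) ∂latticeVolume M)) := by
  obtain ⟨B, hBr, hB0⟩ := exists_isRationalPolytope_mem_nhds M
  have hspan : Submodule.span ℝ (M : Set E) = ⊤ := IsZLattice.span_top
  -- A neighbourhood B of the origin with the zero function is adjoined, as the divergence theorem
  -- needs one. Normals computed for the enlarged family also serve the sums with B; the original
  -- sums have weight 0 at B.
  let K' : Option ι → Set E := fun o => o.elim B K
  let g' : Option ι → E → ℝ := fun o => o.elim 0 g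
  have hK' : ∀ o, IsRationalPolytope M (K' o) := by rintro (_ | i); exacts [hBr, hK i]
  have hne' : ∀ o, (K' o).Nonempty := by
    rintro (_ | i); exacts [⟨0, mem_of_mem_nhds hB0⟩, hne i]
  have hg' : ∀ o, ContinuousOn (g' o) (K' o) := by
    rintro (_ | i); exacts [continuousOn_const, hg i]
  have hc' : ∀ o, ConcaveOn ℝ (K' o) (g' o) := by
    rintro (_ | i)
    exacts [concaveOn_const 0 hBr.isHPoly.convex, hc i]
  have hKc := fun i => (hK i).isHPoly.isCompact
  have hKc' := fun i => (hK' i).isHPoly.isCompact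
  obtain ⟨U₀, -, hU₀p, hU₀⟩ := exists_primitive_normals M hK' hne'
  refine ⟨U₀, hU₀p, fun U hUU hUp l hl a ha p hp => ?_⟩
  have hUn : IsNormalSystem U := ⟨fun u hu => (hUp u hu).2.1, fun u hu v hv c hc' h =>
    (hUp u hu).eq_of_eq_smul hspan (hUp v hv) hc' h⟩
  -- Further primitive normals are harmless: their inequalities hold on every weighted sum.
  have hU' : ∀ l : Option ι → ℝ, (∀ i, 0 ≤ l i) →
      wsum K' l = {x | ∀ u ∈ U, ∑ i, l i * supportFun (K' i) u ≤ u x} := fun l hl =>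
    Set.Subset.antisymm (fun x hx u _ => sum_supportFun_le (fun i => (hKc' i).isBounded) hl u hx)
      fun x hx => by
        rw [hU₀ l hl]
        exact fun u hu => hx u (hUU hu)
  have hext : ∀ l : ι → ℝ, ∀ i ∉ Set.range (some : ι → Option ι),
      (fun o : Option ι => o.elim 0 l) i = 0 := by
    rintro l (_ | i) hi
    · rfl
    · exact absurd ⟨i, rfl⟩ hi
  have hws : ∀ l : ι → ℝ, wsum K l = wsum K' fun o => o.elim 0 l := fun l =>
    wsum_comp (Option.some_injective ι) (K := K') hne' (hext l)
  have hwf : ∀ l : ι → ℝ, wfun K g l = wfun K' g' fun o => o.elim 0 l := fun l =>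
    wfun_comp (Option.some_injective ι) (K := K') g' hne' (hext l)
  have hU : ∀ l : ι → ℝ, (∀ i, 0 ≤ l i) →
      wsum K l = {x | ∀ u ∈ U, ∑ i, l i * supportFun (K i) u ≤ u x} := by
    intro l hl
    rw [hws, hU' _ (by rintro (_ | i); exacts [le_rfl, hl i])]
    simp only [Fintype.sum_option, Option.elim, zero_mul, zero_add, K']
  have hl' : ∀ o : Option ι, 0 ≤ (fun o : Option ι => o.elim 0 l) o := by
    rintro (_ | i); exacts [le_rfl, hl i]
  have hG' := isDilation_wfun (fun o => (hK' o).isHPoly) hne' hg' hc' hl' (a := none) rfl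
  have hUB := isDilationNormals_wsum hKc' hne' hU' hl' (a := none) rfl
  rw [← hws] at hG' hUB
  rw [← hwf] at hG'
  simp only [wsum_add_single K ha]
  exact (isDilation_wfun (fun i => (hK i).isHPoly) hne hg hc hl ha).tendsto_slope (latticeVolume M)
    (isCompact_wsum hKc l) (concaveOn_wfun hKc hg hc hl)
    (continuousOn_wfun (fun i => (hK i).isHPoly) hne hg hc hl) (hKc a) (hne a) (hg a) hUn
    (isDilationNormals_wsum hKc hne hU hl ha) (fun u => latticeVolume (perpLattice M u))
    (fun u hu => isDisintegration_latticeVolume M (hUp u hu)) hp (hKc' none) hB0 (hg' none) hG' hUB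

end Slope

/-! ### Functions with vanishing higher differences -/

section Differences

open Filter Topology

lemma sum_powerset_map {α β : Type*} (e : α ↪ β) (s : Finset α) (f : Finset β → ℝ) :
    ∑ I ∈ (s.map e).powerset, f I = ∑ I ∈ s.powerset, f (I.map e) := by
  classical
  have h : (s.map e).powerset = s.powerset.map (Finset.mapEmbedding e).toEmbedding := by
    ext t
    simp only [Finset.mem_powerset, Finset.subset_map_iff, Finset.mem_map]
    constructor
    · rintro ⟨u, hu, rfl⟩
      exact ⟨u, hu, rfl⟩
    · rintro ⟨u, hu, rfl⟩
      exact ⟨u, hu, rfl⟩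
  rw [h, Finset.sum_map]
  rfl

lemma sum_single_eq_weight {n : ℕ} (I : Finset (Fin n)) :
    ∑ j ∈ I, (Pi.single j.succ 1 : Fin (n + 1) → ℝ) = weight (I.map (Fin.succEmb n)) := by
  ext i
  rw [Finset.sum_apply, weight]
  simp only [Pi.single_apply]
  split_ifs with h
  · obtain ⟨j, hj, rfl⟩ := Finset.mem_map.1 h
    rw [Finset.sum_eq_single j]
    · simp
    · intro k _ hkj
      rw [if_neg]
      simpa using hkj.symm
    · exact fun h => absurd hj h
  · refine Finset.sum_eq_zero fun j hj => if_neg ?_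
    rintro rfl
    exact h (Finset.mem_map_of_mem (Fin.succEmb n) hj)

lemma weight_insert_zero {n : ℕ} (I : Finset (Fin n)) :
    weight (insert 0 (I.map (Fin.succEmb n))) =
      weight (I.map (Fin.succEmb n)) + (Pi.single 0 1 : Fin (n + 1) → ℝ) := by
  ext i
  rw [Pi.add_apply]
  refine Fin.cases ?_ (fun j => ?_) i
  · simp [weight]
  · simp [weight]

lemma sum_univ_finset_succ {n : ℕ} (F : Finset (Fin (n + 1)) → ℝ) :
    ∑ I, F I = ∑ I : Finset (Fin n), F (I.map (Fin.succEmb n)) +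
      ∑ I : Finset (Fin n), F (insert 0 (I.map (Fin.succEmb n))) := by
  have h : (Finset.univ : Finset (Fin (n + 1))) =
      insert 0 (Finset.univ.map (Fin.succEmb n)) := by
    rw [Fin.univ_succ, Finset.cons_eq_insert]; rfl
  have h0 : (0 : Fin (n + 1)) ∉ Finset.univ.map (Fin.succEmb n) := by simp
  rw [← Finset.powerset_univ, h, Finset.sum_powerset_insert h0, sum_powerset_map,
    sum_powerset_map (f := fun I => F (insert 0 I)), Finset.powerset_univ]

/-- A polynomial-like function of degree at most `n + 1` is determined by a first derivative of its
mixed differences. -/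
lemma sum_weight_eq_of_slopes {n : ℕ} {F : (Fin (n + 1) → ℝ) → ℝ}
    (hF : ∀ (s : Finset (Option (Fin (n + 1)))) (d : Option (Fin (n + 1)) → Fin (n + 1) → ℝ)
      (l : Fin (n + 1) → ℝ), (∀ j i, 0 ≤ d j i) → (∀ i, 0 ≤ l i) → n + 1 < s.card →
      ∑ I ∈ s.powerset, (-1 : ℝ) ^ I.card * F (l + ∑ j ∈ I, d j) = 0)
    {W : Finset (Fin n) → ℝ}
    (hW : ∀ I : Finset (Fin n), Tendsto (fun ε : ℝ => ε⁻¹ *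
      (F (weight (I.map (Fin.succEmb n)) + Pi.single 0 ε) - F (weight (I.map (Fin.succEmb n)))))
      (𝓝[>] 0) (𝓝 (W I))) :
    ∑ I, (-1 : ℝ) ^ I.card * F (weight I) = -∑ I, (-1 : ℝ) ^ I.card * W I := by
  set A : ℝ → ℝ := fun t => ∑ I : Finset (Fin n),
    (-1 : ℝ) ^ I.card * F (weight (I.map (Fin.succEmb n)) + Pi.single 0 t) with hA
  have hnn : ∀ {t : ℝ}, 0 ≤ t → ∀ i j : Fin (n + 1), 0 ≤ (Pi.single i t : Fin (n + 1) → ℝ) j := by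
    intro t ht i j
    rw [Pi.single_apply]
    split_ifs
    exacts [ht, le_rfl]
  -- The second difference of A with step δ is a mixed difference of F of order n + 2: one unit step
  -- in each of the n directions other than 0, and two steps of length δ in direction 0, indexed by
  -- `none` and `some 0`.
  have hstep : ∀ t δ : ℝ, 0 ≤ t → 0 ≤ δ → A t + A (t + δ + δ) = 2 * A (t + δ) := by
    intro t δ ht hδ
    let d : Option (Fin (n + 1)) → Fin (n + 1) → ℝ := fun o =>
      o.elim (Pi.single 0 δ) fun i => if i = 0 then Pi.single 0 δ else Pi.single i 1
    let e : Fin n ↪ Option (Fin (n + 1)) := (Fin.succEmb n).trans Function.Embedding.some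
    have h1 : (some 0 : Option (Fin (n + 1))) ∉ Finset.univ.map e := by simp [e]
    have h2 : (none : Option (Fin (n + 1))) ∉ insert (some 0) (Finset.univ.map e) := by simp [e]
    have h := hF (insert none (insert (some 0) (Finset.univ.map e))) d (Pi.single 0 t) ?_
      (hnn ht 0) ?_
    · have m1 : ∀ I : Finset (Fin n), (some 0 : Option (Fin (n + 1))) ∉ I.map e := fun I => by
        simp [e]
      have m2 : ∀ I : Finset (Fin n), (none : Option (Fin (n + 1))) ∉ I.map e := fun I => by
        simp [e]
      have m3 : ∀ I : Finset (Fin n), (none : Option (Fin (n + 1))) ∉ insert (some 0) (I.map e) :=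
        fun I => by simp [e]
      have hd : ∀ I : Finset (Fin n), ∑ j ∈ I.map e, d j = weight (I.map (Fin.succEmb n)) := by
        intro I
        rw [Finset.sum_map, ← sum_single_eq_weight]
        refine Finset.sum_congr rfl fun j _ => ?_
        simp [d, e]
      have d0 : d none = Pi.single 0 δ := rfl
      have d1 : d (some 0) = Pi.single 0 δ := by simp [d]
      have s1 : ∀ a b : ℝ, (Pi.single 0 (a + b) : Fin (n + 1) → ℝ) = Pi.single 0 a + Pi.single 0 b :=
        fun a b => by
          ext i
          rw [Pi.add_apply, Pi.single_apply, Pi.single_apply, Pi.single_apply]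
          split_ifs <;> simp
      rw [Finset.sum_powerset_insert h2, Finset.sum_powerset_insert h1,
        Finset.sum_powerset_insert h1] at h
      simp only [sum_powerset_map, Finset.powerset_univ] at h
      simp only [Finset.card_insert_of_notMem (m1 _), Finset.card_insert_of_notMem (m2 _),
        Finset.card_insert_of_notMem (m3 _), Finset.sum_insert (m1 _), Finset.sum_insert (m2 _),
        Finset.sum_insert (m3 _), Finset.card_map, hd, d0, d1, pow_succ] at h
      have a0 : A t = ∑ I : Finset (Fin n), (-1 : ℝ) ^ I.card *
          F (Pi.single 0 t + weight (I.map (Fin.succEmb n))) := by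
        simp only [hA, add_comm]
      have a1 : A (t + δ) = ∑ I : Finset (Fin n), (-1 : ℝ) ^ I.card *
          F (Pi.single 0 t + (Pi.single 0 δ + weight (I.map (Fin.succEmb n)))) := by
        simp only [hA, s1, add_comm, add_left_comm]
      have a2 : A (t + δ + δ) = ∑ I : Finset (Fin n), (-1 : ℝ) ^ I.card *
          F (Pi.single 0 t + (Pi.single 0 δ + (Pi.single 0 δ + weight (I.map (Fin.succEmb n))))) := by
        simp only [hA, s1, add_comm, add_left_comm]
      rw [a0, a1, a2]
      simp only [mul_neg, mul_one, neg_mul, neg_neg, Finset.sum_neg_distrib] at h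
      linarith
    · rintro (_ | i) j
      · exact hnn hδ 0 j
      · simp only [d, Option.elim]
        split_ifs
        exacts [hnn hδ 0 j, hnn zero_le_one i j]
    · rw [Finset.card_insert_of_notMem h2, Finset.card_insert_of_notMem h1, Finset.card_map]
      simp
  -- Two consecutive values are carried along because the recursion has order two.
  have hlin : ∀ δ : ℝ, 0 ≤ δ → ∀ k : ℕ, A (k * δ) = A 0 + k * (A δ - A 0) ∧
      A ((k + 1 : ℕ) * δ) = A 0 + (k + 1 : ℕ) * (A δ - A 0) := by
    intro δ hδ k
    induction k with
    | zero => simp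
    | succ k ih =>
      refine ⟨ih.2, ?_⟩
      have h := hstep (k * δ) δ (by positivity) hδ
      have h1 : (k : ℝ) * δ + δ = (k + 1 : ℕ) * δ := by push_cast; ring
      have h2 : ((k + 1 : ℕ) : ℝ) * δ + δ = (k + 1 + 1 : ℕ) * δ := by push_cast; ring
      rw [h1, h2, ih.1, ih.2] at h
      push_cast at h ⊢
      linarith
  have hlim : Tendsto (fun ε : ℝ => ε⁻¹ * (A ε - A 0)) (𝓝[>] 0)
      (𝓝 (∑ I, (-1 : ℝ) ^ I.card * W I)) := by
    refine (tendsto_finsetSum Finset.univ fun I _ => (hW I).const_mul ((-1 : ℝ) ^ I.card)).congr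
      fun ε => ?_
    simp only [hA, Pi.single_zero, add_zero, ← Finset.sum_sub_distrib, Finset.mul_sum]
    exact Finset.sum_congr rfl fun I _ => by ring
  have hseq : Tendsto (fun k : ℕ => 1 / ((k : ℝ) + 1)) atTop (𝓝[>] 0) :=
    tendsto_nhdsWithin_iff.2 ⟨tendsto_one_div_add_atTop_nhds_zero_nat,
      Eventually.of_forall fun k => Set.mem_Ioi.2 (by positivity)⟩
  -- For ε = 1 / (k + 1) the difference quotient is exactly A(1) - A(0), so no continuity of A is
  -- needed.
  have hA1 : A 1 - A 0 = ∑ I, (-1 : ℝ) ^ I.card * W I := by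
    refine tendsto_nhds_unique (tendsto_const_nhds (f := atTop (α := ℕ)))
      ((hlim.comp hseq).congr fun k => ?_)
    have h := (hlin (1 / ((k : ℝ) + 1)) (by positivity) k).2
    have h1 : ((k + 1 : ℕ) : ℝ) * (1 / ((k : ℝ) + 1)) = 1 := by
      push_cast; field_simp
    rw [h1] at h
    rw [h, Function.comp_apply]
    push_cast
    field_simp
    ring
  have h0 : ∀ I : Finset (Fin n), (0 : Fin (n + 1)) ∉ I.map (Fin.succEmb n) := fun I => by simp
  rw [sum_univ_finset_succ, ← hA1]
  simp only [Finset.card_insert_of_notMem (h0 _), Finset.card_map, weight_insert_zero, pow_succ,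
    hA, Pi.single_zero, add_zero, mul_neg, mul_one, neg_mul, Finset.sum_neg_distrib]
  ring

end Differences

/-! ### Mixed integrals as sums over all index sets -/

section MixedIntegral

open Filter Topology

variable {E : Type*} [NormedAddCommGroup E] [NormedSpace ℝ E] [MeasurableSpace E]
  {ι : Type*} [Fintype ι]

lemma neg_one_pow_card_sub (I : Finset ι) :
    (-1 : ℝ) ^ (Fintype.card ι - I.card) = (-1) ^ Fintype.card ι * (-1) ^ I.card := by
  have h := Finset.card_le_univ I
  obtain ⟨k, hk⟩ := Nat.exists_eq_add_of_le h
  rw [hk, Nat.add_sub_cancel_left, pow_add, mul_comm, ← mul_assoc, ← mul_pow]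
  simp

/-- The sign splits off, and the empty set may be included because its term is zero. Sums over all
subsets are easier to reindex. -/
lemma sum_nonempty_eq (f : Finset ι → ℝ) (h0 : f ∅ = 0) :
    ∑ I : Finset ι with I.Nonempty, (-1 : ℝ) ^ (Fintype.card ι - I.card) * f I =
      (-1) ^ Fintype.card ι * ∑ I, (-1) ^ I.card * f I := by
  classical
  rw [Finset.sum_filter, Finset.mul_sum]
  refine Finset.sum_congr rfl fun I _ => ?_
  split_ifs with h
  · rw [neg_one_pow_card_sub, mul_assoc]
  · rw [Finset.not_nonempty_iff_eq_empty.1 h, h0]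
    simp

lemma mixedIntegral_eq (μ : Measure E) {K : ι → Set E} (hne : ∀ i, (K i).Nonempty)
    (g : ι → E → ℝ) : mixedIntegral μ K g = (-1) ^ Fintype.card ι *
      ∑ I, (-1) ^ I.card * ∫ x in wsum K (weight I), wfun K g (weight I) x ∂μ := by
  rw [mixedIntegral, sum_nonempty_eq (fun I => ∫ x in ∑ i ∈ I, K i, supConv I K g x ∂μ)]
  · simp only [sum_eq_wsum hne, supConv_eq_wfun hne]
  -- The empty sup-convolution is the function 0 on the point 0. Its integral vanishes even when
  -- that point has positive mass, as in the zero-dimensional kernels that occur for n = 1.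
  · refine setIntegral_eq_zero_of_forall_eq_zero fun x hx => ?_
    rw [Finset.sum_empty, Set.mem_zero] at hx
    have : {s : ℝ | ∃ x' : ι → E, (∀ i ∈ (∅ : Finset ι), x' i ∈ K i) ∧
        ∑ i ∈ (∅ : Finset ι), x' i = x ∧ s = ∑ i ∈ (∅ : Finset ι), g i (x' i)} = {0} := by
      ext s
      simp [hx]
    rw [supConv, this, csSup_singleton]

variable [BorelSpace E]

lemma isCompact_preimage_face {C : Set E} (hC : IsCompact C) (u : StrongDual ℝ E) (p : E) :
    IsCompact {y : u.ker | p + (y : E) ∈ face C u} := by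
  have h : IsCompact (face C u) := hC.of_isClosed_subset (isClosed_face hC u) fun x hx => hx.1
  have he : Topology.IsClosedEmbedding fun y : u.ker => p + (y : E) :=
    (Homeomorph.addLeft p).isClosedEmbedding.comp
      (ContinuousLinearMap.isClosed_ker u).isClosedEmbedding_subtypeVal
  exact he.isCompact_preimage h

/-- The sup-convolution on a face of a sum is the sup-convolution of the restrictions to the
faces. -/
lemma faceIntegral_wsum {K : ι → Set E} {g : ι → E → ℝ} (hK : ∀ i, IsCompact (K i))
    (hg : ∀ i, ContinuousOn (g i) (K i)) {l : ι → ℝ}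
    (hl : ∀ i, 0 ≤ l i) {u : StrongDual ℝ E} (ν : Measure u.ker) {q : ι → E}
    (hq : ∀ i, q i ∈ face (K i) u) :
    faceIntegral ν (wsum K l) (∑ i, l i • q i) (wfun K g l) =
      ∫ y in wsum (fun i => {y : u.ker | q i + (y : E) ∈ face (K i) u}) l,
        wfun (fun i => {y : u.ker | q i + (y : E) ∈ face (K i) u})
          (fun i y => g i (q i + y)) l y ∂ν := by
  have hne : ∀ i, (K i).Nonempty := fun i => ⟨q i, (hq i).1⟩
  rw [faceIntegral, face_wsum_translate hK hne hl hq]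
  set K' : ι → Set u.ker := fun i => {y : u.ker | q i + (y : E) ∈ face (K i) u}
  have hK' : ∀ i, IsCompact (K' i) := fun i => isCompact_preimage_face (hK i) u (q i)
  have hg' : ∀ i, ContinuousOn (fun y : u.ker => g i (q i + y)) (K' i) := fun i =>
    (hg i).comp (by fun_prop) fun y hy => hy.1
  refine setIntegral_congr_fun (isCompact_wsum hK' l).isClosed.measurableSet fun y hy => ?_
  have hyf : ∑ i, l i • q i + (y : E) ∈ face (wsum K l) u := by
    have : y ∈ wsum K' l := hy
    rwa [← face_wsum_translate hK hne hl hq] at this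
  refine le_antisymm ?_ ?_
  · obtain ⟨z, hz, hzy, he⟩ := exists_wfun_eq hK hg hyf.1
    have hzf := fun i => mem_face_of_sum_mem_face hK hne hl hz (hzy.symm ▸ hyf) i
    have hker : ∀ i, ∃ w : u.ker, w ∈ K' i ∧ l i • (q i + (w : E)) = l i • z i ∧
        l i * g i (q i + w) = l i * g i (z i) := by
      intro i
      by_cases h0 : l i = 0
      -- A summand of weight zero may lie off its face; it is replaced by the base point.
      · exact ⟨0, by simpa [K'] using hq i, by simp [h0], by simp [h0]⟩
      · have h1 := ((mem_face_iff (hK i).isBounded).1 (hzf i h0)).2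
        have h2 := ((mem_face_iff (hK i).isBounded).1 (hq i)).2
        have h3 : z i - q i ∈ u.ker := by
          change u (z i - q i) = 0
          rw [map_sub, h1, h2, sub_self]
        exact ⟨⟨z i - q i, h3⟩, by simpa [K'] using hzf i h0, by simp, by simp⟩
    choose w hw hw1 hw2 using hker
    have hwy : ∑ i, l i • w i = y := by
      refine Subtype.ext ?_
      have h4 : ∑ i, l i • (q i + (w i : E)) = ∑ i, l i • q i + (y : E) := by
        rw [← hzy]
        exact Finset.sum_congr rfl fun i _ => hw1 i
      simp only [smul_add, Finset.sum_add_distrib, add_right_inj] at h4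
      rw [← h4]
      simp
    rw [he, ← Finset.sum_congr rfl fun i _ => hw2 i, ← hwy]
    exact le_wfun hK' hg' hw
  · obtain ⟨w, hw, hwy, he⟩ := exists_wfun_eq hK' hg' hy
    rw [he]
    have h4 : ∑ i, l i • (q i + (w i : E)) = ∑ i, l i • q i + (y : E) := by
      rw [← hwy]
      simp [smul_add, Finset.sum_add_distrib]
    rw [← h4]
    exact le_wfun hK hg fun i => (hw i).1

lemma faceMixedIntegral_eq [FiniteDimensional ℝ E] (M : Submodule ℤ E) {K : ι → Set E}
    {g : ι → E → ℝ} (hK : ∀ i, IsCompact (K i)) (hg : ∀ i, ContinuousOn (g i) (K i))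
    {u : StrongDual ℝ E} {q : ι → E} (hq : ∀ i, q i ∈ face (K i) u) :
    faceMixedIntegral M u q K g = (-1) ^ Fintype.card ι *
      ∑ I, (-1) ^ I.card * faceIntegral (latticeVolume (perpLattice M u)) (wsum K (weight I))
        (∑ i, weight I i • q i) (wfun K g (weight I)) := by
  rw [faceMixedIntegral, mixedIntegral_eq _ fun i => ⟨0, by simpa using hq i⟩]
  simp only [faceIntegral_wsum hK hg (weight_nonneg _) _ hq]

end MixedIntegral

/-! ### Integrals with respect to mixed Monge-Ampère measures -/

section MixedMongeAmpere

variable {E : Type*} [NormedAddCommGroup E] [NormedSpace ℝ E] {ι : Type*} [Fintype ι]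
  {K : ι → Set E} {g : ι → E → ℝ}

lemma sum_legendre_le (hK : ∀ i, IsCompact (K i)) (hg : ∀ i, ContinuousOn (g i) (K i)) {l : ι → ℝ}
    (hl : ∀ i, 0 ≤ l i) (v : StrongDual ℝ E) {x : E} (hx : x ∈ wsum K l) :
    ∑ i, l i * legendre (K i) (g i) v ≤ v x - wfun K g l x := by
  obtain ⟨y, hy, rfl, he⟩ := exists_wfun_eq hK hg hx
  rw [he, map_sum, ← Finset.sum_sub_distrib]
  refine Finset.sum_le_sum fun i _ => ?_
  rw [map_smul, smul_eq_mul, ← mul_sub]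
  exact mul_le_mul_of_nonneg_left (legendre_le (hK i) (hg i) v (hy i)) (hl i)

/-- The Legendre-Fenchel dual turns sup-convolutions into sums. -/
lemma legendre_wsum (hK : ∀ i, IsCompact (K i)) (hne : ∀ i, (K i).Nonempty)
    (hg : ∀ i, ContinuousOn (g i) (K i)) {l : ι → ℝ} (hl : ∀ i, 0 ≤ l i) (v : StrongDual ℝ E) :
    legendre (wsum K l) (wfun K g l) v = ∑ i, l i * legendre (K i) (g i) v := by
  refine le_antisymm ?_ (le_legendre (wsum_nonempty hne l) fun x hx => sum_legendre_le hK hg hl v hx)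
  choose y hy hye using fun i => exists_legendre_eq (hK i) (hne i) (hg i) v
  have h1 : legendre (wsum K l) (wfun K g l) v ≤ v (∑ i, l i • y i) - wfun K g l (∑ i, l i • y i) :=
    csInf_le ⟨_, by rintro _ ⟨x, hx, rfl⟩; exact sum_legendre_le hK hg hl v hx⟩
      ⟨_, ⟨y, hy, rfl⟩, rfl⟩
  have h2 := le_wfun hK hg (l := l) hy
  refine (h1.trans (sub_le_sub_left h2 _)).trans_eq ?_
  rw [map_sum, ← Finset.sum_sub_distrib]
  refine Finset.sum_congr rfl fun i _ => ?_
  rw [map_smul, smul_eq_mul, ← mul_sub, hye]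

lemma sum_legendre_eq (hK : ∀ i, IsCompact (K i)) (hne : ∀ i, (K i).Nonempty)
    (hg : ∀ i, ContinuousOn (g i) (K i)) (I : Finset ι) :
    ∑ i ∈ I, legendre (K i) (g i) = legendre (wsum K (weight I)) (wfun K g (weight I)) := by
  ext v
  rw [legendre_wsum hK hne hg (weight_nonneg I), weight_mul_sum, Finset.sum_apply]

variable [FiniteDimensional ℝ E] [MeasurableSpace E] [BorelSpace E]

/-- The integrand is arbitrary here, so the empty term vanishes only because a point is null in
positive dimension. -/
lemma setIntegral_wsum_empty [Nontrivial E] (μ : Measure E) [μ.IsAddHaarMeasure] (K : ι → Set E)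
    (f : E → ℝ) : ∫ x in wsum K (weight ∅), f x ∂μ = 0 := by
  refine setIntegral_measure_zero f (measure_mono_null (t := {0}) ?_ (measure_singleton 0))
  rintro _ ⟨y, -, rfl⟩
  rw [weight_smul_sum, Finset.sum_empty]
  rfl

/-- The integral of a Lipschitz function with respect to a mixed Monge-Ampère measure. -/
theorem integral_mixedMongeAmpere [Nontrivial E] (μ : Measure E) [μ.IsAddHaarMeasure]
    (hK : ∀ i, IsHPoly (id : E → E) ⊤ (K i)) (hne : ∀ i, (K i).Nonempty)
    (hg : ∀ i, ContinuousOn (g i) (K i)) (hc : ∀ i, ConcaveOn ℝ (K i) (g i)) {C : ℝ≥0}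
    {f : StrongDual ℝ E → ℝ} (hf : LipschitzWith C f) :
    (mixedMongeAmpere μ fun i => legendre (K i) (g i)).Integrable f ∧
    ∫ᵛ v, f v ∂•(mixedMongeAmpere μ fun i => legendre (K i) (g i)) =
      (-1) ^ Fintype.card ι * ∑ I, (-1) ^ I.card *
        ∫ x in wsum K (weight I), f (fderiv ℝ (wfun K g (weight I)) x) ∂μ := by
  have hKc := fun i => (hK i).isCompact
  have hconc := fun I : Finset ι => concaveOn_wfun hKc hg hc (weight_nonneg I)
  have hcont := fun I : Finset ι => continuousOn_wfun hK hne hg hc (weight_nonneg I)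
  have hcpt := fun I : Finset ι => isCompact_wsum hKc (weight I)
  have hmeas := fun I : Finset ι => measurable_fderiv ℝ (wfun K g (weight I))
  let m : Finset ι → Measure (StrongDual ℝ E) := fun I =>
    (μ.restrict (wsum K (weight I))).map (fderiv ℝ (wfun K g (weight I)))
  -- The sum of the duals over I is the dual of the sup-convolution, whose Monge-Ampère measure is
  -- the image of `μ` under its gradient.
  have hm : ∀ I : Finset ι, mongeAmpere μ (∑ i ∈ I, legendre (K i) (g i)) = m I := fun I => by
    rw [sum_legendre_eq hKc hne hg, mongeAmpere_legendre μ (hcpt I) (wsum_nonempty hne _) (hconc I)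
      (hcont I)]
  have hfin : ∀ I, IsFiniteMeasure (m I) := fun I => by
    have : IsFiniteMeasure (μ.restrict (wsum K (weight I))) :=
      ⟨by rw [Measure.restrict_apply_univ]; exact (hcpt I).measure_lt_top⟩
    infer_instance
  have hts : ∀ I, toSigned (m I) = (m I).toSignedMeasure := fun I => dif_pos (hfin I)
  have hint : ∀ I, (m I).toSignedMeasure.Integrable f := fun I => by
    rw [VectorMeasure.Integrable, Measure.variation_toSignedMeasure,
      integrable_map_measure hf.continuous.aestronglyMeasurable (hmeas I).aemeasurable]
    exact integrableOn_comp_fderiv μ (hcpt I) (hconc I) (hcont I) hf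
  simp only [mixedMongeAmpere, hm, hts]
  have hint' : ∀ I ∈ Finset.univ.filter (fun I : Finset ι => I.Nonempty),
      ((-1 : ℝ) ^ (Fintype.card ι - I.card) • (m I).toSignedMeasure).Integrable f :=
    fun I _ => (hint I).smul_vectorMeasure _
  refine ⟨VectorMeasure.Integrable.finsetSum_vectorMeasure hint', ?_⟩
  rw [VectorMeasure.integral_finsetSum_vectorMeasure hint',
    ← sum_nonempty_eq (fun I => ∫ x in wsum K (weight I), f (fderiv ℝ (wfun K g (weight I)) x) ∂μ)
      (setIntegral_wsum_empty μ K _)]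
  refine Finset.sum_congr rfl fun I _ => ?_
  rw [VectorMeasure.integral_smul_vectorMeasure, smul_eq_mul]
  congr 1
  -- Multiplication on ℝ is symmetric, so the order in which the bilinear pairing takes its
  -- arguments does not matter.
  have hflip : (ContinuousLinearMap.lsmul ℝ ℝ : ℝ →L[ℝ] ℝ →L[ℝ] ℝ) =
      (ContinuousLinearMap.lsmul ℝ ℝ).flip := by
    ext; simp
  rw [hflip, VectorMeasure.integral_toSignedMeasure,
    integral_map (hmeas I).aemeasurable hf.continuous.aestronglyMeasurable]

end MixedMongeAmpere

/-! ### The formula for the mixed integral -/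

section Formula

open Filter Topology

variable {E : Type*} [NormedAddCommGroup E] [NormedSpace ℝ E] [FiniteDimensional ℝ E]
  [MeasurableSpace E] [BorelSpace E]

/-- The mixed integral in terms of boundary terms and of the mixed Monge-Ampère measure. -/
theorem mixedIntegral_eq_sub (M : Submodule ℤ E) [DiscreteTopology M] [IsZLattice ℝ M] (n : ℕ)
    (hdim : Module.finrank ℝ E = n) {Q : Fin (n + 1) → Set E} {g : Fin (n + 1) → E → ℝ}
    (hQ : ∀ i, IsRationalPolytope M (Q i)) (hne : ∀ i, (Q i).Nonempty)
    (hc : ∀ i, ConcaveOn ℝ (Q i) (g i)) (hg : ∀ i, ContinuousOn (g i) (Q i))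
    (p : {u : StrongDual ℝ E // IsPrimitive M u} → Fin n → E)
    (hp : ∀ (u : {u : StrongDual ℝ E // IsPrimitive M u}) (i : Fin n), p u i ∈ face (Q (Fin.succ i)) u) :
    (Function.support fun u : {u : StrongDual ℝ E // IsPrimitive M u} =>
      supportFun (Q 0) u * faceMixedIntegral M u (p u) (fun i => Q (Fin.succ i))
        (fun i => g (Fin.succ i))).Finite ∧
    mixedIntegral (latticeVolume M) Q g =
      -(∑ᶠ u : {u : StrongDual ℝ E // IsPrimitive M u}, supportFun (Q 0) u *
          faceMixedIntegral M u (p u) (fun i => Q (Fin.succ i)) (fun i => g (Fin.succ i)))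
      - (-1) ^ n * ∑ I : Finset (Fin n), (-1) ^ I.card *
          ∫ x in wsum (fun i => Q (Fin.succ i)) (weight I), legendre (Q 0) (g 0)
            (fderiv ℝ (wfun (fun i => Q (Fin.succ i)) (fun i => g (Fin.succ i)) (weight I)) x)
            ∂latticeVolume M := by
  classical
  set K : Fin n → Set E := fun i => Q (Fin.succ i)
  set h : Fin n → E → ℝ := fun i => g (Fin.succ i)
  set μ := latticeVolume M
  have hKc : ∀ i, IsCompact (K i) := fun i => (hQ _).isHPoly.isCompact
  have hKne : ∀ i, (K i).Nonempty := fun i => hne _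
  have hhg : ∀ i, ContinuousOn (h i) (K i) := fun i => hg _
  have hws : ∀ I : Finset (Fin n), wsum K (weight I) = wsum Q (weight (I.map (Fin.succEmb n))) :=
    fun I => by
      rw [← weight_map (e := Fin.succEmb n)]
      exact wsum_comp (Fin.succEmb n).injective hne (weight_map_eq_zero I)
  have hwf : ∀ I : Finset (Fin n), wfun K h (weight I) =
      wfun Q g (weight (I.map (Fin.succEmb n))) := fun I => by
      rw [← weight_map (e := Fin.succEmb n)]
      exact wfun_comp (Fin.succEmb n).injective g hne (weight_map_eq_zero I)
  -- boundary contributions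
  let T : Finset (Fin n) → {u : StrongDual ℝ E // IsPrimitive M u} → ℝ := fun I u =>
    supportFun (Q 0) u * faceIntegral (latticeVolume (perpLattice M u)) (wsum K (weight I))
      (∑ i, weight I i • p u i) (wfun K h (weight I))
  have hface : ∀ u : {u : StrongDual ℝ E // IsPrimitive M u},
      supportFun (Q 0) u * faceMixedIntegral M u (p u) K h =
        (-1) ^ n * ∑ I, (-1) ^ I.card * T I u := fun u => by
    rw [faceMixedIntegral_eq M hKc hhg (hp u), Fintype.card_fin, mul_left_comm, Finset.mul_sum]
    congr 1
    exact Finset.sum_congr rfl fun I _ => mul_left_comm _ _ _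
  obtain ⟨U₀, hU₀p, hU₀⟩ := exists_normals_tendsto_slope M hQ hne hg hc
  let W : Finset (Fin n) → ℝ := fun I =>
    ∫ x in wsum K (weight I), legendre (Q 0) (g 0) (fderiv ℝ (wfun K h (weight I)) x) ∂μ
  -- The freedom to take any finite U containing U₀ is what later isolates a single boundary term.
  have hslope : ∀ U : Finset {u : StrongDual ℝ E // IsPrimitive M u},
      U₀ ⊆ U.map (Function.Embedding.subtype _) → ∀ I : Finset (Fin n),
      Tendsto (fun ε : ℝ => ε⁻¹ *
        ((∫ x in wsum Q (weight (I.map (Fin.succEmb n)) + Pi.single 0 ε),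
            wfun Q g (weight (I.map (Fin.succEmb n)) + Pi.single 0 ε) x ∂μ) -
          ∫ x in wsum Q (weight (I.map (Fin.succEmb n))),
            wfun Q g (weight (I.map (Fin.succEmb n))) x ∂μ)) (𝓝[>] 0)
        (𝓝 (-(∑ u ∈ U, T I u) - W I)) := by
    intro U hU I
    have hP : ∀ u ∈ U.map (Function.Embedding.subtype _), IsPrimitive M u := fun u hu => by
      obtain ⟨v, -, rfl⟩ := Finset.mem_map.1 hu
      exact v.2
    have h1 := hU₀ _ hU hP (weight (I.map (Fin.succEmb n))) (weight_nonneg _) 0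
      (weight_map_eq_zero I 0 (by simp))
      (fun u => if hu : IsPrimitive M u then ∑ i, weight I i • p ⟨u, hu⟩ i else 0)
      (fun u hu => by
        rw [dif_pos (hP u hu), ← hws]
        exact sum_mem_face hKc hKne (weight_nonneg I) fun i => hp ⟨u, hP u hu⟩ i)
    convert h1 using 3
    · rw [Finset.sum_map]
      congr 1
      refine Finset.sum_congr rfl fun u _ => ?_
      change T I u = supportFun (Q 0) u * faceIntegral (latticeVolume (perpLattice M u))
        (wsum Q (weight (I.map (Fin.succEmb n))))
        (if hu : IsPrimitive M u then ∑ i, weight I i • p ⟨u, hu⟩ i else 0)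
        (wfun Q g (weight (I.map (Fin.succEmb n))))
      rw [dif_pos u.2, ← hws, ← hwf]
    · simp only [W, hws, hwf, μ]
  let V : Finset {u : StrongDual ℝ E // IsPrimitive M u} := U₀.subtype _
  have hV : U₀ ⊆ V.map (Function.Embedding.subtype _) := fun u hu =>
    Finset.mem_map.2 ⟨⟨u, hU₀p u hu⟩, by simpa [V] using hu, rfl⟩
  -- Adding one normal to the finite set does not change the limit, so the boundary term it
  -- contributes is zero. This yields finiteness of the support without examining the faces.
  have hzero : ∀ u ∉ V, ∀ I, T I u = 0 := by
    intro u hu I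
    have h1 := tendsto_nhds_unique (hslope V hV I) (hslope (insert u V)
      (hV.trans (Finset.map_subset_map.2 (Finset.subset_insert u V))) I)
    rw [Finset.sum_insert hu] at h1
    linarith
  have hsupp : (Function.support fun u : {u : StrongDual ℝ E // IsPrimitive M u} =>
      supportFun (Q 0) u * faceMixedIntegral M u (p u) K h) ⊆ V := by
    intro u hu
    by_contra hcon
    refine hu ?_
    dsimp only
    rw [hface, Finset.sum_eq_zero fun I _ => by rw [hzero u hcon I, mul_zero], mul_zero]
  refine ⟨V.finite_toSet.subset hsupp, ?_⟩
  rw [finsum_eq_sum_of_support_subset _ hsupp, mixedIntegral_eq μ hne, Fintype.card_fin]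
  have hcard : Module.finrank ℝ E + 1 = n + 1 := by rw [hdim]
  rw [sum_weight_eq_of_slopes (n := n)
    (F := fun l => ∫ x in wsum Q l, wfun Q g l x ∂μ)
    (fun s d l hd hl hs => sum_integral_wfun μ (fun i => (hQ i).isHPoly) hne hg hc s hd hl
      (by rwa [hcard])) (hslope V hV)]
  simp only [hface, ← Finset.mul_sum, mul_sub, mul_neg, Finset.sum_sub_distrib,
    Finset.sum_neg_distrib, pow_succ]
  rw [Finset.sum_comm]
  simp only [← Finset.mul_sum]
  ring

end Formula

/-! ### Piecewise affine functions -/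

section PiecewiseAffine

open Filter Topology

variable {E : Type*} [NormedAddCommGroup E] [NormedSpace ℝ E]

/-- The inequalities are those of Q, t ≥ 0, and t ≤ α(x) + c(α) + C for each affine piece. -/
lemma isHPoly_subgraph_add_const {Q : Set E} {g : E → ℝ} (hQ : IsHPoly (id : E → E) ⊤ Q)
    (hQc : IsCompact Q) (hg : ContinuousOn g Q) (hpa : IsPiecewiseAffineOn Q g) {C : ℝ}
    (hC : ∀ x ∈ Q, 0 ≤ g x + C) :
    IsHPoly (id : E × ℝ → E × ℝ) ⊤ (subgraph Q fun x => g x + C) := by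
  classical
  refine ⟨(isCompact_subgraph hQc (hg.add continuousOn_const) hC).isBounded, ?_⟩
  obtain ⟨-, H, -, hH⟩ := hQ
  obtain ⟨S, hS, c, hc⟩ := hpa
  let P : E × ℝ →L[ℝ] E := ContinuousLinearMap.fst ℝ E ℝ
  let T : E × ℝ →L[ℝ] ℝ := ContinuousLinearMap.snd ℝ E ℝ
  refine ⟨H.image (fun h => (h.1.comp P, h.2)) ∪
    insert (T, 0) (S.image fun α => (α.comp P - T, c α + C)), fun _ _ _ => trivial, ?_⟩
  have hQ' : ∀ x, x ∈ Q ↔ ∀ h ∈ H, 0 ≤ h.1 x + h.2 := fun x => by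
    conv_lhs => rw [hH]
    rfl
  ext ⟨x, t⟩
  have hle : x ∈ Q → (t ≤ g x + C ↔ ∀ α ∈ S, 0 ≤ α x - t + (c α + C)) := fun hx => by
    rw [hc x hx, ← sub_le_iff_le_add, Finset.le_inf'_iff]
    refine forall₂_congr fun α _ => ?_
    constructor <;> intro h <;> linarith
  simp only [subgraph, Set.mem_ofPred_eq, Finset.mem_union, Finset.mem_insert, Finset.mem_image]
  constructor
  · rintro ⟨hx, h0, ht⟩ _ (⟨h, hh, rfl⟩ | rfl | ⟨α, hα, rfl⟩)
    · exact (hQ' x).1 hx h hh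
    · simpa [T] using h0
    · exact (hle hx).1 ht α hα
  · intro h
    have hx : x ∈ Q := (hQ' x).2 fun k hk => h _ (Or.inl ⟨k, hk, rfl⟩)
    exact ⟨hx, by simpa [T] using h _ (Or.inr (Or.inl rfl)),
      (hle hx).2 fun α hα => h _ (Or.inr (Or.inr ⟨α, hα, rfl⟩))⟩

variable {ι : Type*} [Fintype ι] {K : ι → Set E} {g : ι → E → ℝ}

/-- The sup-convolutions of piecewise affine functions have supergradients in a finite set. -/
lemma exists_finset_supergradient [FiniteDimensional ℝ E]
    (hK : ∀ i, IsHPoly (id : E → E) ⊤ (K i)) (hne : ∀ i, (K i).Nonempty)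
    (hg : ∀ i, ContinuousOn (g i) (K i)) (hpa : ∀ i, IsPiecewiseAffineOn (K i) (g i)) :
    ∃ S : Finset (StrongDual ℝ E), ∀ l : ι → ℝ, (∀ i, 0 ≤ l i) → ∀ x ∈ wsum K l, ∃ v ∈ S,
      v x - wfun K g l x ≤ legendre (wsum K l) (wfun K g l) v := by
  classical
  have hKc := fun i => (hK i).isCompact
  obtain ⟨C, -, hC⟩ := exists_abs_le hKc hg
  set g' : ι → E → ℝ := fun i x => g i x + C
  have h0 : ∀ i, ∀ x ∈ K i, 0 ≤ g' i x := fun i x hx => by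
    have := (abs_le.1 (hC i x hx)).1
    simp only [g']
    linarith
  have hg' : ∀ i, ContinuousOn (g' i) (K i) := fun i => (hg i).add continuousOn_const
  let b := Module.finBasis ℝ (E × ℝ)
  obtain ⟨U, -, hU⟩ := exists_slopes_wsum b ⊤ (fun i => subgraph (K i) (g' i))
    (fun i => (isHPoly_subgraph_add_const (hK i) (hKc i) (hg i) (hpa i) (h0 i)).mono b)
    (fun i => (hne i).elim fun x hx => ⟨(x, 0), hx, le_rfl, h0 i x hx⟩)
  -- The slope of the hyperplane with normal u, meaningful when u(0, 1) < 0; the other values merely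
  -- enlarge the finite set.
  let r : StrongDual ℝ (E × ℝ) → StrongDual ℝ E := fun u =>
    (-u (0, 1))⁻¹ • u.comp (ContinuousLinearMap.inl ℝ E ℝ)
  refine ⟨U.image r, fun l hl x hx => ?_⟩
  have hUl := hU l hl
  rw [wsum_subgraph hKc hg' h0 hl] at hUl
  set c : StrongDual ℝ (E × ℝ) → ℝ := fun u =>
    ∑ i, l i * supportFun (subgraph (K i) (g' i)) u
  set G := wfun K g' l
  have hG0 : ∀ y ∈ wsum K l, 0 ≤ G y := fun y hy => by
    obtain ⟨z, hz, -, he⟩ := exists_wfun_eq hKc hg' hy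
    simp only [G]
    rw [he]
    exact Finset.sum_nonneg fun i _ => mul_nonneg (hl i) (h0 i _ (hz i))
  have hmem : ∀ y ∈ wsum K l, ∀ u ∈ U, c u ≤ u (y, G y) := fun y hy => by
    have : (y, G y) ∈ subgraph (wsum K l) G := ⟨hy, hG0 y hy, le_rfl⟩
    rw [hUl] at this
    exact this
  have hadd : ∀ (u : StrongDual ℝ (E × ℝ)) y t, u (y, t) = u (y, 0) + t * u (0, 1) :=
    fun u y t => by
      rw [← smul_eq_mul, ← map_smul, ← map_add]
      simp
  -- Some side bounding the subgraph from above is active at the point of the graph over x;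
  -- otherwise that point could be raised within the subgraph. The slope of this side is a
  -- supergradient.
  obtain ⟨u, huU, hux, hu1⟩ : ∃ u ∈ U, u (x, G x) ≤ c u ∧ u (0, 1) < 0 := by
    by_contra! hcon
    have hev : ∀ᶠ ε : ℝ in 𝓝[>] 0, ∀ u ∈ U, c u ≤ u (x, G x + ε) := by
      refine (eventually_all_finset U).2 fun u hu => ?_
      rcases lt_or_ge (c u) (u (x, G x)) with h | h
      · have hcont : Continuous fun ε : ℝ => u (x, G x + ε) := by fun_prop
        have h1 := hcont.tendsto 0
        rw [add_zero] at h1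
        exact nhdsWithin_le_nhds ((h1.eventually (lt_mem_nhds h)).mono fun _ h => h.le)
      · filter_upwards [self_mem_nhdsWithin] with ε hε
        have h1 := hcon u hu h
        have h2 := hmem x hx u hu
        rw [hadd] at h2 ⊢
        have := mul_nonneg (le_of_lt hε) h1
        rw [add_mul]
        linarith
    obtain ⟨ε, hε, hε0⟩ := (hev.and self_mem_nhdsWithin).exists
    have h1 : (x, G x + ε) ∈ subgraph (wsum K l) G := by
      rw [hUl]
      exact hε
    have h2 : G x + ε ≤ G x := h1.2.2
    have h3 : (0 : ℝ) < ε := hε0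
    linarith
  refine ⟨r u, Finset.mem_image_of_mem r huU, le_legendre ⟨x, hx⟩ fun y hy => ?_⟩
  have h1 := hmem y hy u huU
  have h2 : u (x, G x) ≤ u (y, G y) := hux.trans h1
  rw [hadd, hadd u y] at h2
  have h3 : G x = wfun K g l x + (∑ i, l i) * C := wfun_add_const hKc hg C hx
  have h4 : G y = wfun K g l y + (∑ i, l i) * C := wfun_add_const hKc hg C hy
  have hs : 0 < -u (0, 1) := neg_pos.2 hu1
  have h5 : ∀ z, r u z = (-u (0, 1))⁻¹ * u (z, 0) := fun z => rfl
  have h6 : r u x - r u y ≤ G x - G y := by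
    rw [h5, h5, ← mul_sub, inv_mul_eq_div, div_le_iff₀ hs]
    linarith
  linarith

variable [FiniteDimensional ℝ E] [MeasurableSpace E] [BorelSpace E]

/-- Almost everywhere the derivative is the only supergradient, so it is the one found in the finite
set. -/
lemma exists_finset_fderiv_mem (μ : Measure E) [μ.IsAddHaarMeasure]
    (hK : ∀ i, IsHPoly (id : E → E) ⊤ (K i)) (hne : ∀ i, (K i).Nonempty)
    (hg : ∀ i, ContinuousOn (g i) (K i)) (hc : ∀ i, ConcaveOn ℝ (K i) (g i))
    (hpa : ∀ i, IsPiecewiseAffineOn (K i) (g i)) :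
    ∃ S : Finset (StrongDual ℝ E), ∀ l : ι → ℝ, (∀ i, 0 ≤ l i) →
      ∀ᵐ x ∂μ, x ∈ wsum K l → fderiv ℝ (wfun K g l) x ∈ S := by
  have hKc := fun i => (hK i).isCompact
  obtain ⟨S, hS⟩ := exists_finset_supergradient hK hne hg hpa
  refine ⟨S, fun l hl => ?_⟩
  filter_upwards [ae_mem_interior_and_differentiableAt μ (concaveOn_wfun hKc hg hc hl)] with x hx hxQ
  obtain ⟨v, hvS, hv⟩ := hS l hl x hxQ
  rwa [← eq_fderiv_of_legendre_eq (isCompact_wsum hKc l) (continuousOn_wfun hK hne hg hc hl)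
    (hx hxQ).1 (hx hxQ).2 hv]

lemma setIntegral_comp_eq_sum (μ : Measure E) {D : Set E} (hD : MeasurableSet D) (hDf : μ D ≠ ∞)
    {φ : E → StrongDual ℝ E} (hφ : Measurable φ) (S : Finset (StrongDual ℝ E))
    (hS : ∀ᵐ x ∂μ, x ∈ D → φ x ∈ S) (f : StrongDual ℝ E → ℝ) :
    ∫ x in D, f (φ x) ∂μ = ∑ v ∈ S, f v * μ.real (D ∩ φ ⁻¹' {v}) := by
  have hm : ∀ v, MeasurableSet (φ ⁻¹' {v}) := fun v => hφ (measurableSet_singleton v)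
  calc ∫ x in D, f (φ x) ∂μ
      = ∫ x in D, ∑ v ∈ S, (φ ⁻¹' {v}).indicator (fun _ => f v) x ∂μ := by
        refine setIntegral_congr_ae hD ?_
        filter_upwards [hS] with x hx hxD
        rw [Finset.sum_eq_single (φ x)]
        · exact (Set.indicator_of_mem (show x ∈ φ ⁻¹' {φ x} from rfl) fun _ => f (φ x)).symm
        · exact fun v _ hv => Set.indicator_of_notMem (fun h => hv (Eq.symm h)) _
        · exact fun h => absurd (hx hxD) h
    _ = ∑ v ∈ S, ∫ x in D, (φ ⁻¹' {v}).indicator (fun _ => f v) x ∂μ :=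
        integral_finsetSum _ fun v _ => (integrableOn_const hDf).indicator (hm v)
    _ = _ := by
        refine Finset.sum_congr rfl fun v _ => ?_
        rw [setIntegral_indicator (hm v), setIntegral_const, smul_eq_mul, mul_comm]

/-! ### Faces of hypographs -/

/-- The points where `v` is a supergradient of `g`. -/
def gradientCell (Q : Set E) (g : E → ℝ) (v : StrongDual ℝ E) : Set E :=
  {x | x ∈ Q ∧ v x - g x ≤ legendre Q g v}

/-- Minimising v(x) - t over the hypograph forces t = g(x) and v(x) - g(x) minimal. -/
lemma fst_image_face_hypograph {Q : Set E} {g : E → ℝ} (hQ : IsCompact Q) (hg : ContinuousOn g Q)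
    (v : StrongDual ℝ E) :
    Prod.fst '' face (hypograph Q g) (pairing v (-1)) = gradientCell Q g v := by
  have hp : ∀ z : E × ℝ, pairing v (-1) z = v z.1 - z.2 := fun z => by
    simp [pairing, sub_eq_add_neg]
  ext x
  simp only [Set.mem_image, Prod.exists, exists_and_right, exists_eq_right, gradientCell,
    Set.mem_ofPred_eq]
  constructor
  · rintro ⟨t, ⟨hx, ht⟩, h⟩
    dsimp only at hx ht
    refine ⟨hx, le_legendre ⟨x, hx⟩ fun y hy => ?_⟩
    have h1 := h (y, g y) ⟨hy, le_rfl⟩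
    rw [hp, hp] at h1
    dsimp only at h1
    linarith
  · rintro ⟨hx, h⟩
    refine ⟨g x, ⟨hx, le_rfl⟩, ?_⟩
    rintro ⟨y, s⟩ ⟨hy, hs⟩
    dsimp only at hy hs
    rw [hp, hp]
    dsimp only
    linarith [legendre_le hQ hg v hy]

/-- Since the dual of the sup-convolution is the weighted sum of the duals, equality for a
decomposition forces equality in every summand of nonzero weight; a summand of weight zero is
replaced by a minimiser. -/
lemma wsum_gradientCell (hK : ∀ i, IsCompact (K i)) (hne : ∀ i, (K i).Nonempty)
    (hg : ∀ i, ContinuousOn (g i) (K i)) {l : ι → ℝ} (hl : ∀ i, 0 ≤ l i) (v : StrongDual ℝ E) :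
    wsum (fun i => gradientCell (K i) (g i) v) l = gradientCell (wsum K l) (wfun K g l) v := by
  ext x
  constructor
  · rintro ⟨y, hy, rfl⟩
    refine ⟨⟨y, fun i => (hy i).1, rfl⟩, ?_⟩
    rw [legendre_wsum hK hne hg hl, map_sum]
    refine (sub_le_sub_left (le_wfun hK hg fun i => (hy i).1) _).trans ?_
    rw [← Finset.sum_sub_distrib]
    refine Finset.sum_le_sum fun i _ => ?_
    rw [map_smul, smul_eq_mul, ← mul_sub]
    exact mul_le_mul_of_nonneg_left (hy i).2 (hl i)
  · rintro ⟨hx, h⟩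
    obtain ⟨y, hy, rfl, he⟩ := exists_wfun_eq hK hg hx
    rw [legendre_wsum hK hne hg hl, he, map_sum, ← Finset.sum_sub_distrib] at h
    choose q hq hqe using fun i => exists_legendre_eq (hK i) (hne i) (hg i) v
    have hle : ∀ i ∈ Finset.univ, l i * legendre (K i) (g i) v ≤ v (l i • y i) - l i * g i (y i) :=
      fun i _ => by
        rw [map_smul, smul_eq_mul, ← mul_sub]
        exact mul_le_mul_of_nonneg_left (legendre_le (hK i) (hg i) v (hy i)) (hl i)
    have heq := (Finset.sum_eq_sum_iff_of_le hle).1 (le_antisymm (Finset.sum_le_sum hle) h)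
    have hcell : ∀ i, ∃ z ∈ gradientCell (K i) (g i) v, l i • z = l i • y i := by
      intro i
      by_cases h0 : l i = 0
      · exact ⟨q i, ⟨hq i, (hqe i).le⟩, by rw [h0, zero_smul, zero_smul]⟩
      · refine ⟨y i, ⟨hy i, ?_⟩, rfl⟩
        have h1 := heq i (Finset.mem_univ i)
        rw [map_smul, smul_eq_mul, ← mul_sub] at h1
        exact (mul_left_cancel₀ h0 h1).ge
    choose z hz hzy using hcell
    exact ⟨z, hz, Finset.sum_congr rfl fun i _ => hzy i⟩

lemma measureReal_gradientCell (μ : Measure E) [μ.IsAddHaarMeasure] {Q : Set E} {g : E → ℝ}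
    (hQ : IsCompact Q) (hc : ConcaveOn ℝ Q g) (hg : ContinuousOn g Q) (v : StrongDual ℝ E) :
    μ.real (gradientCell Q g v) = μ.real (Q ∩ fderiv ℝ g ⁻¹' {v}) := by
  refine measureReal_congr (eventuallyEq_set.2 ?_)
  filter_upwards [ae_mem_interior_and_differentiableAt μ hc] with x hx
  constructor
  · rintro ⟨hxQ, h⟩
    exact ⟨hxQ, (eq_fderiv_of_legendre_eq hQ hg (hx hxQ).1 (hx hxQ).2 h).symm⟩
  · rintro ⟨hxQ, h⟩
    have h : fderiv ℝ g x = v := h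
    refine ⟨hxQ, ?_⟩
    rw [← h, legendre_fderiv hQ hc hg hxQ (hx hxQ).2]

lemma mixedVolume_eq [Nontrivial E] (μ : Measure E) [μ.IsAddHaarMeasure] {C : ι → Set E}
    (hne : ∀ i, (C i).Nonempty) : mixedVolume μ C = (-1) ^ Fintype.card ι *
      ∑ I, (-1) ^ I.card * μ.real (wsum C (weight I)) := by
  rw [mixedVolume, sum_nonempty_eq (fun I => μ.real (∑ i ∈ I, C i))]
  · simp only [sum_eq_wsum hne]
  · rw [Finset.sum_empty, Measure.real, show (0 : Set E) = {0} from rfl, measure_singleton]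
    rfl

/-- For piecewise affine functions, the mixed Monge-Ampère measure is discrete. -/
theorem finsum_mul_mixedVolume_eq [Nontrivial E] (μ : Measure E) [μ.IsAddHaarMeasure]
    (hK : ∀ i, IsHPoly (id : E → E) ⊤ (K i)) (hne : ∀ i, (K i).Nonempty)
    (hg : ∀ i, ContinuousOn (g i) (K i)) (hc : ∀ i, ConcaveOn ℝ (K i) (g i))
    (hpa : ∀ i, IsPiecewiseAffineOn (K i) (g i)) (f : StrongDual ℝ E → ℝ) :
    (Function.support fun v => f v * mixedVolume μ fun i =>
      Prod.fst '' face (hypograph (K i) (g i)) (pairing v (-1))).Finite ∧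
    ∑ᶠ v, f v * mixedVolume μ (fun i =>
        Prod.fst '' face (hypograph (K i) (g i)) (pairing v (-1))) =
      (-1) ^ Fintype.card ι * ∑ I, (-1) ^ I.card *
        ∫ x in wsum K (weight I), f (fderiv ℝ (wfun K g (weight I)) x) ∂μ := by
  have hKc := fun i => (hK i).isCompact
  have hcpt := fun I : Finset ι => isCompact_wsum hKc (weight I)
  obtain ⟨S, hS⟩ := exists_finset_fderiv_mem μ hK hne hg hc hpa
  let m : Finset ι → StrongDual ℝ E → ℝ := fun I v =>
    μ.real (wsum K (weight I) ∩ fderiv ℝ (wfun K g (weight I)) ⁻¹' {v})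
  have hMV : ∀ v, mixedVolume μ (fun i =>
      Prod.fst '' face (hypograph (K i) (g i)) (pairing v (-1))) =
      (-1) ^ Fintype.card ι * ∑ I, (-1) ^ I.card * m I v := by
    intro v
    simp only [fst_image_face_hypograph (hKc _) (hg _)]
    rw [mixedVolume_eq μ fun i => ?_]
    · refine congrArg _ (Finset.sum_congr rfl fun I _ => ?_)
      rw [wsum_gradientCell hKc hne hg (weight_nonneg I), measureReal_gradientCell μ (hcpt I)
        (concaveOn_wfun hKc hg hc (weight_nonneg I))
        (continuousOn_wfun hK hne hg hc (weight_nonneg I))]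
    · obtain ⟨q, hq, hqe⟩ := exists_legendre_eq (hKc i) (hne i) (hg i) v
      exact ⟨q, hq, hqe.le⟩
  -- The set where the gradient equals v is null unless v belongs to the finite set of possible
  -- gradients.
  have hm : ∀ v ∉ S, ∀ I, m I v = 0 := by
    intro v hv I
    refine (measureReal_eq_zero_iff ((measure_mono Set.inter_subset_left).trans_lt
      (hcpt I).measure_lt_top).ne).2 (measure_eq_zero_iff_ae_notMem.2 ?_)
    filter_upwards [hS _ (weight_nonneg I)] with x hx hxm
    exact hv ((show fderiv ℝ (wfun K g (weight I)) x = v from hxm.2) ▸ hx hxm.1)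
  have hsupp : (Function.support fun v => f v * mixedVolume μ fun i =>
      Prod.fst '' face (hypograph (K i) (g i)) (pairing v (-1))) ⊆ S := by
    intro v hv
    by_contra hcon
    refine hv ?_
    dsimp only
    rw [hMV, Finset.sum_eq_zero fun I _ => by rw [hm v hcon I, mul_zero], mul_zero, mul_zero]
  refine ⟨S.finite_toSet.subset hsupp, ?_⟩
  rw [finsum_eq_sum_of_support_subset _ hsupp]
  have hint : ∀ I : Finset ι, ∫ x in wsum K (weight I), f (fderiv ℝ (wfun K g (weight I)) x) ∂μ =
      ∑ v ∈ S, f v * m I v := fun I =>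
    setIntegral_comp_eq_sum μ (hcpt I).isClosed.measurableSet (hcpt I).measure_lt_top.ne
      (measurable_fderiv ℝ _) S (hS _ (weight_nonneg I)) f
  simp only [hMV, hint, Finset.mul_sum]
  rw [Finset.sum_comm]
  refine Finset.sum_congr rfl fun I _ => Finset.sum_congr rfl fun v _ => ?_
  ring

end PiecewiseAffine

end MixedInt

end

/-! ### The theorem -/

theorem theorem1p3 {E : Type*} [NormedAddCommGroup E] [NormedSpace ℝ E] [FiniteDimensional ℝ E]
    [MeasurableSpace E] [BorelSpace E]
    (M : Submodule ℤ E) [DiscreteTopology M] [IsZLattice ℝ M]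
    (n : ℕ) (hn : 1 ≤ n) (hdim : Module.finrank ℝ E = n)
    (Q : Fin (n + 1) → Set E) (g : Fin (n + 1) → E → ℝ)
    (hQ : ∀ i, MixedInt.IsRationalPolytope M (Q i)) (hQne : ∀ i, (Q i).Nonempty)
    (hconc : ∀ i, ConcaveOn ℝ (Q i) (g i)) (hcont : ∀ i, ContinuousOn (g i) (Q i))
    -- arbitrary base points of the faces, used to move them into the hyperplanes `u^⊥`
    (p : {u : StrongDual ℝ E // MixedInt.IsPrimitive M u} → Fin n → E)
    (hp : ∀ (u : {u : StrongDual ℝ E // MixedInt.IsPrimitive M u}) (i : Fin n),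
      p u i ∈ MixedInt.face (Q (Fin.succ i)) u) :
    ((Function.support fun u : {u : StrongDual ℝ E // MixedInt.IsPrimitive M u} =>
          MixedInt.supportFun (Q 0) u *
            MixedInt.faceMixedIntegral M u (p u) (fun i => Q (Fin.succ i))
              (fun i => g (Fin.succ i))).Finite ∧
      (MixedInt.mixedMongeAmpere (MixedInt.latticeVolume M)
          (fun i : Fin n => MixedInt.legendre (Q (Fin.succ i)) (g (Fin.succ i)))).Integrable
        (MixedInt.legendre (Q 0) (g 0)) ∧
      MixedInt.mixedIntegral (MixedInt.latticeVolume M) Q g =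
        -(∑ᶠ u : {u : StrongDual ℝ E // MixedInt.IsPrimitive M u},
            MixedInt.supportFun (Q 0) u *
              MixedInt.faceMixedIntegral M u (p u) (fun i => Q (Fin.succ i))
                (fun i => g (Fin.succ i)))
          - ∫ᵛ v, MixedInt.legendre (Q 0) (g 0) v
              ∂•(MixedInt.mixedMongeAmpere (MixedInt.latticeVolume M)
                  (fun i : Fin n => MixedInt.legendre (Q (Fin.succ i)) (g (Fin.succ i))))) ∧
    ((∀ i, MixedInt.IsPiecewiseAffineOn (Q i) (g i)) →
      (Function.support fun v : StrongDual ℝ E =>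
          MixedInt.legendre (Q 0) (g 0) v *
            MixedInt.mixedVolume (MixedInt.latticeVolume M) (fun i : Fin n =>
              Prod.fst '' MixedInt.face
                (MixedInt.hypograph (Q (Fin.succ i)) (g (Fin.succ i)))
                (MixedInt.pairing v (-1)))).Finite ∧
      MixedInt.mixedIntegral (MixedInt.latticeVolume M) Q g =
        -(∑ᶠ u : {u : StrongDual ℝ E // MixedInt.IsPrimitive M u},
            MixedInt.supportFun (Q 0) u *
              MixedInt.faceMixedIntegral M u (p u) (fun i => Q (Fin.succ i))
                (fun i => g (Fin.succ i)))
          - ∑ᶠ v : StrongDual ℝ E,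
              MixedInt.legendre (Q 0) (g 0) v *
                MixedInt.mixedVolume (MixedInt.latticeVolume M) (fun i : Fin n =>
                  Prod.fst '' MixedInt.face
                    (MixedInt.hypograph (Q (Fin.succ i)) (g (Fin.succ i)))
                    (MixedInt.pairing v (-1)))) := by
  -- Positive dimension makes points null, so the empty index set contributes nothing to the
  -- gradient integrals and the mixed volumes.
  have : Nontrivial E := Module.nontrivial_of_finrank_pos (R := ℝ) (by omega)
  have hK : ∀ i : Fin n, MixedInt.IsHPoly (id : E → E) ⊤ (Q (Fin.succ i)) := fun i =>
    (hQ _).isHPoly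
  obtain ⟨C, hC⟩ := MixedInt.exists_lipschitzWith_legendre (hQ 0).isHPoly.isCompact (hQne 0)
    (hcont 0)
  obtain ⟨hfin, hMI⟩ := MixedInt.mixedIntegral_eq_sub M n hdim hQ hQne hconc hcont p hp
  obtain ⟨hint, hMA⟩ := MixedInt.integral_mixedMongeAmpere (MixedInt.latticeVolume M) hK
    (fun i => hQne _) (fun i => hcont _) (fun i => hconc _) hC
  rw [Fintype.card_fin] at hMA
  refine ⟨⟨hfin, hint, by rw [hMI, hMA]⟩, fun hpa => ?_⟩
  obtain ⟨hfin', hsum⟩ := MixedInt.finsum_mul_mixedVolume_eq (MixedInt.latticeVolume M) hK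
    (fun i => hQne _) (fun i => hcont _) (fun i => hconc _) (fun i => hpa _)
    (MixedInt.legendre (Q 0) (g 0))
  rw [Fintype.card_fin] at hsum
  exact ⟨hfin', by rw [hMI, hsum]⟩
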